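/- Let $k$ be an algebraically closed field of characteristic zero and $H$ a Hopf algebra over $k$ with bijective antipode $S$; write $\Delta(h)=\sum h_1\otimes h_2$. Let $R=\bigoplus_{i\ge 0}R_i$ be a connected graded $k$-algebra (that is, $R_0=k$) which is left and right Noetherian, and which is a left graded $H$-module algebra: $R$ is a left $H$-module with $h(rs)=\sum (h_1r)(h_2s)$ and $h1=\varepsilon(h)1$, and each $R_i$ is an $H$-submodule. Assume that $R$ is Koszul. That is, $V=R_1$ is finite dimensional, $R=T(V)/(I)$ with $I\subseteq V\otimes V$, and the trivial left $R$-module $k$ has a graded projective resolution $\cdots\to P_1\to P_0\to k\to 0$ with each $P_n$ generated in degree $n$. Assume also that $R$ is AS-regular. That is, $R$ has finite global dimension, and for some integers $n\ge 0$ and $l$ the modules ${}_RR$ and $R_R$ both have injective dimension $n$, and $\underline{\mathrm{Ext}}^i_R(k,R)\cong\underline{\mathrm{Ext}}^i_{R^{op}}(k,R)$ is $0$ for $i\ne n$ and is $k(l)$ for $i=n$. Let $d$ be the global dimension of $R$. Let $R^!=T(V^*)/(I^\perp)$ be the quadratic dual, where $I^\perp\subseteq V^*\otimes V^*$ is the orthogonal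 space of $I$ for the pairing $\langle f_2\otimes f_1,x_1\otimes x_2\rangle=f_1(x_1)f_2(x_2)$. Let $\triangleleft$ be the right action of $H$ on $R^!$ that is determined by $(f\triangleleft h)(v)=f(hv)$ for $f\in V^*$, $v\in V$, by $1\triangleleft h=\varepsilon(h)1$ and by $(xy)\triangleleft h=\sum (x\triangleleft h_2)(y\triangleleft h_1)$. Then $R^!_d$ is one-dimensional: $R^!_d=k\lambda$ for some $\lambda\neq 0$. Moreover, the homological determinant of the $H$-action on $R$ exists and is given by $$\mathrm{hdet}(h)\,\lambda=\lambda\triangleleft h\qquad\text{for all }h\in H .$$ Here the homological determinant is defined as follows. The $H$-action on $\underline{\mathrm{Ext}}^n_R(k,R)$, with $n$ the injective dimension of $R$, is induced by $(h\cdot F)(x)=\sum h_2F(S^{-1}(h_1)x)$ on $\underline{\mathrm{Hom}}_R(B,R)$, where $B_m=R\otimes R^{\otimes m}$ is the bar resolution of $k$ with the diagonal action of $H$. For a nonzero element $e\in\underline{\mathrm{Ext}}^n_R(k,R)$ there is an algebra homomorphism $\eta:H\to k$ with $h\cdot e=\eta(h)e$ for all $h\in H$, and $\mathrm{hdet}=\eta\circ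 S$. -/

import Mathlib

open scoped TensorProduct DirectSum

universe u v w

noncomputable section

/-! ### Graded algebras and Hopf module algebras -/

/-- An `ℕ`-graded algebra is connected if its degree zero part is the ground field. -/
class IsConnectedGraded {k : Type u} [Field k] {R : Type v} [Ring R] [Algebra k R]
    (𝒜 : ℕ → Submodule k R) : Prop where
  nontrivial : Nontrivial R
  zero_eq : 𝒜 0 = LinearMap.range (Algebra.linearMap k R)

/-- `R` is a left `H`-module algebra, `h (r s) = ∑ (h₁ r) (h₂ s)` and `h 1 = ε(h) 1`, and each
homogeneous component is an `H`-submodule. -/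
class IsGradedModuleAlgebra (k : Type u) [Field k] (H : Type w) [Ring H] [HopfAlgebra k H]
    {R : Type v} [Ring R] [Algebra k R] [Module H R] [IsScalarTower k H R]
    (𝒜 : ℕ → Submodule k R) : Prop where
  smul_mul : ∀ (h : H) (r s : R), h • (r * s) =
    LinearMap.mul' k R (TensorProduct.map
      ((LinearMap.toSpanSingleton H R r).restrictScalars k)
      ((LinearMap.toSpanSingleton H R s).restrictScalars k) (Coalgebra.comul (R := k) h))
  smul_one : ∀ h : H, h • (1 : R) = algebraMap k R (Coalgebra.counit (R := k) h)
  smul_mem : ∀ (n : ℕ) (h : H) (r : R), r ∈ 𝒜 n → h • r ∈ 𝒜 n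

section Augmentation

variable {k : Type u} [Field k] {R : Type v} [Ring R] [Algebra k R]
  (𝒜 : ℕ → Submodule k R) [GradedAlgebra 𝒜] [IsConnectedGraded 𝒜]

theorem bijective_ofId_zero : Function.Bijective (Algebra.ofId k (𝒜 0)) := by
  have := IsConnectedGraded.nontrivial (𝒜 := 𝒜)
  constructor
  · intro a b hab
    have h := congrArg (Subtype.val) hab
    exact (algebraMap k R).injective h
  · rintro ⟨x, hx⟩
    have hx' := hx
    rw [IsConnectedGraded.zero_eq (𝒜 := 𝒜)] at hx'
    obtain ⟨c, rfl⟩ := hx'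
    exact ⟨c, Subtype.ext rfl⟩

/-- The projection of a graded algebra onto its degree zero part. -/
def projZero : R →ₐ[k] 𝒜 0 :=
  { GradedRing.projZeroRingHom' 𝒜 with
    commutes' := fun c => GradedRing.projZeroRingHom'_apply_coe 𝒜 (algebraMap k (𝒜 0) c) }

/-- The augmentation `ε : R → R₀ = k` of a connected graded algebra. -/
def augmentation : R →ₐ[k] k :=
  ((AlgEquiv.ofBijective (Algebra.ofId k (𝒜 0)) (bijective_ofId_zero 𝒜)).symm.toAlgHom).comp
    (projZero 𝒜)

end Augmentation

/-! ### Quadratic and Koszul algebras -/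

section Quadratic

variable {k : Type u} [Field k] {R : Type v} [Ring R] [Algebra k R] (𝒜 : ℕ → Submodule k R)

/-- The space `I ⊆ V ⊗ V` of quadratic relations, `V = R₁`: the kernel of the multiplication. -/
def quadraticRelations : Submodule k (𝒜 1 ⊗[k] 𝒜 1) :=
  LinearMap.ker (LinearMap.mul' k R ∘ₗ TensorProduct.map (𝒜 1).subtype (𝒜 1).subtype)

/-- The inclusion `W ⊗ W → T(W)`. -/
def tensorSquare (W : Type*) [AddCommGroup W] [Module k W] : W ⊗[k] W →ₗ[k] TensorAlgebra k W :=
  LinearMap.mul' k (TensorAlgebra k W) ∘ₗ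
    TensorProduct.map (TensorAlgebra.ι k) (TensorAlgebra.ι k)

/-- `R` is quadratic: `V = R₁` is finite dimensional and the canonical map `T(V) → R` is onto with
kernel the two-sided ideal `(I)` generated by the quadratic relations. -/
structure IsQuadratic : Prop where
  finite : FiniteDimensional k (𝒜 1)
  surjective : Function.Surjective (TensorAlgebra.lift k (𝒜 1).subtype)
  ker_eq : TwoSidedIdeal.ker (TensorAlgebra.lift k (𝒜 1).subtype) =
    TwoSidedIdeal.span (tensorSquare (k := k) (𝒜 1) '' (quadraticRelations 𝒜 : Set (𝒜 1 ⊗[k] 𝒜 1)))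

/-- The pairing `⟨f₂ ⊗ f₁, x₁ ⊗ x₂⟩ = f₁(x₁) f₂(x₂)` of `V* ⊗ V*` with `V ⊗ V`. -/
def reversePairing (W : Type*) [AddCommGroup W] [Module k W] :
    Module.Dual k W ⊗[k] Module.Dual k W →ₗ[k] Module.Dual k (W ⊗[k] W) :=
  TensorProduct.dualDistrib k W W ∘ₗ
    (TensorProduct.comm k (Module.Dual k W) (Module.Dual k W)).toLinearMap

/-- The orthogonal space `I^⊥ ⊆ V* ⊗ V*`. -/
def orthogonalRelations : Submodule k (Module.Dual k (𝒜 1) ⊗[k] Module.Dual k (𝒜 1)) where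
  carrier := {t | ∀ x ∈ quadraticRelations 𝒜, reversePairing (𝒜 1) t x = 0}
  add_mem' ha hb x hx := by simp [ha x hx, hb x hx]
  zero_mem' x _ := by simp
  smul_mem' c t ht x hx := by simp [ht x hx]

/-- The defining relations of the quadratic dual: every element of `I^⊥` is set to zero. -/
def quadraticDualRel (a b : TensorAlgebra k (Module.Dual k (𝒜 1))) : Prop :=
  ∃ t ∈ orthogonalRelations 𝒜, a = tensorSquare (k := k) (Module.Dual k (𝒜 1)) t ∧ b = 0

/-- The quadratic dual `R^! = T(V*)/(I^⊥)`. -/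
abbrev QuadraticDual : Type (max u v) := RingQuot (quadraticDualRel 𝒜)

/-- The canonical map `V* → R^!`. -/
def quadraticDualι : Module.Dual k (𝒜 1) →ₗ[k] QuadraticDual 𝒜 :=
  (RingQuot.mkAlgHom k (quadraticDualRel 𝒜)).toLinearMap ∘ₗ TensorAlgebra.ι k

/-- The homogeneous component `R^!_n`, the image of `(V*)^{⊗ n}`. -/
def quadraticDualComponent (n : ℕ) : Submodule k (QuadraticDual 𝒜) :=
  (LinearMap.range (quadraticDualι 𝒜)) ^ n

/-- A graded projective resolution `⋯ → P₁ → P₀ → k → 0` of the trivial left module such that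
`P_n` is generated in degree `n`. -/
structure LinearResolution [GradedAlgebra 𝒜] [IsConnectedGraded 𝒜] where
  P : ℕ → Type v
  [addCommGroup : ∀ n, AddCommGroup (P n)]
  [module : ∀ n, Module R (P n)]
  /-- the homogeneous components of `P n` -/
  gr : ∀ n, ℤ → AddSubgroup (P n)
  isInternal : ∀ n, DirectSum.IsInternal (gr n)
  smul_mem : ∀ (n a : ℕ) (j : ℤ) (r : R) (p : P n), r ∈ 𝒜 a → p ∈ gr n j → r • p ∈ gr n (a + j)
  projective : ∀ n, Module.Projective R (P n)
  generated : ∀ n, Submodule.span R (gr n n : Set (P n)) = ⊤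
  d : ∀ n, P (n + 1) →ₗ[R] P n
  d_mem : ∀ (n : ℕ) (j : ℤ) (p : P (n + 1)), p ∈ gr (n + 1) j → d n p ∈ gr n j
  /-- the map `P₀ → k`, where `k` is the trivial module concentrated in degree `0` -/
  π : P 0 →+ k
  π_smul : ∀ (r : R) (p : P 0), π (r • p) = augmentation 𝒜 r * π p
  π_degree : ∀ (j : ℤ) (p : P 0), p ∈ gr 0 j → j ≠ 0 → π p = 0
  π_surjective : Function.Surjective π
  exact_zero : Function.Exact (d 0) π
  exact_succ : ∀ n, Function.Exact (d (n + 1)) (d n)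

/-- Koszul algebras. -/
def IsKoszul [GradedAlgebra 𝒜] [IsConnectedGraded 𝒜] : Prop :=
  IsQuadratic 𝒜 ∧ Nonempty (LinearResolution 𝒜)

end Quadratic

/-! ### The bar resolution of the trivial module and graded `Ext` -/

section Bar

variable {k : Type u} [Field k] {A : Type v} [Ring A] [Algebra k A]
  (𝒜 : ℕ → Submodule k A) (ε : A →ₐ[k] k)

variable (k A) in
/-- The terms `B_n = A ⊗ A^{⊗ n}` of the bar resolution of the trivial left `A`-module. -/
def barTerm : ℕ → ModuleCat.{v} k
  | 0 => ModuleCat.of k A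
  | n + 1 => ModuleCat.of k (A ⊗[k] barTerm n)

/-- Left multiplication by `a ∈ A` on `B_n`, on the first tensor factor. -/
def barSMul (a : A) : (n : ℕ) → barTerm k A n →ₗ[k] barTerm k A n
  | 0 => LinearMap.mulLeft k a
  | n + 1 => LinearMap.rTensor (barTerm k A n) (LinearMap.mulLeft k a)

/-- The multiplication map `A ⊗ B_n → B_n`. -/
def barMul : (n : ℕ) → A ⊗[k] barTerm k A n →ₗ[k] barTerm k A n
  | 0 => LinearMap.mul' k A
  | n + 1 => LinearMap.rTensor (barTerm k A n) (LinearMap.mul' k A) ∘ₗ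
      (TensorProduct.assoc k A A (barTerm k A n)).symm.toLinearMap

/-- The bar differential `B_{n+1} → B_n`,
`a₀ ⊗ ⋯ ⊗ a_{n+1} ↦ ∑_{i ≤ n} (-1)^i a₀ ⊗ ⋯ ⊗ aᵢ aᵢ₊₁ ⊗ ⋯ ⊗ a_{n+1}
  + (-1)^{n+1} a₀ ⊗ ⋯ ⊗ a_n ε(a_{n+1})`,
written recursively as `d (a ⊗ b) = a b - a ⊗ d b`, with `d b = ε(b)` for `b ∈ B₀`. -/
def barD : (n : ℕ) → barTerm k A (n + 1) →ₗ[k] barTerm k A n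
  | 0 => LinearMap.mul' k A -
      (TensorProduct.rid k A).toLinearMap ∘ₗ LinearMap.lTensor A ε.toLinearMap
  | n + 1 => barMul (n + 1) - LinearMap.lTensor A (barD n)

/-- The homogeneous component of degree `m` of `B_n` for the total degree. -/
def barGrade : (n : ℕ) → ℕ → Submodule k (barTerm k A n)
  | 0, m => 𝒜 m
  | n + 1, m => Submodule.span k
      {x : A ⊗[k] barTerm k A n | ∃ i j : ℕ, i + j = m ∧
        ∃ a ∈ 𝒜 i, ∃ b ∈ barGrade n j, x = a ⊗ₜ[k] b}

/-- An `ℕ`-grading extended by zero to all integer degrees. -/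
def intGrade (j : ℤ) : Submodule k A := if 0 ≤ j then 𝒜 j.toNat else ⊥

/-- The graded maps of degree zero `B_n → A(j)`, that is `A`-linear maps `B_n → A` raising degrees
by `j`. The whole `\underline{Hom}_A(B_n, A)` is the sum of these over `j ∈ ℤ`. -/
def barCochain (n : ℕ) (j : ℤ) : Submodule k (barTerm k A n →ₗ[k] A) where
  carrier := {F | (∀ a x, F (barSMul a n x) = a * F x) ∧
    ∀ (m : ℕ), ∀ x ∈ barGrade 𝒜 n m, F x ∈ intGrade 𝒜 (j + m)}
  add_mem' hF hG := ⟨fun a x => by simp [hF.1, hG.1, mul_add],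
    fun m x hx => add_mem (hF.2 m x hx) (hG.2 m x hx)⟩
  zero_mem' := ⟨fun a x => by simp, fun m x _ => by simp⟩
  smul_mem' c F hF := ⟨fun a x => by simp [hF.1],
    fun m x hx => Submodule.smul_mem _ c (hF.2 m x hx)⟩

/-- Cocycles of degree `j` in `\underline{Hom}_A(B_n, A)`. -/
def barCocycle (n : ℕ) (j : ℤ) : Submodule k (barTerm k A n →ₗ[k] A) :=
  barCochain 𝒜 n j ⊓ LinearMap.ker (LinearMap.lcomp k A (barD ε n))

/-- Coboundaries of degree `j` in `\underline{Hom}_A(B_n, A)`. -/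
def barCoboundary : (n : ℕ) → (j : ℤ) → Submodule k (barTerm k A n →ₗ[k] A)
  | 0, _ => ⊥
  | n + 1, j => (barCochain 𝒜 n j).map (LinearMap.lcomp k A (barD ε n))

/-- The degree `j` part of the graded Ext space `\underline{Ext}^n_A(k, A)`: the space of cocycles
modulo coboundaries, realized as the image of the cocycles in the quotient by the coboundaries. -/
def gradedExt (n : ℕ) (j : ℤ) :
    Submodule k ((barTerm k A n →ₗ[k] A) ⧸ barCoboundary 𝒜 ε n j) :=
  (barCocycle 𝒜 ε n j).map (barCoboundary 𝒜 ε n j).mkQ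

/-- `\underline{Ext}^i_A(k, A)` is zero for `i ≠ n` and is `k(l)` for `i = n`, where `k(l)` is
one-dimensional and concentrated in degree `-l` (so its module structure is the trivial one). -/
def HasGorensteinExt (n : ℕ) (l : ℤ) : Prop :=
  ∀ (i : ℕ) (j : ℤ), Module.rank k (gradedExt 𝒜 ε i j) = if i = n ∧ j = -l then 1 else 0

end Bar

/-! ### AS-regular algebras -/

section ASRegular

variable {k : Type u} [Field k] {R : Type v} [Ring R] [Algebra k R]
  (𝒜 : ℕ → Submodule k R) [GradedAlgebra 𝒜] [IsConnectedGraded 𝒜]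

/-- The grading of the opposite algebra. -/
def opGrade (n : ℕ) : Submodule k Rᵐᵒᵖ :=
  (𝒜 n).map (MulOpposite.opLinearEquiv k : R ≃ₗ[k] Rᵐᵒᵖ).toLinearMap

/-- The augmentation of the opposite algebra. -/
def opAugmentation : Rᵐᵒᵖ →ₐ[k] k :=
  (augmentation 𝒜).fromOpposite fun _ _ => Commute.all _ _

/-- The injective dimension of a ring as a left module over itself. -/
def selfInjectiveDimension (A : Type v) [Ring A] : WithBot ℕ∞ :=
  CategoryTheory.injectiveDimension (ModuleCat.of A A)

/-- The (left) global dimension of a ring. -/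
def globalDimension (A : Type v) [Ring A] : WithBot ℕ∞ :=
  ⨆ M : ModuleCat.{v} A, CategoryTheory.projectiveDimension M

/-- AS-Gorenstein algebras with parameters `(n, l)`. Right `R`-modules are left modules over the
opposite algebra. -/
structure IsASGorenstein (n : ℕ) (l : ℤ) : Prop where
  injDim_left : selfInjectiveDimension R = n
  injDim_right : selfInjectiveDimension Rᵐᵒᵖ = n
  ext_left : HasGorensteinExt 𝒜 (augmentation 𝒜) n l
  ext_right : HasGorensteinExt (opGrade 𝒜) (opAugmentation 𝒜) n l

/-- AS-regular algebras. -/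
def IsASRegular : Prop :=
  (∃ (n : ℕ) (l : ℤ), IsASGorenstein 𝒜 n l) ∧ ∃ m : ℕ, globalDimension R ≤ m

end ASRegular

/-! ### Hopf actions on `\underline{Ext}` and the homological determinant -/

section Hdet

variable {k : Type u} [Field k] {H : Type w} [Ring H] [HopfAlgebra k H]
  {R : Type v} [Ring R] [Algebra k R] [Module H R] [IsScalarTower k H R]

/-- The action of `H` on `R` as a linear map. -/
def hopfAct : H →ₗ[k] R →ₗ[k] R := (Algebra.lsmul k k R).toLinearMap

/-- The diagonal action of `H` on `B_n = R ⊗ R^{⊗ n}`. -/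
def barAct : (n : ℕ) → H →ₗ[k] barTerm k R n →ₗ[k] barTerm k R n
  | 0 => (hopfAct : H →ₗ[k] R →ₗ[k] R)
  | n + 1 => TensorProduct.lift
      ((TensorProduct.mapBilinear (RingHom.id k) R (barTerm k R n) R (barTerm k R n)).compl₁₂
        hopfAct (barAct n)) ∘ₗ Coalgebra.comul

/-- The action of `H` on maps `B_n → R`: `(h · F)(x) = ∑ h₂ F(S⁻¹(h₁) x)`. -/
def cochainAct (hS : Function.Bijective (HopfAlgebra.antipode k (A := H))) (n : ℕ) (h : H)
    (F : barTerm k R n →ₗ[k] R) : barTerm k R n →ₗ[k] R :=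
  TensorProduct.lift
    (LinearMap.mk₂ k
      (fun a b : H => hopfAct b ∘ₗ F ∘ₗ
        barAct n ((LinearEquiv.ofBijective (HopfAlgebra.antipode k (A := H)) hS).symm a))
      (fun a a' b => by ext; simp) (fun c a b => by ext; simp)
      (fun a b b' => by ext; simp) (fun c a b => by ext; simp))
    (Coalgebra.comul (R := k) h)

variable (𝒜 : ℕ → Submodule k R) [GradedAlgebra 𝒜] [IsConnectedGraded 𝒜]

/-- `χ` is the homological determinant of the `H`-action on `R`: with `n` the injective dimension
of `R`, there are a nonzero class `e` in `\underline{Ext}^n_R(k, R)`, represented by a cocycle `F`,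
and an algebra homomorphism `η : H → k` such that `h · e = η(h) e` for all `h`, and `χ = η ∘ S`.
Here `\underline{Ext}^n_R(k, R)` is the sum over `j` of its components of degree `j`, and `h · e`
is the class of `h · F`. -/
def IsHomologicalDeterminant (hS : Function.Bijective (HopfAlgebra.antipode k (A := H)))
    (χ : H →ₗ[k] k) : Prop :=
  ∃ n : ℕ, selfInjectiveDimension R = n ∧
    ∃ F ∈ ⨆ j, barCocycle 𝒜 (augmentation 𝒜) n j,
      F ∉ ⨆ j, barCoboundary 𝒜 (augmentation 𝒜) n j ∧
      ∃ η : H →ₐ[k] k,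
        (∀ h : H, cochainAct hS n h F - η h • F ∈ ⨆ j, barCoboundary 𝒜 (augmentation 𝒜) n j) ∧
        χ = η.toLinearMap ∘ₗ HopfAlgebra.antipode k

end Hdet

/-! ### The right action of `H` on the quadratic dual -/

section DualAction

variable {k : Type u} [Field k] {H : Type w} [Ring H] [HopfAlgebra k H]
  {R : Type v} [Ring R] [Algebra k R] [Module H R] [IsScalarTower k H R]
  (𝒜 : ℕ → Submodule k R) [IsGradedModuleAlgebra k H 𝒜]

/-- The action of `H` on `V = R₁`. -/
def degOneAct : H →ₗ[k] 𝒜 1 →ₗ[k] 𝒜 1 where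
  toFun h := (hopfAct h).restrict fun r hr => IsGradedModuleAlgebra.smul_mem (k := k) 1 h r hr
  map_add' a b := LinearMap.ext fun x => Subtype.ext (add_smul a b (x : R))
  map_smul' c a := LinearMap.ext fun x => Subtype.ext (smul_assoc c a (x : R))

/-- The right action `(f ◁ h)(v) = f (h v)` on `V*`, as the map `f ↦ (h ↦ f ◁ h)`. -/
def dualAct : Module.Dual k (𝒜 1) →ₗ[k] H →ₗ[k] Module.Dual k (𝒜 1) :=
  LinearMap.mk₂ k (fun f h => f ∘ₗ degOneAct 𝒜 h)
    (fun f g h => by ext; simp) (fun c f h => by ext; simp)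
    (fun f h h' => by ext; simp) (fun c f h => by ext; simp)

@[simp] theorem dualAct_apply (f : Module.Dual k (𝒜 1)) (h : H) (x : 𝒜 1) :
    dualAct 𝒜 f h x = f (degOneAct 𝒜 h x) := rfl

/-- The action on `V ⊗ V`, `h (x ⊗ y) = ∑ h₁ x ⊗ h₂ y`, as a function of `h₁ ⊗ h₂`. -/
def sqAct : H ⊗[k] H →ₗ[k] 𝒜 1 ⊗[k] 𝒜 1 →ₗ[k] 𝒜 1 ⊗[k] 𝒜 1 :=
  TensorProduct.lift
    ((TensorProduct.mapBilinear (RingHom.id k) (𝒜 1) (𝒜 1) (𝒜 1) (𝒜 1)).compl₁₂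
      (degOneAct 𝒜) (degOneAct 𝒜))

theorem mul_sqAct (h : H) (x : 𝒜 1 ⊗[k] 𝒜 1) :
    LinearMap.mul' k R (TensorProduct.map (𝒜 1).subtype (𝒜 1).subtype
      (sqAct 𝒜 (Coalgebra.comul (R := k) h) x)) =
    h • LinearMap.mul' k R (TensorProduct.map (𝒜 1).subtype (𝒜 1).subtype x) := by
  induction x with
  | zero => simp
  | add x y hx hy => simp only [map_add, hx, hy, smul_add]
  | tmul x y =>
    simp only [TensorProduct.map_tmul, LinearMap.mul'_apply, Submodule.coe_subtype,
      IsGradedModuleAlgebra.smul_mul (k := k) (H := H) (𝒜 := 𝒜)]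
    generalize (Coalgebra.comul (R := k) h) = z
    induction z with
    | zero => simp
    | add a b ha hb => simp only [map_add, LinearMap.add_apply, ha, hb]
    | tmul a b => rfl

theorem sqAct_mem (h : H) (x : 𝒜 1 ⊗[k] 𝒜 1) (hx : x ∈ quadraticRelations 𝒜) :
    sqAct 𝒜 (Coalgebra.comul (R := k) h) x ∈ quadraticRelations 𝒜 := by
  have hx' : LinearMap.mul' k R (TensorProduct.map (𝒜 1).subtype (𝒜 1).subtype x) = 0 := hx
  change LinearMap.mul' k R (TensorProduct.map (𝒜 1).subtype (𝒜 1).subtype _) = 0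
  rw [mul_sqAct, hx', smul_zero]

/-- The action on `V* ⊗ V*`, `(f ⊗ g) ◁ h = ∑ (f ◁ h₂) ⊗ (g ◁ h₁)`, as a function of
`h₁ ⊗ h₂`. -/
def dualSqAct : H ⊗[k] H →ₗ[k] Module.Dual k (𝒜 1) ⊗[k] Module.Dual k (𝒜 1) →ₗ[k]
    Module.Dual k (𝒜 1) ⊗[k] Module.Dual k (𝒜 1) :=
  TensorProduct.lift ((TensorProduct.mapBilinear (RingHom.id k) _ _ _ _).compl₁₂
    (dualAct (H := H) 𝒜).flip (dualAct (H := H) 𝒜).flip).flip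

theorem reversePairing_dualSqAct (z : H ⊗[k] H)
    (t : Module.Dual k (𝒜 1) ⊗[k] Module.Dual k (𝒜 1)) (x : 𝒜 1 ⊗[k] 𝒜 1) :
    reversePairing (𝒜 1) (dualSqAct 𝒜 z t) x = reversePairing (𝒜 1) t (sqAct 𝒜 z x) := by
  induction z with
  | zero => simp
  | add a b ha hb => simp only [map_add, LinearMap.add_apply, ha, hb]
  | tmul a b =>
    induction t with
    | zero => simp
    | add a b ha hb => simp only [map_add, LinearMap.add_apply, ha, hb]
    | tmul f g =>
      induction x with
      | zero => simp
      | add a b ha hb => simp only [map_add, ha, hb]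
      | tmul x y => rfl

theorem dualSqAct_mem (h : H) (t : Module.Dual k (𝒜 1) ⊗[k] Module.Dual k (𝒜 1))
    (ht : t ∈ orthogonalRelations 𝒜) :
    dualSqAct 𝒜 (Coalgebra.comul (R := k) h) t ∈ orthogonalRelations 𝒜 := fun x hx => by
  rw [reversePairing_dualSqAct]
  exact ht _ (sqAct_mem 𝒜 h x hx)

/-- The map `f ↦ (h ↦ f ◁ h)` from `V*` to the linear maps `H → R^!`. These form the convolution
algebra, in which we reverse the products of `H` with values, so as to obtain the rule
`(x y) ◁ h = ∑ (x ◁ h₂) (y ◁ h₁)`. -/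
def dualActConv : Module.Dual k (𝒜 1) →ₗ[k]
    (WithConv (H →ₗ[k] (QuadraticDual 𝒜)ᵐᵒᵖ))ᵐᵒᵖ :=
  (MulOpposite.opLinearEquiv k).toLinearMap ∘ₗ
    (WithConv.linearEquiv k (H →ₗ[k] (QuadraticDual 𝒜)ᵐᵒᵖ)).symm.toLinearMap ∘ₗ
    LinearMap.compRight k ((MulOpposite.opLinearEquiv k).toLinearMap ∘ₗ quadraticDualι 𝒜) ∘ₗ
    dualAct 𝒜

theorem lift_dualActConv (h : H) (t : Module.Dual k (𝒜 1) ⊗[k] Module.Dual k (𝒜 1)) :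
    ((TensorAlgebra.lift k (dualActConv (H := H) 𝒜)
      (tensorSquare (Module.Dual k (𝒜 1)) t)).unop.ofConv h).unop =
    RingQuot.mkAlgHom k (quadraticDualRel 𝒜)
      (tensorSquare (Module.Dual k (𝒜 1)) (dualSqAct 𝒜 (Coalgebra.comul (R := k) h) t)) := by
  induction t with
  | zero => simp
  | add x y hx hy => simp only [map_add, MulOpposite.unop_add, WithConv.ofConv_add,
      LinearMap.add_apply, hx, hy]
  | tmul f g =>
    simp only [tensorSquare, LinearMap.comp_apply, TensorProduct.map_tmul, LinearMap.mul'_apply,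
      map_mul, TensorAlgebra.lift_ι_apply, MulOpposite.unop_mul, LinearMap.convMul_apply]
    generalize (Coalgebra.comul (R := k) h) = z
    induction z with
    | zero => simp
    | add a b ha hb => simp only [map_add, MulOpposite.unop_add, LinearMap.add_apply, ha, hb]
    | tmul a b =>
      simp [dualActConv, dualSqAct, quadraticDualι]

/-- The algebra map extending `f ↦ (h ↦ f ◁ h)` to the quadratic dual. -/
def quadraticDualActConv : QuadraticDual 𝒜 →ₐ[k]
    (WithConv (H →ₗ[k] (QuadraticDual 𝒜)ᵐᵒᵖ))ᵐᵒᵖ :=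
  RingQuot.liftAlgHom k ⟨TensorAlgebra.lift k (dualActConv 𝒜), by
    rintro _ _ ⟨t, ht, rfl, rfl⟩
    rw [map_zero]
    apply MulOpposite.unop_injective
    apply WithConv.ofConv_injective
    ext h
    apply MulOpposite.unop_injective
    rw [lift_dualActConv, RingQuot.mkAlgHom_rel k
      (⟨_, dualSqAct_mem 𝒜 h t ht, rfl, rfl⟩ : quadraticDualRel 𝒜 _ 0)]
    simp⟩

/-- The right action `x ◁ h` of `H` on `R^!`. It is determined by `quadraticDualAct_one`,
`quadraticDualAct_ι` and `quadraticDualAct_mul` below. -/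
def quadraticDualAct (x : QuadraticDual 𝒜) : H →ₗ[k] QuadraticDual 𝒜 :=
  (MulOpposite.opLinearEquiv k).symm.toLinearMap ∘ₗ (quadraticDualActConv 𝒜 x).unop.ofConv

theorem quadraticDualAct_one (h : H) : quadraticDualAct 𝒜 1 h =
    algebraMap k (QuadraticDual 𝒜) (Coalgebra.counit (R := k) h) := by
  simp [quadraticDualAct]

theorem quadraticDualAct_ι (f : Module.Dual k (𝒜 1)) (h : H) :
    quadraticDualAct 𝒜 (quadraticDualι 𝒜 f) h = quadraticDualι 𝒜 (dualAct 𝒜 f h) := by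
  simp [quadraticDualAct, quadraticDualι, quadraticDualActConv, dualActConv]

/-- `(x y) ◁ h = ∑ (x ◁ h₂) (y ◁ h₁)`. -/
theorem quadraticDualAct_mul (x y : QuadraticDual 𝒜) (h : H) :
    quadraticDualAct 𝒜 (x * y) h =
      LinearMap.mul' k (QuadraticDual 𝒜)
        (TensorProduct.map (quadraticDualAct 𝒜 x) (quadraticDualAct 𝒜 y)
          (TensorProduct.comm k H H (Coalgebra.comul (R := k) h))) := by
  simp only [quadraticDualAct, LinearMap.comp_apply, map_mul, MulOpposite.unop_mul,
    LinearMap.convMul_apply]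
  generalize (Coalgebra.comul (R := k) h) = z
  induction z with
  | zero => simp
  | add a b ha hb => simp only [map_add, ha, hb]
  | tmul a b => simp

end DualAction

end

/-!
The proof compares the homological determinant and the action on the quadratic dual with a third
object, the Koszul complex, which is realised inside the bar resolution `B_n = R ⊗ R^{⊗ n}`.

Let `V = R₁`, and let `G_n ⊆ B_n` (`koszulGen`) be the space of generators of the Koszul complex:
`G_0 = k`, and `G_{n + 1}` consists of the elements `1 ⊗ x` with `x` a cycle in `V · G_n`. The
natural map `R ⊗ G_n → B_n` is injective, so `R ⊗ G_n` is a subcomplex of the bar resolution, and it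
is stable under the diagonal action of `H`. A linear resolution `P` of `k` is free, `P_n ≅ R ⊗ G_n`
by induction on `n`, and this makes the Koszul complex exact (`LinearResolution.koszul_exact`).

Let `d` be the global dimension. For a Noetherian ring of finite global dimension the latter is
bounded by the self injective dimension (`globalDimension_le_of_selfInjectiveDimension`), while the
Koszul complex stops in some degree `p ≤ d`. Since it is exact, it is a retract of the bar
resolution, so every functional on `G_p` extends to a cocycle of degree `-p` on `B_p`
(`exists_barCocycle_extending`). Coboundaries take values in `R₊` on `G_p`. Hence `Ext^p(k, R)` is
nonzero, the Gorenstein condition forces `p` to be the injective dimension, and `p = d`. The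
one-dimensionality of `Ext^d(k, R)` then shows that `G_d` is a line `kγ`, and that the class of a
cocycle `F` on `B_d` is determined by the scalar `ε(F(γ))` (`isKoszulTop`).

Let `χ` be the character by which `H` acts on `γ`. For `h = S(g)` the action on cochains reads
`(h · F)(x) = ∑ S(g₁) F(g₂ x)`, so `ε((h · F)(γ)) = ε(F(g γ)) = χ(g) ε(F(γ))`. Therefore `H` acts on
`Ext^d(k, R)` by a character `η` with `η ∘ S = χ`, that is, `hdet = χ`
(`isHomologicalDeterminant_character`, `IsHomologicalDeterminant.eq_character`).

Contraction of the first letter by elements of `V*` makes `∏ G_n` a module over the quadratic dual,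
and this yields a pairing of `R^!_n` with `G_n` (`koszulPairing`), which is perfect
(`exists_koszulPairing_eq`, `eq_zero_of_koszulPairing`) and for which `◁ h` is transposed to `h`
(`koszulPairing_quadraticDualAct`). So `R^!_d` is the dual of the line `kγ`, and `λ ◁ h = χ(h) λ`.
-/

noncomputable section

/-! ### Injective dimension of free modules and global dimension -/

open CategoryTheory in
/-- Over a left Noetherian ring, direct sums of copies of an injective module are injective, by
Baer's criterion: a map from a finitely generated ideal lands in a finite subsum. -/
theorem Module.Injective.finsupp {A : Type v} [Ring A] [IsNoetherianRing A] (ι : Type v)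
    (M : Type v) [AddCommGroup M] [Module A M] (hM : Module.Injective A M) :
    Module.Injective A (ι →₀ M) := by
  classical
  refine Module.Baer.injective fun I g => ?_
  have hB : Module.Baer A M := Module.Baer.of_injective hM
  obtain ⟨s, hs⟩ : (⊤ : Submodule A I).FG := IsNoetherian.noetherian ⊤
  -- the finite set of coordinates met by the images of generators of the ideal
  let T : Finset ι := s.biUnion fun x => (g x).support
  have hT : ∀ x : I, g x ∈ Finsupp.supported M A (T : Set ι) := by
    have hle : (⊤ : Submodule A I) ≤ (Finsupp.supported M A (T : Set ι)).comap g := by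
      rw [← hs, Submodule.span_le]
      intro y hy
      change _ ∈ Finsupp.supported M A _
      rw [Finsupp.mem_supported]
      exact Finset.coe_subset.2 (Finset.subset_biUnion_of_mem (fun x : I => (g x).support) hy)
    exact fun x => hle (Submodule.mem_top (x := x))
  choose f hf using fun i : ι => hB I (Finsupp.lapply i ∘ₗ g)
  refine ⟨∑ i ∈ T, Finsupp.lsingle i ∘ₗ f i, fun x hx => ?_⟩
  ext j
  have hx' := hT ⟨x, hx⟩
  simp only [LinearMap.sum_apply, LinearMap.comp_apply, hf _ x hx, Finsupp.lapply_apply,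
    Finsupp.lsingle_apply, Finsupp.finsetSum_apply, Finsupp.single_apply]
  rw [Finset.sum_ite_eq' T j]
  split_ifs with hj
  · rfl
  · by_contra h
    exact hj (hx' (Finsupp.mem_support_iff.2 (Ne.symm h)))

open CategoryTheory in
theorem hasInjectiveDimensionLT_finsupp {A : Type v} [Ring A] [IsNoetherianRing A] (ι : Type v)
    (n : ℕ) (M : ModuleCat.{v} A) (hM : HasInjectiveDimensionLT M (n + 1)) :
    HasInjectiveDimensionLT (ModuleCat.of A (ι →₀ M)) (n + 1) := by
  induction n generalizing M with
  | zero =>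
    rw [zero_add, ← injective_iff_hasInjectiveDimensionLT_one] at hM ⊢
    have h := (Module.injective_iff_injective_object A M).2 hM
    exact (Module.injective_iff_injective_object A (ι →₀ M)).1 (Module.Injective.finsupp ι M h)
  | succ n ih =>
    let ⟨I, _, f, _⟩ := EnoughInjectives.presentation M
    have injf : Function.Injective f.hom := (ModuleCat.mono_iff_injective f).mp ‹_›
    let S : ShortComplex (ModuleCat.{v} A) :=
      ModuleCat.shortComplexOfCompEqZero _ _ f.hom.exact_map_mkQ_range.linearMap_comp_eq_zero
    have exactS := ModuleCat.shortComplex_shortExact S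
      f.hom.exact_map_mkQ_range injf (Submodule.mkQ_surjective _)
    have h3 := ih _ ((exactS.hasInjectiveDimensionLT_X₃_iff n inferInstance).2 hM)
    let F : (ι →₀ M) →ₗ[A] (ι →₀ I) := Finsupp.mapRange.linearMap f.hom
    let G : (ι →₀ I) →ₗ[A] (ι →₀ (I ⧸ LinearMap.range f.hom)) :=
      Finsupp.mapRange.linearMap (Submodule.mkQ _)
    have hF : Function.Injective F := Finsupp.mapRange_injective _ (map_zero _) injf
    have hG : Function.Surjective G :=
      Finsupp.mapRange_surjective _ (map_zero _) (Submodule.mkQ_surjective _)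
    have hFG : Function.Exact F G := by
      intro y
      constructor
      · intro hy
        have hy' : ∀ i, y i ∈ LinearMap.range f.hom := fun i => by
          have := DFunLike.congr_fun hy i
          exact (Submodule.Quotient.mk_eq_zero _).1 this
        choose x hx using hy'
        have hx0 : ∀ i, y i = 0 → x i = 0 := fun i hi => injf (by rw [hx, hi, map_zero])
        refine ⟨Finsupp.onFinset y.support x fun i hi => Finsupp.mem_support_iff.2
          fun h => hi (hx0 i h), ?_⟩
        ext i
        exact hx i
      · rintro ⟨x, rfl⟩
        ext i
        exact (Submodule.Quotient.mk_eq_zero _).2 ⟨x i, rfl⟩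
    have hI : Injective (ModuleCat.of A (ι →₀ I)) :=
      (Module.injective_iff_injective_object A (ι →₀ I)).1 (Module.Injective.finsupp ι I
        ((Module.injective_iff_injective_object A I).2 ‹_›))
    let S' : ShortComplex (ModuleCat.{v} A) :=
      ModuleCat.shortComplexOfCompEqZero F G hFG.linearMap_comp_eq_zero
    have exactS' : S'.ShortExact := ModuleCat.shortComplex_shortExact S' hFG hF hG
    exact (exactS'.hasInjectiveDimensionLT_X₃_iff n hI).1 h3

open CategoryTheory Abelian in
/-- For a left Noetherian ring of finite global dimension the global dimension is at most the self
injective dimension. If `n` is the latter and `n < m`, then in a presentation of `N` by a free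
module `F` the injective dimension of `F` is at most `n`, so `Ext^m(-, N)` embeds into
`Ext^{m + 1}`, and a bound `m` of the global dimension can be lowered. -/
theorem hasProjectiveDimensionLT_of_selfInjectiveDimension {A : Type v} [Ring A]
    [IsNoetherianRing A] (n m : ℕ) (hn : HasInjectiveDimensionLT (ModuleCat.of A A) (n + 1))
    (hm : ∀ M : ModuleCat.{v} A, HasProjectiveDimensionLT M (n + 1 + m)) (M : ModuleCat.{v} A) :
    HasProjectiveDimensionLT M (n + 1) := by
  induction m generalizing M with
  | zero => exact hm M
  | succ m ih =>
    refine ih (fun M => ?_) M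
    have hinj : ∀ N : ModuleCat.{v} A, HasInjectiveDimensionLT N (n + 1 + m) := by
      intro N
      have exactS := LinearMap.shortExact_shortComplexKer
        (Finsupp.linearCombination_id_surjective A N)
      refine exactS.hasInjectiveDimensionLT_X₃ (n + 1 + m) ?_ ?_
      · have h := hasInjectiveDimensionLT_finsupp N n (ModuleCat.of A A) hn
        exact hasInjectiveDimensionLT_of_ge _ (n + 1) _ (by omega)
      · rw [hasInjectiveDimensionLT_iff.{v}]
        intro i hi Y e
        have := hm Y
        exact e.eq_zero_of_hasProjectiveDimensionLT _ hi
    rw [hasProjectiveDimensionLT_iff.{v}]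
    intro i hi Y e
    have := hinj Y
    exact e.eq_zero_of_hasInjectiveDimensionLT _ hi

open CategoryTheory in
theorem globalDimension_le_iff {A : Type v} [Ring A] (m : ℕ) :
    globalDimension A ≤ m ↔ ∀ M : ModuleCat.{v} A, HasProjectiveDimensionLT M (m + 1) := by
  rw [globalDimension, iSup_le_iff]
  exact forall_congr' fun M => projectiveDimension_le_iff M m

open CategoryTheory in
theorem globalDimension_le_of_selfInjectiveDimension {A : Type v} [Ring A] [IsNoetherianRing A]
    {n d : ℕ} (hn : selfInjectiveDimension A = n) (hd : globalDimension A ≤ d) :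
    globalDimension A ≤ n := by
  rw [globalDimension_le_iff] at hd ⊢
  refine hasProjectiveDimensionLT_of_selfInjectiveDimension n d
    ((injectiveDimension_le_iff _ _).1 hn.le) fun M => ?_
  have := hd M
  exact hasProjectiveDimensionLT_of_ge _ (d + 1) _ (by omega)

open CategoryTheory in
/-- Dimension shifting along an infinite exact sequence of projective modules `X i` with kernels
`N i`: if the global dimension is at most `d`, then `N d` is a retract of `X d`. -/
theorem exists_retraction_of_globalDimension_le {A : Type v} [Ring A] {d : ℕ}
    (hd : globalDimension A ≤ d) (X : ℕ → Type v) [∀ i, AddCommGroup (X i)] [∀ i, Module A (X i)]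
    [∀ i, Module.Projective A (X i)] (N : ∀ i, Submodule A (X i))
    (e : ∀ i, (X (i + 1) ⧸ N (i + 1)) ≃ₗ[A] N i) :
    ∃ r : X d →ₗ[A] N d, ∀ x : N d, r x = x := by
  rw [globalDimension_le_iff] at hd
  have key : ∀ i j, i + j = d →
      HasProjectiveDimensionLT (ModuleCat.of A (X i ⧸ N i)) (j + 1) := by
    intro i
    induction i with
    | zero => intro j hj; obtain rfl : j = d := by omega
              exact hd _
    | succ i ih =>
      intro j hj
      let S : ShortComplex (ModuleCat.{v} A) :=
        ModuleCat.shortComplexOfCompEqZero (N i).subtype (N i).mkQ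
          (LinearMap.exact_subtype_mkQ (N i)).linearMap_comp_eq_zero
      have exactS : S.ShortExact := ModuleCat.shortComplex_shortExact S
        (LinearMap.exact_subtype_mkQ (N i)) (Submodule.subtype_injective _)
        (Submodule.mkQ_surjective _)
      have hp : Projective S.X₂ := (IsProjective.iff_projective (R := A) _).1 inferInstance
      have h1 := (exactS.hasProjectiveDimensionLT_X₃_iff j hp).1 (ih (j + 1) (by omega))
      exact (hasProjectiveDimensionLT_of_iso (e i).symm.toModuleIso (j + 1) :)
  have h := key d 0 (by omega)
  rw [zero_add, ← projective_iff_hasProjectiveDimensionLT_one] at h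
  have : Module.Projective A (X d ⧸ N d) := (IsProjective.iff_projective (R := A) _).2 h
  obtain ⟨s, hs⟩ := Module.projective_lifting_property (N d).mkQ LinearMap.id
    (Submodule.mkQ_surjective _)
  have hmk : ∀ x, x - s ((N d).mkQ x) ∈ N d := fun x => by
    rw [← Submodule.Quotient.mk_eq_zero, Submodule.Quotient.mk_sub, sub_eq_zero]
    exact (LinearMap.congr_fun hs ((N d).mkQ x)).symm
  refine ⟨(LinearMap.id - s ∘ₗ (N d).mkQ).codRestrict (N d) hmk, fun x => Subtype.ext ?_⟩
  have hx : (N d).mkQ (x : X d) = 0 := (Submodule.Quotient.mk_eq_zero _).2 x.2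
  simp [LinearMap.codRestrict_apply, LinearMap.sub_apply, LinearMap.comp_apply, hx]

/-! ### The bar resolution as a complex of free modules -/

section FreeLift

variable {k : Type u} [Field k] {A : Type v} [Ring A] [Algebra k A]
  {W : Type*} [AddCommGroup W] [Module k W] {M : Type*} [AddCommGroup M] [Module k M] [Module A M]
  [IsScalarTower k A M]

/-- The `A`-linear map `A ⊗ W → M` extending a `k`-linear map `W → M`. -/
def freeLift (g : W →ₗ[k] M) : A ⊗[k] W →ₗ[A] M :=
  TensorProduct.AlgebraTensorModule.lift (LinearMap.toSpanSingleton A (W →ₗ[k] M) g)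

@[simp] theorem freeLift_tmul (g : W →ₗ[k] M) (a : A) (w : W) :
    freeLift g (a ⊗ₜ[k] w) = a • g w := rfl

end FreeLift

section Bar

variable {k : Type u} [Field k] {A : Type v} [Ring A] [Algebra k A]

/-- The pure tensor `a ⊗ x` in `B_{n + 1} = A ⊗ B_n`. -/
def barMk (n : ℕ) : A →ₗ[k] barTerm k A n →ₗ[k] barTerm k A (n + 1) :=
  TensorProduct.mk k A (barTerm k A n)

theorem barSMul_barMk (n : ℕ) (a b : A) (x : barTerm k A n) :
    barSMul a (n + 1) (barMk n b x) = barMk n (a * b) x := rfl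

theorem barTerm_hom_ext {n : ℕ} {M : Type*} [AddCommGroup M] [Module k M]
    {f g : barTerm k A (n + 1) →ₗ[k] M}
    (h : ∀ (a : A) (x : barTerm k A n), f (barMk n a x) = g (barMk n a x)) : f = g :=
  TensorProduct.ext' (g := f) (h := g) h

/-- Left multiplication on the first tensor factor, as a ring homomorphism. -/
def barSMulHom (n : ℕ) : A →+* Module.End k (barTerm k A n) where
  toFun a := barSMul a n
  map_one' := by
    cases n with
    | zero => exact LinearMap.mulLeft_one k A
    | succ n =>
      refine barTerm_hom_ext fun b x => ?_
      rw [barSMul_barMk, one_mul]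
      rfl
  map_mul' a b := by
    cases n with
    | zero => exact LinearMap.mulLeft_mul k A a b
    | succ n =>
      refine barTerm_hom_ext fun c x => ?_
      change _ = barSMul a (n + 1) (barSMul b (n + 1) (barMk (k := k) n c x))
      rw [barSMul_barMk, barSMul_barMk, barSMul_barMk, mul_assoc]
  map_zero' := by
    cases n with
    | zero => exact LinearMap.mulLeft_zero_eq_zero k A
    | succ n =>
      refine barTerm_hom_ext fun c x => ?_
      rw [barSMul_barMk, zero_mul, map_zero]
      rfl
  map_add' a b := by
    cases n with
    | zero => exact LinearMap.ext fun x => add_mul a b x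
    | succ n =>
      refine barTerm_hom_ext fun c x => ?_
      change _ = barSMul a (n + 1) (barMk (k := k) n c x) + barSMul b (n + 1) (barMk n c x)
      rw [barSMul_barMk, barSMul_barMk, barSMul_barMk, add_mul, map_add]
      rfl

instance barModule {k : Type u} [Field k] {A : Type v} [Ring A] [Algebra k A] (n : ℕ) :
    Module A (barTerm k A n) := Module.compHom _ (barSMulHom (k := k) n)

theorem bar_smul_def (n : ℕ) (a : A) (x : barTerm k A n) : a • x = barSMul a n x := rfl

instance (n : ℕ) : IsScalarTower k A (barTerm k A n) where
  smul_assoc c a x := by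
    change barSMul (c • a) n x = c • barSMul a n x
    cases n with
    | zero => exact smul_mul_assoc c a x
    | succ n =>
      refine LinearMap.congr_fun (f := barSMul (c • a) (n + 1)) (g := c • barSMul a (n + 1))
        (barTerm_hom_ext fun b y => ?_) x
      rw [LinearMap.smul_apply, barSMul_barMk, barSMul_barMk, smul_mul_assoc, map_smul]; rfl

variable (k A) in
/-- The element `1` of `B_0 = A`. -/
def barOne : barTerm k A 0 := (1 : A)

variable (k A) in
/-- The identification of `B_0` with `A`. -/
def barVal : barTerm k A 0 →ₗ[k] A := LinearMap.id

theorem barVal_smul (a : A) (x : barTerm k A 0) : barVal k A (a • x) = a * barVal k A x := rfl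

theorem barVal_barOne : barVal k A (barOne k A) = 1 := rfl

theorem barVal_injective : Function.Injective (barVal k A) := fun _ _ h => h

/-- The map `b ↦ 1 ⊗ b`, the contracting homotopy of the bar resolution; its image generates
`B_{n + 1}` freely. -/
def barCons (n : ℕ) : barTerm k A n →ₗ[k] barTerm k A (n + 1) :=
  barMk n 1

theorem smul_barCons (n : ℕ) (a : A) (x : barTerm k A n) :
    a • barCons n x = barMk n a x := by
  change barSMul a (n + 1) (barMk n 1 x) = _
  rw [barSMul_barMk, mul_one]

theorem barVal_smul_barOne (x : barTerm k A 0) : barVal k A x • barOne k A = x :=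
  mul_one (barVal k A x)

@[elab_as_elim]
theorem bar_induction {n : ℕ} {p : barTerm k A (n + 1) → Prop} (x : barTerm k A (n + 1))
    (h0 : p 0) (hsmul : ∀ (a : A) (b : barTerm k A n), p (a • barCons n b))
    (hadd : ∀ x y, p x → p y → p (x + y)) : p x :=
  TensorProduct.induction_on (motive := fun x : A ⊗[k] barTerm k A n => p x) x h0
    (fun a b => Eq.subst (motive := p) (smul_barCons n a b) (hsmul a b)) hadd

theorem bar_hom_ext {n : ℕ} {M : Type*} [AddCommGroup M] [Module A M]
    {f g : barTerm k A (n + 1) →ₗ[A] M} (h : ∀ b, f (barCons n b) = g (barCons n b)) : f = g := by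
  ext x
  induction x using bar_induction with
  | h0 => simp
  | hsmul a b => simp [h]
  | hadd x y hx hy => simp [hx, hy]

/-- The `A`-linear map on `B_{n + 1}` with prescribed values on the elements `1 ⊗ b`. -/
def barLift (n : ℕ) {M : Type*} [AddCommGroup M] [Module k M] [Module A M] [IsScalarTower k A M]
    (g : barTerm k A n →ₗ[k] M) : barTerm k A (n + 1) →ₗ[A] M where
  toFun := freeLift (A := A) g
  map_add' := map_add (freeLift (A := A) g)
  map_smul' a x := by
    induction x using bar_induction with
    | h0 => rw [smul_zero]; erw [map_zero (freeLift (A := A) g)]; rw [smul_zero]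
    | hsmul b y =>
      rw [smul_smul, smul_barCons, smul_barCons]
      exact mul_smul a b (g y)
    | hadd x y hx hy =>
      rw [smul_add]
      erw [map_add (freeLift (A := A) g), map_add (freeLift (A := A) g)]
      rw [smul_add, hx, hy]

@[simp] theorem barLift_barCons (n : ℕ) {M : Type*} [AddCommGroup M] [Module k M] [Module A M]
    [IsScalarTower k A M] (g : barTerm k A n →ₗ[k] M) (b : barTerm k A n) :
    barLift n g (barCons n b) = g b := one_smul A (g b)

theorem barMul_tmul (n : ℕ) (a : A) (x : barTerm k A n) : barMul n (a ⊗ₜ[k] x) = a • x := by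
  cases n with
  | zero => rfl
  | succ n =>
    exact LinearMap.congr_fun (f := (barMul (n + 1)) ∘ₗ TensorProduct.mk k A _ a)
      (g := barSMul a (n + 1)) (barTerm_hom_ext fun b y => rfl) x

variable (ε : A →ₐ[k] k)

theorem barD_zero_smul_barCons (a : A) (x : barTerm k A 0) :
    barD ε 0 (a • barCons 0 x) = a • x - a • (ε (barVal k A x) • barOne k A) := by
  rw [smul_barCons]
  apply barVal_injective
  rw [map_sub, barVal_smul, barVal_smul, map_smul, barVal_barOne, mul_smul_comm, mul_one]
  change a * barVal k A x - (TensorProduct.rid k A) (a ⊗ₜ[k] (ε (barVal k A x))) = _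
  rw [TensorProduct.rid_tmul]

theorem barD_succ_smul_barCons (n : ℕ) (a : A) (x : barTerm k A (n + 1)) :
    barD ε (n + 1) (a • barCons (n + 1) x) = a • x - a • barCons n (barD ε n x) := by
  rw [smul_barCons, smul_barCons, ← barMul_tmul]
  rfl

/-- The bar differential as an `A`-linear map. -/
def barDiff (n : ℕ) : barTerm k A (n + 1) →ₗ[A] barTerm k A n where
  toFun := barD ε n
  map_add' := map_add _
  map_smul' a x := by
    induction x using bar_induction with
    | h0 => simp
    | hsmul b y =>
      rw [smul_smul]
      cases n with
      | zero =>
        rw [barD_zero_smul_barCons, barD_zero_smul_barCons, mul_smul, mul_smul, smul_sub,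
          RingHom.id_apply]
      | succ n =>
        rw [barD_succ_smul_barCons, barD_succ_smul_barCons, mul_smul, mul_smul, smul_sub,
          RingHom.id_apply]
    | hadd x y hx hy => simp only [smul_add, map_add, hx, hy]

theorem barDiff_apply (n : ℕ) (x : barTerm k A (n + 1)) : barDiff ε n x = barD ε n x := rfl

/-- The kernel of `B_n → B_{n - 1}`, where `B_{-1} = k`. -/
def barCycles : (n : ℕ) → Submodule A (barTerm k A n)
  | 0 => { carrier := {x | ε (barVal k A x) = 0}
           add_mem' := fun {x y} hx hy => by
             change ε (barVal k A (x + y)) = 0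
             rw [map_add, map_add, (hx : ε (barVal k A x) = 0), (hy : ε (barVal k A y) = 0),
               add_zero]
           zero_mem' := map_zero ε
           smul_mem' := fun a x hx => by
             change ε (barVal k A (a • x)) = 0
             rw [barVal_smul, map_mul, (hx : ε (barVal k A x) = 0), mul_zero] }
  | n + 1 => LinearMap.ker (barDiff ε n)

theorem mem_barCycles_zero {x : barTerm k A 0} : x ∈ barCycles ε 0 ↔ ε (barVal k A x) = 0 := Iff.rfl

theorem mem_barCycles_succ {n : ℕ} {x : barTerm k A (n + 1)} :
    x ∈ barCycles ε (n + 1) ↔ barDiff ε n x = 0 := Iff.rfl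

theorem barDiff_barCons {n : ℕ} {x : barTerm k A n} (hx : x ∈ barCycles ε n) :
    barDiff ε n (barCons n x) = x := by
  rw [barDiff_apply, ← one_smul A (barCons n x)]
  cases n with
  | zero => rw [barD_zero_smul_barCons, (mem_barCycles_zero ε).1 hx, zero_smul, smul_zero,
      sub_zero, one_smul]
  | succ n => rw [barD_succ_smul_barCons, ← barDiff_apply, (mem_barCycles_succ ε).1 hx, map_zero,
      smul_zero, sub_zero, one_smul]

theorem barDiff_barCons_mem_barCycles (n : ℕ) (b : barTerm k A n) :
    barDiff ε n (barCons n b) ∈ barCycles ε n := by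
  induction n with
  | zero =>
    rw [barDiff_apply, ← one_smul A (barCons 0 b), barD_zero_smul_barCons, one_smul, one_smul,
      mem_barCycles_zero, map_sub, map_smul, barVal_barOne]
    simp
  | succ n ih =>
    rw [barDiff_apply, ← one_smul A (barCons _ b), barD_succ_smul_barCons, one_smul, one_smul,
      mem_barCycles_succ, map_sub, ← barDiff_apply, barDiff_barCons, sub_self]
    induction b using bar_induction with
    | h0 => simp
    | hsmul a b => rw [map_smul]; exact Submodule.smul_mem _ _ (ih b)
    | hadd x y hx hy => rw [map_add]; exact add_mem hx hy

theorem barDiff_mem_barCycles (n : ℕ) (x : barTerm k A (n + 1)) :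
    barDiff ε n x ∈ barCycles ε n := by
  induction x using bar_induction with
  | h0 => simp
  | hsmul a b => rw [map_smul]; exact Submodule.smul_mem _ _ (barDiff_barCons_mem_barCycles ε n b)
  | hadd x y hx hy => rw [map_add]; exact add_mem hx hy

/-- The retraction `a ⊗ b ↦ ε(a) b` of `b ↦ 1 ⊗ b`. -/
def barTail (n : ℕ) : barTerm k A (n + 1) →ₗ[k] barTerm k A n :=
  (TensorProduct.lid k (barTerm k A n)).toLinearMap ∘ₗ LinearMap.rTensor _ ε.toLinearMap

theorem barTail_smul_barCons (n : ℕ) (a : A) (b : barTerm k A n) :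
    barTail ε n (a • barCons n b) = ε a • b := by
  rw [smul_barCons]; exact TensorProduct.lid_tmul _ _

theorem barTail_barCons (n : ℕ) (b : barTerm k A n) : barTail ε n (barCons n b) = b := by
  rw [← one_smul A (barCons n b), barTail_smul_barCons, map_one, one_smul]

end Bar

/-! ### The Koszul complex inside the bar resolution -/

section Koszul

variable {k : Type u} [Field k] {A : Type v} [Ring A] [Algebra k A]
  (𝒜 : ℕ → Submodule k A) (ε : A →ₐ[k] k)

/-- The subspace `V · G` of `B_n`, where `V` is the degree one part of `A`. -/
def degOneMul (n : ℕ) (G : Submodule k (barTerm k A n)) : Submodule k (barTerm k A n) :=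
  Submodule.map₂ (Algebra.lsmul k k (barTerm k A n)).toLinearMap (𝒜 1) G

/-- The generators of the Koszul complex as a subcomplex of the bar resolution: `G_0 = k ⊆ B_0`,
and `G_{n + 1}` consists of the elements `1 ⊗ x` where `x` is a cycle in `V · G_n ⊆ B_n`. In terms
of words, `G_n` is `1 ⊗ ⋂ V^{⊗ i} ⊗ I ⊗ V^{⊗ (n - 2 - i)}`. -/
def koszulGen : (n : ℕ) → Submodule k (barTerm k A n)
  | 0 => Submodule.span k {barOne k A}
  | n + 1 => (degOneMul 𝒜 n (koszulGen n) ⊓ (barCycles ε n).restrictScalars k).map (barCons n)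

theorem mem_koszulGen_succ {n : ℕ} {x : barTerm k A (n + 1)} :
    x ∈ koszulGen 𝒜 ε (n + 1) ↔
      ∃ y ∈ degOneMul 𝒜 n (koszulGen 𝒜 ε n), y ∈ barCycles ε n ∧ barCons n y = x := by
  rw [koszulGen, Submodule.mem_map]
  simp only [Submodule.mem_inf, Submodule.restrictScalars_mem, and_assoc]

/-- The map `A ⊗ G_n → B_n`, `a ⊗ g ↦ a g`. -/
def koszulMap (n : ℕ) : A ⊗[k] koszulGen 𝒜 ε n →ₗ[A] barTerm k A n :=
  freeLift (koszulGen 𝒜 ε n).subtype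

@[simp] theorem koszulMap_tmul (n : ℕ) (a : A) (g : koszulGen 𝒜 ε n) :
    koszulMap 𝒜 ε n (a ⊗ₜ g) = a • (g : barTerm k A n) := rfl

theorem koszulMap_injective (n : ℕ) : Function.Injective (koszulMap 𝒜 ε n) := by
  cases n with
  | zero =>
    have h1 : barOne k A ∈ koszulGen 𝒜 ε 0 := Submodule.subset_span rfl
    refine Function.LeftInverse.injective
      (g := fun b : barTerm k A 0 => (show A from b) ⊗ₜ[k] (⟨_, h1⟩ : koszulGen 𝒜 ε 0)) fun t => ?_
    induction t with
    | zero => rw [map_zero]; exact TensorProduct.zero_tmul _ _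
    | add x y hx hy =>
      rw [map_add]
      exact (TensorProduct.add_tmul _ _ _).trans (congrArg₂ (· + ·) hx hy)
    | tmul a g =>
      obtain ⟨g, hg⟩ := g
      obtain ⟨c, rfl⟩ := Submodule.mem_span_singleton.1 hg
      have : (a • (c • barOne k A) : barTerm k A 0) = c • a := by
        apply barVal_injective
        rw [barVal_smul, map_smul, barVal_barOne, mul_smul_comm, mul_one]; rfl
      rw [koszulMap_tmul, this]
      exact (TensorProduct.smul_tmul c a _).trans rfl
  | succ n =>
    have hinj : Function.Injective (barTail ε n ∘ₗ (koszulGen 𝒜 ε (n + 1)).subtype) := by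
      rintro ⟨x, hx⟩ ⟨y, hy⟩ h
      obtain ⟨x', -, -, rfl⟩ := (mem_koszulGen_succ 𝒜 ε).1 hx
      obtain ⟨y', -, -, rfl⟩ := (mem_koszulGen_succ 𝒜 ε).1 hy
      simp only [LinearMap.comp_apply, Submodule.subtype_apply, barTail_barCons] at h
      simp [h]
    have h := Module.Flat.lTensor_preserves_injective_linearMap (M := A) _ hinj
    have heq : ∀ t, LinearMap.lTensor A (barTail ε n ∘ₗ (koszulGen 𝒜 ε (n + 1)).subtype) t =
        koszulMap 𝒜 ε (n + 1) t := by
      intro t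
      induction t with
      | zero => rw [map_zero, map_zero]; rfl
      | add x y hx hy => rw [map_add, map_add, hx, hy]; rfl
      | tmul a g =>
        obtain ⟨x, hx⟩ := g
        obtain ⟨x', -, -, rfl⟩ := (mem_koszulGen_succ 𝒜 ε).1 hx
        rw [koszulMap_tmul, LinearMap.lTensor_tmul, smul_barCons]
        exact congrArg (fun z => a ⊗ₜ[k] z) (barTail_barCons ε n x')
    intro s t hst
    exact h (by rw [heq, heq, hst])

theorem exists_koszulMap_eq {n : ℕ} {x : barTerm k A n}
    (hx : x ∈ degOneMul 𝒜 n (koszulGen 𝒜 ε n)) :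
    ∃ t, koszulMap 𝒜 ε n t = x ∧
      t ∈ LinearMap.range (LinearMap.rTensor (koszulGen 𝒜 ε n) (𝒜 1).subtype) := by
  have h : degOneMul 𝒜 n (koszulGen 𝒜 ε n) ≤
      (LinearMap.range (LinearMap.rTensor (koszulGen 𝒜 ε n) (𝒜 1).subtype)).map
        ((koszulMap 𝒜 ε n).restrictScalars k) :=
    Submodule.map₂_le.2 fun v hv g hg => ⟨v ⊗ₜ ⟨g, hg⟩, ⟨⟨v, hv⟩ ⊗ₜ ⟨g, hg⟩, rfl⟩, rfl⟩
  obtain ⟨t, ht, rfl⟩ := h hx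
  exact ⟨t, rfl, ht⟩

theorem barDiff_mem_of_mem_koszulGen {n : ℕ} {x : barTerm k A (n + 1)}
    (hx : x ∈ koszulGen 𝒜 ε (n + 1)) :
    barDiff ε n x ∈ degOneMul 𝒜 n (koszulGen 𝒜 ε n) ∧ barCons n (barDiff ε n x) = x := by
  obtain ⟨y, hy, hy', rfl⟩ := (mem_koszulGen_succ 𝒜 ε).1 hx
  rw [barDiff_barCons ε hy']
  exact ⟨hy, rfl⟩

/-- The Koszul differential on generators, `G_{n + 1} → A ⊗ G_n`. -/
theorem exists_koszulDiff (n : ℕ) : ∃ c : koszulGen 𝒜 ε (n + 1) →ₗ[k] A ⊗[k] koszulGen 𝒜 ε n,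
    ∀ x, koszulMap 𝒜 ε n (c x) = barDiff ε n x ∧
      c x ∈ LinearMap.range (LinearMap.rTensor (koszulGen 𝒜 ε n) (𝒜 1).subtype) := by
  choose c hc hc' using fun x : koszulGen 𝒜 ε (n + 1) =>
    exists_koszulMap_eq 𝒜 ε (barDiff_mem_of_mem_koszulGen 𝒜 ε x.2).1
  refine ⟨⟨⟨c, fun x y => koszulMap_injective 𝒜 ε n ?_⟩,
    fun a x => koszulMap_injective 𝒜 ε n ?_⟩, fun x => ⟨hc x, hc' x⟩⟩
  · rw [map_add, hc, hc, hc, Submodule.coe_add, map_add]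
  · rw [hc, RingHom.id_apply, ← algebraMap_smul A a (c x), map_smul, hc, Submodule.coe_smul,
      ← algebraMap_smul A a (x : barTerm k A (n + 1)), map_smul]

end Koszul

/-! ### Graded free modules -/

section Graded

variable {k : Type u} [Field k] {A : Type v} [Ring A] [Algebra k A]
  (𝒜 : ℕ → Submodule k A) [GradedAlgebra 𝒜]
  {W : Type*} [AddCommGroup W] [Module k W]

theorem algebraMap_augmentation [IsConnectedGraded 𝒜] (a : A) :
    algebraMap k A (augmentation 𝒜 a) = GradedAlgebra.proj 𝒜 0 a := by
  have h := (AlgEquiv.ofBijective (Algebra.ofId k (𝒜 0)) (bijective_ofId_zero 𝒜)).apply_symm_apply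
    (projZero 𝒜 a)
  exact congrArg Subtype.val h

theorem augmentation_of_mem [IsConnectedGraded 𝒜] {i : ℕ} (hi : i ≠ 0) {a : A} (ha : a ∈ 𝒜 i) :
    augmentation 𝒜 a = 0 := by
  have : Nontrivial A := IsConnectedGraded.nontrivial (𝒜 := 𝒜)
  apply (algebraMap k A).injective
  rw [algebraMap_augmentation, map_zero]
  exact DirectSum.decompose_of_mem_ne 𝒜 ha hi

theorem exists_sum_proj (a : A) :
    ∃ s : Finset ℕ, ∀ t, s ⊆ t → ∑ j ∈ t, GradedAlgebra.proj 𝒜 j a = a := by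
  classical
  refine ⟨(DirectSum.decompose 𝒜 a).support, fun t ht => ?_⟩
  conv_rhs => rw [← DirectSum.sum_support_decompose 𝒜 a]
  refine (Finset.sum_subset ht fun j _ hj => ?_).symm
  simpa using hj

/-- The projection of `A ⊗ W` onto `A_j ⊗ W`. -/
def tensorProj (j : ℕ) : A ⊗[k] W →ₗ[k] A ⊗[k] W :=
  (GradedAlgebra.proj 𝒜 j).rTensor W

theorem tensorProj_tmul (j : ℕ) (a : A) (w : W) :
    tensorProj 𝒜 j (a ⊗ₜ[k] w) = GradedAlgebra.proj 𝒜 j a ⊗ₜ[k] w := rfl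

theorem exists_sum_tensorProj (x : A ⊗[k] W) :
    ∃ s : Finset ℕ, ∀ t, s ⊆ t → ∑ j ∈ t, tensorProj 𝒜 j x = x := by
  classical
  induction x with
  | zero => exact ⟨∅, fun t _ => by simp⟩
  | add x y hx hy =>
    obtain ⟨s, hs⟩ := hx
    obtain ⟨t, ht⟩ := hy
    refine ⟨s ∪ t, fun r hr => ?_⟩
    simp only [map_add, Finset.sum_add_distrib]
    rw [hs r (Finset.union_subset_left hr), ht r (Finset.union_subset_right hr)]
  | tmul a w =>
    obtain ⟨s, hs⟩ := exists_sum_proj 𝒜 a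
    refine ⟨s, fun t ht => ?_⟩
    simp only [tensorProj_tmul]
    rw [← TensorProduct.sum_tmul, hs t ht]

theorem eq_zero_of_tensorProj (x : A ⊗[k] W) (h : ∀ j, tensorProj 𝒜 j x = 0) : x = 0 := by
  obtain ⟨s, hs⟩ := exists_sum_tensorProj 𝒜 x
  rw [← hs s subset_rfl]
  exact Finset.sum_eq_zero fun j _ => h j

theorem tensorProj_smul_of_mem {i : ℕ} {a : A} (ha : a ∈ 𝒜 i) (j : ℕ) (y : A ⊗[k] W) :
    tensorProj 𝒜 j (a • y) = if i ≤ j then a • tensorProj 𝒜 (j - i) y else 0 := by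
  induction y with
  | zero => simp
  | add x y hx hy =>
    rw [smul_add, map_add, hx, hy]
    split_ifs <;> simp
  | tmul b w =>
    rw [TensorProduct.smul_tmul', tensorProj_tmul, tensorProj_tmul, smul_eq_mul,
      GradedAlgebra.proj_apply, GradedAlgebra.proj_apply]
    split_ifs with h
    · rw [DirectSum.coe_decompose_mul_of_left_mem_of_le 𝒜 ha h, TensorProduct.smul_tmul',
        smul_eq_mul]
    · rw [DirectSum.coe_decompose_mul_of_left_mem_of_not_le 𝒜 ha h, TensorProduct.zero_tmul]

theorem tensorProj_smul_of_lower_eq_zero {j : ℕ} {y : A ⊗[k] W}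
    (hy : ∀ i < j, tensorProj 𝒜 i y = 0) (a : A) :
    tensorProj 𝒜 j (a • y) = tensorProj 𝒜 j (GradedAlgebra.proj 𝒜 0 a • y) := by
  induction a using DirectSum.Decomposition.inductionOn 𝒜 with
  | zero => simp
  | @homogeneous i m =>
    by_cases hi : i = 0
    · subst hi
      rw [GradedAlgebra.proj_apply, DirectSum.decompose_of_mem_same 𝒜 m.2]
    · rw [GradedAlgebra.proj_apply, DirectSum.decompose_of_mem_ne 𝒜 m.2 hi, zero_smul, map_zero,
        tensorProj_smul_of_mem 𝒜 m.2]
      split_ifs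
      · rw [hy _ (by omega), smul_zero]
      · rfl
  | add a b ha hb => rw [add_smul, map_add, ha, hb, map_add, add_smul, map_add]

/-- A graded Nakayama lemma: a retract of `A ⊗ W` contained in `A₊ ⊗ W` vanishes. -/
theorem eq_zero_of_retract (N : Submodule A (A ⊗[k] W)) (hN : ∀ x ∈ N, tensorProj 𝒜 0 x = 0)
    (e : A ⊗[k] W →ₗ[A] A ⊗[k] W) (he : ∀ x, e x ∈ N) (he' : ∀ x ∈ N, e x = x)
    (x : A ⊗[k] W) (hx : x ∈ N) : x = 0 := by
  refine eq_zero_of_tensorProj 𝒜 x fun j => ?_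
  induction j using Nat.strong_induction_on generalizing x with
  | _ j ih =>
    have key : ∀ y, tensorProj 𝒜 j (e y) = tensorProj 𝒜 j (e (tensorProj 𝒜 0 y)) := by
      intro y
      induction y with
      | zero => simp
      | add x y hx hy => simp only [map_add, hx, hy]
      | tmul a w =>
        have h (b : A) : e (b ⊗ₜ[k] w) = b • e (1 ⊗ₜ[k] w) := by
          rw [← map_smul, TensorProduct.smul_tmul', smul_eq_mul, mul_one]
        rw [tensorProj_tmul, h a, h (GradedAlgebra.proj 𝒜 0 a), tensorProj_smul_of_lower_eq_zero 𝒜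
          fun i hi => ih i hi _ (he _)]
    rw [← he' x hx, key, hN x hx, map_zero, map_zero]

end Graded

section GradedModule

variable {P : Type*} [AddCommGroup P] {gr : ℤ → AddSubgroup P}

/-- The component of degree `j` in an internally graded group. -/
def grComp (h : DirectSum.IsInternal gr) (j : ℤ) : P →+ P :=
  letI := h.chooseDecomposition
  (gr j).subtype.comp ((DFinsupp.evalAddMonoidHom j).comp
    (DirectSum.decomposeAddEquiv gr).toAddMonoidHom)

theorem grComp_of_mem (h : DirectSum.IsInternal gr) {j : ℤ} {p : P} (hp : p ∈ gr j) :
    grComp h j p = p :=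
  letI := h.chooseDecomposition
  DirectSum.decompose_of_mem_same gr hp

theorem grComp_of_mem_ne (h : DirectSum.IsInternal gr) {i j : ℤ} {p : P} (hp : p ∈ gr i)
    (hij : i ≠ j) : grComp h j p = 0 :=
  letI := h.chooseDecomposition
  DirectSum.decompose_of_mem_ne gr hp hij

theorem grComp_mem (h : DirectSum.IsInternal gr) (j : ℤ) (p : P) : grComp h j p ∈ gr j :=
  letI := h.chooseDecomposition
  (DirectSum.decompose gr p j).2

theorem gr_induction (h : DirectSum.IsInternal gr) {C : P → Prop} (p : P) (h0 : C 0)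
    (hgr : ∀ i, ∀ p ∈ gr i, C p) (hadd : ∀ p q, C p → C q → C (p + q)) : C p :=
  letI := h.chooseDecomposition
  DirectSum.Decomposition.inductionOn gr h0 (fun m => hgr _ m m.2) hadd p

theorem grComp_map {Q : Type*} [AddCommGroup Q] {gr' : ℤ → AddSubgroup Q}
    (h : DirectSum.IsInternal gr) (h' : DirectSum.IsInternal gr') (f : P →+ Q)
    (hf : ∀ i, ∀ p ∈ gr i, f p ∈ gr' i) (j : ℤ) (p : P) :
    grComp h' j (f p) = f (grComp h j p) := by
  induction p using gr_induction h with
  | h0 => simp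
  | hgr i p hp =>
    by_cases hij : i = j
    · subst hij
      rw [grComp_of_mem _ hp, grComp_of_mem _ (hf i p hp)]
    · rw [grComp_of_mem_ne _ hp hij, grComp_of_mem_ne _ (hf i p hp) hij, map_zero]
  | hadd x y hx hy => simp only [map_add, hx, hy]

variable {k : Type u} [Field k] {A : Type v} [Ring A] [Algebra k A]
  (𝒜 : ℕ → Submodule k A) [GradedAlgebra 𝒜]
  {W : Type*} [AddCommGroup W] [Module k W] [Module k P] [Module A P] [IsScalarTower k A P]

theorem freeLift_tensorProj_mem
    (smul_mem : ∀ (a : ℕ) (j : ℤ) (r : A) (p : P), r ∈ 𝒜 a → p ∈ gr j → r • p ∈ gr (a + j))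
    {n : ℤ} {b : W →ₗ[k] P} (hb : ∀ w, b w ∈ gr n) (j : ℕ) (t : A ⊗[k] W) :
    freeLift b (tensorProj 𝒜 j t) ∈ gr (j + n) := by
  induction t with
  | zero => simp
  | add x y hx hy => rw [map_add, map_add]; exact add_mem hx hy
  | tmul a w =>
    rw [tensorProj_tmul, freeLift_tmul]
    exact smul_mem _ _ _ _ (DirectSum.decompose 𝒜 a j).2 (hb w)

theorem grComp_freeLift (h : DirectSum.IsInternal gr)
    (smul_mem : ∀ (a : ℕ) (j : ℤ) (r : A) (p : P), r ∈ 𝒜 a → p ∈ gr j → r • p ∈ gr (a + j))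
    {n : ℤ} {b : W →ₗ[k] P} (hb : ∀ w, b w ∈ gr n) (j : ℕ) (t : A ⊗[k] W) :
    grComp h (j + n) (freeLift b t) = freeLift b (tensorProj 𝒜 j t) := by
  classical
  obtain ⟨s, hs⟩ := exists_sum_tensorProj 𝒜 t
  conv_lhs => rw [← hs (insert j s) (Finset.subset_insert j s)]
  rw [map_sum, map_sum, Finset.sum_eq_single j]
  · exact grComp_of_mem h (freeLift_tensorProj_mem 𝒜 smul_mem hb j t)
  · intro i _ hij
    exact grComp_of_mem_ne h (freeLift_tensorProj_mem 𝒜 smul_mem hb i t) (by omega)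
  · exact fun hj => absurd (Finset.mem_insert_self j s) hj

theorem exists_tmul_one_eq_tensorProj_zero [IsConnectedGraded 𝒜] (t : A ⊗[k] W) :
    ∃ w : W, tensorProj 𝒜 0 t = (1 : A) ⊗ₜ[k] w := by
  induction t with
  | zero => exact ⟨0, by simp⟩
  | add x y hx hy =>
    obtain ⟨w, hw⟩ := hx
    obtain ⟨z, hz⟩ := hy
    exact ⟨w + z, by rw [map_add, hw, hz, TensorProduct.tmul_add]⟩
  | tmul a w =>
    refine ⟨augmentation 𝒜 a • w, ?_⟩
    rw [tensorProj_tmul, ← algebraMap_augmentation, Algebra.algebraMap_eq_smul_one,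
      TensorProduct.smul_tmul]

/-- A graded projective module that is generated in degree `n` is free on its component of
degree `n`. -/
theorem freeLift_bijective [IsConnectedGraded 𝒜] [Module.Projective A P]
    (h : DirectSum.IsInternal gr)
    (smul_mem : ∀ (a : ℕ) (j : ℤ) (r : A) (p : P), r ∈ 𝒜 a → p ∈ gr j → r • p ∈ gr (a + j))
    {n : ℤ} (hgen : Submodule.span A (gr n : Set P) = ⊤) {b : W →ₗ[k] P} (hb : ∀ w, b w ∈ gr n)
    (hb_inj : Function.Injective b) (hb_surj : ∀ p ∈ gr n, ∃ w, b w = p) :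
    Function.Bijective (freeLift (A := A) b) := by
  have hsurj : Function.Surjective (freeLift (A := A) b) := by
    rw [← LinearMap.range_eq_top, eq_top_iff, ← hgen, Submodule.span_le]
    intro p hp
    obtain ⟨w, rfl⟩ := hb_surj p hp
    exact ⟨1 ⊗ₜ w, by simp⟩
  refine ⟨?_, hsurj⟩
  obtain ⟨s, hs⟩ := Module.projective_lifting_property (freeLift (A := A) b) LinearMap.id hsurj
  have hs' (p : P) : freeLift b (s p) = p := LinearMap.congr_fun hs p
  rw [← LinearMap.ker_eq_bot, Submodule.eq_bot_iff]
  refine eq_zero_of_retract 𝒜 _ (fun x hx => ?_) (LinearMap.id - s ∘ₗ freeLift b)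
    (fun x => ?_) fun x hx => ?_
  · have h0 := grComp_freeLift 𝒜 h smul_mem hb 0 x
    rw [LinearMap.mem_ker.1 hx, map_zero] at h0
    obtain ⟨w, hw⟩ := exists_tmul_one_eq_tensorProj_zero 𝒜 x
    rw [hw, freeLift_tmul, one_smul] at h0
    rw [hw, hb_inj (h0.symm.trans (map_zero b).symm), TensorProduct.tmul_zero]
  · rw [LinearMap.mem_ker, LinearMap.sub_apply, map_sub, LinearMap.comp_apply, hs',
      LinearMap.id_apply, sub_self]
  · rw [LinearMap.sub_apply, LinearMap.comp_apply, LinearMap.mem_ker.1 hx, map_zero, sub_zero,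
      LinearMap.id_apply]

end GradedModule

/-! ### Exactness of the Koszul complex -/

section Resolution

variable {k : Type u} [Field k] {R : Type v} [Ring R] [Algebra k R]
  {𝒜 : ℕ → Submodule k R} [GradedAlgebra 𝒜] [IsConnectedGraded 𝒜]

namespace LinearResolution

attribute [instance] LinearResolution.addCommGroup LinearResolution.module

variable (L : LinearResolution 𝒜)

instance baseModule (n : ℕ) : Module k (L.P n) := Module.compHom _ (algebraMap k R)

instance (n : ℕ) : IsScalarTower k R (L.P n) where
  smul_assoc c r p := by
    rw [Algebra.smul_def, mul_smul]; rfl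

/-- The kernel of `P_n → P_{n - 1}`, where `P_{-1} = k`. -/
def cycles : (n : ℕ) → Submodule R (L.P n)
  | 0 => { carrier := {p | L.π p = 0}
           add_mem' := fun {p q} hp hq => by
             change L.π (p + q) = 0
             rw [map_add, (hp : L.π p = 0), (hq : L.π q = 0), add_zero]
           zero_mem' := map_zero L.π
           smul_mem' := fun r p hp => by
             change L.π (r • p) = 0
             rw [L.π_smul, (hp : L.π p = 0), mul_zero] }
  | n + 1 => LinearMap.ker (L.d n)

theorem mem_cycles_zero {p : L.P 0} : p ∈ L.cycles 0 ↔ L.π p = 0 := Iff.rfl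

theorem range_d (n : ℕ) : LinearMap.range (L.d n) = L.cycles n := by
  cases n with
  | zero => ext p; exact (L.exact_zero p).symm
  | succ n => exact (LinearMap.exact_iff.1 (L.exact_succ n)).symm

theorem eq_zero_of_mem_gr_of_lt {n : ℕ} {j : ℤ} (hj : j < n) {p : L.P n} (hp : p ∈ L.gr n j) :
    p = 0 := by
  suffices h : ∀ q ∈ Submodule.span R (L.gr n n : Set (L.P n)), grComp (L.isInternal n) j q = 0 by
    rw [← grComp_of_mem (L.isInternal n) hp]
    exact h p (by rw [L.generated]; exact Submodule.mem_top)
  intro q hq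
  induction hq using Submodule.closure_induction with
  | zero => exact map_zero _
  | add x y _ _ hx hy => rw [map_add, hx, hy, add_zero]
  | smul_mem r x hx =>
    induction r using DirectSum.Decomposition.inductionOn 𝒜 with
    | zero => rw [zero_smul, map_zero]
    | @homogeneous i m =>
      exact grComp_of_mem_ne _ (L.smul_mem n i n m x m.2 hx) (by omega)
    | add a b ha hb => rw [add_smul, map_add, ha, hb, add_zero]

theorem grComp_d (n : ℕ) (j : ℤ) (p : L.P (n + 1)) :
    grComp (L.isInternal n) j (L.d n p) = L.d n (grComp (L.isInternal (n + 1)) j p) :=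
  grComp_map _ _ (L.d n).toAddMonoidHom (fun i p hp => L.d_mem n i p hp) j p

theorem exists_d_eq {n : ℕ} {j : ℤ} {p : L.P n} (hp : p ∈ L.cycles n) (hpj : p ∈ L.gr n j) :
    ∃ q ∈ L.gr (n + 1) j, L.d n q = p := by
  rw [← range_d] at hp
  obtain ⟨q, rfl⟩ := hp
  refine ⟨grComp (L.isInternal (n + 1)) j q, grComp_mem _ _ _, ?_⟩
  rw [← L.grComp_d, grComp_of_mem _ hpj]

theorem grComp_mem_cycles {n : ℕ} (j : ℤ) {p : L.P n} (hp : p ∈ L.cycles n) :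
    grComp (L.isInternal n) j p ∈ L.cycles n := by
  rw [← range_d] at hp ⊢
  obtain ⟨q, rfl⟩ := hp
  exact ⟨_, (L.grComp_d n j q).symm⟩

theorem eq_zero_of_mem_cycles {n : ℕ} {p : L.P n} (hp : p ∈ L.cycles n) (hpn : p ∈ L.gr n n) :
    p = 0 := by
  obtain ⟨q, hq, rfl⟩ := L.exists_d_eq hp hpn
  rw [L.eq_zero_of_mem_gr_of_lt (by push_cast; omega) hq, map_zero]

/-- The free `R`-linear extension of `b : G_n → (P_n)_n` is an isomorphism of `R ⊗ G_n` with
`P_n`, under which the cycles of the Koszul complex correspond to those of the resolution. -/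
structure IsComparison (n : ℕ) (b : koszulGen 𝒜 (augmentation 𝒜) n →ₗ[k] L.P n) : Prop where
  mem_gr : ∀ g, b g ∈ L.gr n n
  bijective : Function.Bijective (freeLift (A := R) b)
  mem_cycles : ∀ t, freeLift (A := R) b t ∈ L.cycles n ↔
    koszulMap 𝒜 (augmentation 𝒜) n t ∈ barCycles (augmentation 𝒜) n

theorem exists_isComparison_zero : ∃ b, L.IsComparison 0 b := by
  obtain ⟨p, hp⟩ := L.π_surjective 1
  have hπ : L.π (grComp (L.isInternal 0) 0 p) = 1 := by
    rw [← hp]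
    clear hp
    induction p using gr_induction (L.isInternal 0) with
    | h0 => simp
    | hgr i q hq =>
      by_cases hi : i = 0
      · subst hi
        rw [grComp_of_mem _ hq]
      · rw [grComp_of_mem_ne _ hq hi, map_zero, L.π_degree i q hq hi]
    | hadd x y hx hy => simp only [map_add, hx, hy]
  set p₀ := grComp (L.isInternal 0) 0 p with hp₀
  have hp₀_mem : p₀ ∈ L.gr 0 0 := grComp_mem _ _ _
  let b : koszulGen 𝒜 (augmentation 𝒜) 0 →ₗ[k] L.P 0 :=
    (LinearMap.toSpanSingleton k (L.P 0) p₀) ∘ₗ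
      (augmentation 𝒜).toLinearMap ∘ₗ barVal k R ∘ₗ Submodule.subtype _
  have hsmul (c : k) (q : L.P 0) : c • q = algebraMap k R c • q := rfl
  have hgr (c : k) {q : L.P 0} (hq : q ∈ L.gr 0 0) : c • q ∈ L.gr 0 0 := by
    rw [hsmul]
    have h : algebraMap k R c ∈ 𝒜 0 := by
      rw [IsConnectedGraded.zero_eq (𝒜 := 𝒜)]; exact ⟨c, rfl⟩
    simpa using L.smul_mem 0 0 0 _ q h hq
  have hb (c : k) (hc : c • barOne k R ∈ koszulGen 𝒜 (augmentation 𝒜) 0) :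
      b ⟨c • barOne k R, hc⟩ = c • p₀ := by
    change (augmentation 𝒜 (barVal k R (c • barOne k R))) • p₀ = _
    rw [map_smul, barVal_barOne, map_smul, map_one, smul_eq_mul, mul_one]
  have hπb (g : koszulGen 𝒜 (augmentation 𝒜) 0) :
      L.π (b g) = augmentation 𝒜 (barVal k R g) := by
    change L.π (algebraMap k R _ • p₀) = _
    rw [L.π_smul, hπ, mul_one, AlgHom.commutes]
    rfl
  have hπt (t) : L.π (freeLift (A := R) b t) =
      augmentation 𝒜 (barVal k R (koszulMap 𝒜 (augmentation 𝒜) 0 t)) := by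
    induction t with
    | zero => simp
    | add x y hx hy => simp only [map_add, hx, hy]
    | tmul a g => rw [freeLift_tmul, L.π_smul, hπb, koszulMap_tmul, barVal_smul, map_mul]
  have hmem (g) : b g ∈ L.gr 0 (0 : ℕ) := hgr _ hp₀_mem
  refine ⟨b, hmem, ?_, fun t => ?_⟩
  · have := L.projective 0
    refine freeLift_bijective 𝒜 (L.isInternal 0) (L.smul_mem 0) (L.generated 0) hmem ?_ ?_
    · rw [injective_iff_map_eq_zero]
      rintro ⟨g, hg⟩ h
      obtain ⟨c, rfl⟩ := Submodule.mem_span_singleton.1 hg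
      have := hπb ⟨_, hg⟩
      rw [h, map_zero, map_smul, barVal_barOne, map_smul, map_one, smul_eq_mul, mul_one] at this
      exact Subtype.ext (show c • barOne k R = 0 by rw [← this, zero_smul])
    · intro q hq
      refine ⟨⟨L.π q • barOne k R, Submodule.smul_mem _ _ (Submodule.subset_span rfl)⟩, ?_⟩
      rw [hb, ← sub_eq_zero]
      refine L.eq_zero_of_mem_cycles ?_ (sub_mem (hgr _ hp₀_mem) hq)
      rw [mem_cycles_zero, map_sub, hsmul, L.π_smul, hπ, AlgHom.commutes, mul_one]
      exact sub_self _
  · rw [mem_cycles_zero, hπt, mem_barCycles_zero]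

/-- The inductive step: an element of `G_{n + 1}` corresponds to the element of degree `n + 1` of
`P_{n + 1}` with the same differential, which is unique since all cycles of `P_{n + 1}` are in
higher degrees. -/
theorem IsComparison.exists_succ {L : LinearResolution 𝒜} {n : ℕ} {b} (hb : L.IsComparison n b) :
    ∃ b', L.IsComparison (n + 1) b' ∧ ∀ t, freeLift b t ∈ L.cycles n →
      ∃ t', barDiff (augmentation 𝒜) n (koszulMap 𝒜 (augmentation 𝒜) (n + 1) t') =
        koszulMap 𝒜 (augmentation 𝒜) n t := by
  obtain ⟨c, hc⟩ := exists_koszulDiff 𝒜 (augmentation 𝒜) n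
  have hrange : ∀ t, t ∈ LinearMap.range (LinearMap.rTensor (koszulGen 𝒜 (augmentation 𝒜) n)
      (𝒜 1).subtype) → freeLift b t ∈ L.gr n (n + 1 : ℕ) := by
    rintro _ ⟨t, rfl⟩
    induction t with
    | zero => simp
    | add x y hx hy => rw [map_add, map_add]; exact add_mem hx hy
    | tmul v g =>
      have := L.smul_mem n 1 n v (b g) v.2 (hb.mem_gr g)
      rw [add_comm] at this
      exact_mod_cast this
  have hcyc (x) : freeLift b (c x) ∈ L.cycles n := by
    rw [hb.mem_cycles, (hc x).1]
    exact barDiff_mem_barCycles _ n _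
  choose f hf hdf using fun x => L.exists_d_eq (hcyc x) (hrange _ (hc x).2)
  have hinj {p q : L.P (n + 1)} (hp : p ∈ L.gr (n + 1) (n + 1 : ℕ))
      (hq : q ∈ L.gr (n + 1) (n + 1 : ℕ)) (h : L.d n p = L.d n q) : p = q := by
    rw [← sub_eq_zero]
    refine L.eq_zero_of_mem_cycles ?_ (sub_mem hp hq)
    change L.d n (p - q) = 0
    rw [map_sub, h, sub_self]
  have hgr (a : k) {q : L.P (n + 1)} (hq : q ∈ L.gr (n + 1) (n + 1 : ℕ)) :
      a • q ∈ L.gr (n + 1) (n + 1 : ℕ) := by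
    have h : algebraMap k R a ∈ 𝒜 0 := by
      rw [IsConnectedGraded.zero_eq (𝒜 := 𝒜)]; exact ⟨a, rfl⟩
    simpa using L.smul_mem (n + 1) 0 (n + 1 : ℕ) _ q h hq
  let b' : koszulGen 𝒜 (augmentation 𝒜) (n + 1) →ₗ[k] L.P (n + 1) :=
    { toFun := f
      map_add' := fun x y => hinj (hf _) (add_mem (hf _) (hf _)) (by
        rw [map_add, hdf, hdf, hdf, map_add, map_add])
      map_smul' := fun a x => hinj (hf _) (hgr a (hf _)) (by
        rw [hdf, RingHom.id_apply, c.map_smul]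
        change _ = L.d n (algebraMap k R a • f x)
        rw [(L.d n).map_smul, hdf, ← algebraMap_smul R a (c x), LinearMap.map_smul]) }
  have hdb (x) : L.d n (b' x) = freeLift b (c x) := hdf x
  -- the Koszul differential, extended to `R ⊗ G_{n + 1}`
  have hd1 (t) : L.d n (freeLift (A := R) b' t) = freeLift b (freeLift (A := R) c t) := by
    induction t with
    | zero => simp
    | add x y hx hy => simp only [map_add, hx, hy]
    | tmul a x => simp only [freeLift_tmul, map_smul, hdb]
  have hd2 (t) : barDiff (augmentation 𝒜) n (koszulMap 𝒜 (augmentation 𝒜) (n + 1) t) =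
      koszulMap 𝒜 (augmentation 𝒜) n (freeLift (A := R) c t) := by
    induction t with
    | zero => simp
    | add x y hx hy => simp only [map_add, hx, hy]
    | tmul a x => rw [freeLift_tmul, map_smul, (hc x).1, koszulMap_tmul, map_smul]
  have hbij : Function.Bijective (freeLift (A := R) b') := by
    have := L.projective (n + 1)
    refine freeLift_bijective 𝒜 (L.isInternal (n + 1)) (L.smul_mem (n + 1)) (L.generated (n + 1))
      hf ?_ ?_
    · rw [injective_iff_map_eq_zero]
      intro x hx
      have h1 := hdb x
      rw [hx, map_zero] at h1
      have h2 : c x = 0 := hb.bijective.1 (h1.symm.trans (map_zero _).symm)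
      have h3 := (hc x).1
      rw [h2, map_zero] at h3
      ext
      rw [← (barDiff_mem_of_mem_koszulGen 𝒜 (augmentation 𝒜) x.2).2, ← h3, map_zero]
      rfl
    · intro p hp
      obtain ⟨t, ht⟩ := hb.bijective.2 (L.d n p)
      have htc : freeLift b t ∈ L.cycles n := by rw [ht, ← range_d]; exact ⟨p, rfl⟩
      -- `t` lies in `V ⊗ G_n` for degree reasons
      have ht1 : tensorProj 𝒜 1 t = t := by
        apply hb.bijective.1
        have h := grComp_freeLift 𝒜 (L.isInternal n) (L.smul_mem n) hb.mem_gr 1 t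
        rw [← h]
        refine grComp_of_mem _ ?_
        have := L.d_mem n _ p hp
        rw [← ht] at this
        rw [add_comm]
        exact_mod_cast this
      have htV : koszulMap 𝒜 (augmentation 𝒜) n t ∈
          degOneMul 𝒜 n (koszulGen 𝒜 (augmentation 𝒜) n) := by
        rw [← ht1]
        clear ht1 ht htc
        induction t with
        | zero => simp
        | add x y hx hy => rw [map_add, map_add]; exact add_mem hx hy
        | tmul a g =>
          exact Submodule.apply_mem_map₂ _ (DirectSum.decompose 𝒜 a 1).2 g.2
      have hx := (mem_koszulGen_succ 𝒜 (augmentation 𝒜)).2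
        ⟨_, htV, (hb.mem_cycles t).1 htc, rfl⟩
      refine ⟨⟨_, hx⟩, hinj (hf _) hp ?_⟩
      rw [hdb, ← ht]
      congr 1
      apply koszulMap_injective 𝒜 (augmentation 𝒜) n
      rw [(hc _).1]
      exact barDiff_barCons _ ((hb.mem_cycles t).1 htc)
  refine ⟨b', ⟨hf, hbij, fun t => ?_⟩, fun t ht => ?_⟩
  · change L.d n _ = 0 ↔ barDiff _ n _ = 0
    rw [hd1, hd2, map_eq_zero_iff _ hb.bijective.1,
      map_eq_zero_iff _ (koszulMap_injective 𝒜 (augmentation 𝒜) n)]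
  · rw [← range_d] at ht
    obtain ⟨p, hp⟩ := ht
    obtain ⟨t', rfl⟩ := hbij.2 p
    rw [hd1] at hp
    exact ⟨t', by rw [hd2, hb.bijective.1 hp]⟩

theorem exists_isComparison (n : ℕ) : ∃ b, L.IsComparison n b := by
  induction n with
  | zero => exact L.exists_isComparison_zero
  | succ n ih =>
    obtain ⟨b, hb⟩ := ih
    obtain ⟨b', hb', -⟩ := hb.exists_succ
    exact ⟨b', hb'⟩

/-- The Koszul complex is exact. -/
theorem koszul_exact (L : LinearResolution 𝒜) (n : ℕ) (t : R ⊗[k] koszulGen 𝒜 (augmentation 𝒜) n)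
    (ht : koszulMap 𝒜 (augmentation 𝒜) n t ∈ barCycles (augmentation 𝒜) n) :
    ∃ t', barDiff (augmentation 𝒜) n (koszulMap 𝒜 (augmentation 𝒜) (n + 1) t') =
      koszulMap 𝒜 (augmentation 𝒜) n t := by
  obtain ⟨b, hb⟩ := L.exists_isComparison n
  obtain ⟨b', -, h⟩ := hb.exists_succ
  exact h t ((hb.mem_cycles t).2 ht)

/-- If the global dimension is at most `d`, the Koszul complex stops at `R ⊗ G_d`. -/
theorem koszulMap_eq_zero_of_globalDimension_le (L : LinearResolution 𝒜) {d : ℕ}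
    (hd : globalDimension R ≤ d) (t : R ⊗[k] koszulGen 𝒜 (augmentation 𝒜) d)
    (ht : koszulMap 𝒜 (augmentation 𝒜) d t ∈ barCycles (augmentation 𝒜) d) : t = 0 := by
  obtain ⟨b, hb⟩ := L.exists_isComparison d
  have := L.projective
  obtain ⟨r, hr⟩ := exists_retraction_of_globalDimension_le hd L.P L.cycles fun i =>
    (L.d i).quotKerEquivRange.trans (LinearEquiv.ofEq _ _ (L.range_d i))
  let E := LinearEquiv.ofBijective (freeLift (A := R) b) hb.bijective
  refine eq_zero_of_retract 𝒜 ((L.cycles d).comap (freeLift (A := R) b)) (fun x hx => ?_)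
    (E.symm.toLinearMap ∘ₗ (L.cycles d).subtype ∘ₗ r ∘ₗ E.toLinearMap) (fun x => ?_)
    (fun x hx => ?_) t ((hb.mem_cycles t).2 ht)
  · apply hb.bijective.1
    have h := grComp_freeLift 𝒜 (L.isInternal d) (L.smul_mem d) hb.mem_gr 0 x
    rw [map_zero, ← h]
    exact L.eq_zero_of_mem_cycles (L.grComp_mem_cycles _ hx)
      (by simpa using grComp_mem (L.isInternal d) _ _)
  · change E (E.symm (r (E x))) ∈ L.cycles d
    rw [E.apply_symm_apply]
    exact (r (E x)).2
  · change E.symm (r (E x)) = x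
    rw [E.symm_apply_eq]
    exact congrArg Subtype.val (hr ⟨E x, hx⟩)

end LinearResolution

end Resolution

/-! ### Extending cochains from the Koszul complex to the bar resolution -/

section Extension

variable {k : Type u} [Field k] {A : Type v} [Ring A] [Algebra k A]
  {𝒜 : ℕ → Submodule k A} {ε : A →ₐ[k] k}

/-- If the Koszul complex is exact, then it is a retract of the bar resolution. The retraction is
built degree by degree as a chain map that fixes the Koszul complex; its value on a generator
`1 ⊗ b` is a preimage under the Koszul differential, chosen linearly in `b`. -/
theorem exists_koszul_retraction
    (hex : ∀ n t, koszulMap 𝒜 ε n t ∈ barCycles ε n →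
      ∃ t', barDiff ε n (koszulMap 𝒜 ε (n + 1) t') = koszulMap 𝒜 ε n t) (n : ℕ) :
    ∃ θ : barTerm k A n →ₗ[A] barTerm k A n, (∀ x, θ x ∈ LinearMap.range (koszulMap 𝒜 ε n)) ∧
      (∀ t, θ (koszulMap 𝒜 ε n t) = koszulMap 𝒜 ε n t) ∧
      ∀ x ∈ barCycles ε n, θ x ∈ barCycles ε n := by
  induction n with
  | zero =>
    refine ⟨LinearMap.id, fun x => ?_, fun t => rfl, fun x hx => hx⟩
    exact ⟨barVal k A x ⊗ₜ ⟨barOne k A, Submodule.subset_span rfl⟩, barVal_smul_barOne x⟩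
  | succ n ih =>
    obtain ⟨θ, hθr, hθ, hθc⟩ := ih
    -- a linear section `ρ` of the differential of the Koszul complex
    let f : A ⊗[k] koszulGen 𝒜 ε (n + 1) →ₗ[k] barTerm k A n :=
      (barDiff ε n ∘ₗ koszulMap 𝒜 ε (n + 1)).restrictScalars k
    obtain ⟨s, hs⟩ := f.rangeRestrict.exists_rightInverse_of_surjective f.range_rangeRestrict
    obtain ⟨ρ, hρ⟩ := LinearMap.exists_extend s
    have hρ' (z) (hz : z ∈ LinearMap.range f) : f (ρ z) = z := by
      have h1 : ρ z = s ⟨z, hz⟩ := LinearMap.congr_fun hρ ⟨z, hz⟩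
      rw [h1]
      exact congrArg Subtype.val (LinearMap.congr_fun hs ⟨z, hz⟩)
    -- a linear projection `π` onto the space `κ` of generators of the next term
    let κ := degOneMul 𝒜 n (koszulGen 𝒜 ε n) ⊓ (barCycles ε n).restrictScalars k
    obtain ⟨π, hπ⟩ := LinearMap.exists_extend (LinearMap.id : κ →ₗ[k] κ)
    have hπ' (z) (hz : z ∈ κ) : (π z : barTerm k A n) = z :=
      congrArg Subtype.val (LinearMap.congr_fun hπ ⟨z, hz⟩)
    -- `g b` is the value on `1 ⊗ b`: it is `1 ⊗ b` for `b ∈ κ`, and a lift along `ρ` for `π b = 0`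
    let g : barTerm k A n →ₗ[k] barTerm k A (n + 1) :=
      ((koszulMap 𝒜 ε (n + 1)).restrictScalars k ∘ₗ ρ ∘ₗ θ.restrictScalars k ∘ₗ
        (barDiff ε n).restrictScalars k ∘ₗ barCons n) ∘ₗ (LinearMap.id - κ.subtype ∘ₗ π) +
      barCons n ∘ₗ κ.subtype ∘ₗ π
    have hg (b) : g b = koszulMap 𝒜 ε (n + 1) (ρ (θ (barDiff ε n (barCons n (b - π b))))) +
      barCons n (π b) := rfl
    have hκ (b) : ((π b : κ) : barTerm k A n) ∈ barCycles ε n := (π b).2.2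
    have hdθ : barDiff ε n ∘ₗ barLift n g = θ ∘ₗ barDiff ε n := by
      refine bar_hom_ext fun b => ?_
      rw [LinearMap.comp_apply, barLift_barCons, LinearMap.comp_apply, hg, map_add,
        barDiff_barCons ε (hκ b)]
      obtain ⟨t, ht⟩ := hθr (barDiff ε n (barCons n (b - π b)))
      have htc : koszulMap 𝒜 ε n t ∈ barCycles ε n := by
        rw [ht]
        exact hθc _ (barDiff_mem_barCycles ε n _)
      obtain ⟨t', ht'⟩ := hex n t htc
      have h1 : barDiff ε n (koszulMap 𝒜 ε (n + 1)
          (ρ (θ (barDiff ε n (barCons n (b - π b)))))) = θ (barDiff ε n (barCons n (b - π b))) :=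
        hρ' _ (by rw [← ht, ← ht']; exact ⟨t', rfl⟩)
      obtain ⟨t'', ht'', -⟩ := exists_koszulMap_eq 𝒜 ε (π b).2.1
      have h2 : θ (π b) = (π b : barTerm k A n) := by rw [← ht'', hθ]
      rw [h1, map_sub, map_sub, map_sub, barDiff_barCons ε (hκ b), h2, sub_add_cancel]
    refine ⟨barLift n g, fun x => ?_, fun t => ?_, fun x hx => ?_⟩
    · induction x using bar_induction with
      | h0 => rw [map_zero]; exact zero_mem _
      | hadd x y hx hy => rw [map_add]; exact add_mem hx hy
      | hsmul a b =>
        rw [map_smul, barLift_barCons, hg]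
        refine Submodule.smul_mem _ _ (add_mem ⟨_, rfl⟩ ?_)
        have h := (mem_koszulGen_succ 𝒜 ε).2 ⟨_, (π b).2.1, (π b).2.2, rfl⟩
        exact ⟨1 ⊗ₜ ⟨_, h⟩, by rw [koszulMap_tmul, one_smul]⟩
    · induction t with
      | zero => simp
      | add x y hx hy => simp only [map_add, hx, hy]
      | tmul a g =>
        obtain ⟨g, hg'⟩ := g
        obtain ⟨y, hy, hy', rfl⟩ := (mem_koszulGen_succ 𝒜 ε).1 hg'
        rw [koszulMap_tmul, map_smul, barLift_barCons, hg, hπ' y ⟨hy, hy'⟩]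
        simp
    · have h := LinearMap.congr_fun hdθ x
      rw [LinearMap.comp_apply, LinearMap.comp_apply, (mem_barCycles_succ ε).1 hx, map_zero] at h
      exact h

/-- If the Koszul complex is exact and stops at `A ⊗ G_n`, then every functional on `G_n` extends
to an `A`-linear cocycle on the bar resolution. -/
theorem exists_cocycle_extending
    (hex : ∀ n t, koszulMap 𝒜 ε n t ∈ barCycles ε n →
      ∃ t', barDiff ε n (koszulMap 𝒜 ε (n + 1) t') = koszulMap 𝒜 ε n t) {n : ℕ}
    (hn : ∀ t, koszulMap 𝒜 ε n t ∈ barCycles ε n → t = 0)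
    (φ : Module.Dual k (koszulGen 𝒜 ε n)) :
    ∃ F : barTerm k A n →ₗ[A] A, (∀ x, F (barDiff ε n x) = 0) ∧
      ∀ g : koszulGen 𝒜 ε n, F g = algebraMap k A (φ g) := by
  obtain ⟨θ, hθr, hθ, hθc⟩ := exists_koszul_retraction hex n
  let E := LinearEquiv.ofInjective _ (koszulMap_injective 𝒜 ε n)
  have hE (x) (t) (h : θ x = koszulMap 𝒜 ε n t) : E.symm (θ.codRestrict _ hθr x) = t := by
    rw [E.symm_apply_eq]
    exact Subtype.ext h
  refine ⟨freeLift (Algebra.linearMap k A ∘ₗ φ) ∘ₗ E.symm.toLinearMap ∘ₗ θ.codRestrict _ hθr,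
    fun x => ?_, fun g => ?_⟩
  · obtain ⟨t, ht⟩ := hθr (barDiff ε n x)
    have ht0 : t = 0 := hn t (by rw [ht]; exact hθc _ (barDiff_mem_barCycles ε n x))
    change freeLift _ (E.symm (θ.codRestrict _ hθr (barDiff ε n x))) = 0
    rw [hE _ t ht.symm, ht0, map_zero]
  · change freeLift _ (E.symm (θ.codRestrict _ hθr g)) = _
    have h1 : koszulMap 𝒜 ε n ((1 : A) ⊗ₜ[k] g) = g := by rw [koszulMap_tmul, one_smul]
    have h2 := hθ ((1 : A) ⊗ₜ[k] g)
    rw [h1] at h2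
    rw [hE _ (1 ⊗ₜ g) (h2.trans h1.symm), freeLift_tmul, one_smul]
    rfl

end Extension

/-! ### The grading of the bar resolution -/

section BarGrading

variable {k : Type u} [Field k] {A : Type v} [Ring A] [Algebra k A]
  (𝒜 : ℕ → Submodule k A)

theorem barGrade_succ (n m : ℕ) : barGrade 𝒜 (n + 1) m = Submodule.span k
    {x : barTerm k A (n + 1) | ∃ i j : ℕ, i + j = m ∧
      ∃ a ∈ 𝒜 i, ∃ b ∈ barGrade 𝒜 n j, x = a • barCons n b} := by
  simp only [smul_barCons]
  rfl

theorem smul_barCons_mem_barGrade {n i j : ℕ} {a : A} (ha : a ∈ 𝒜 i) {b : barTerm k A n}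
    (hb : b ∈ barGrade 𝒜 n j) : a • barCons n b ∈ barGrade 𝒜 (n + 1) (i + j) := by
  rw [barGrade_succ]
  exact Submodule.subset_span ⟨i, j, rfl, a, ha, b, hb, rfl⟩

theorem barGrade_succ_le {n m : ℕ} {S : Submodule k (barTerm k A (n + 1))}
    (h : ∀ i j, i + j = m → ∀ a ∈ 𝒜 i, ∀ b ∈ barGrade 𝒜 n j, a • barCons n b ∈ S) :
    barGrade 𝒜 (n + 1) m ≤ S := by
  rw [barGrade_succ, Submodule.span_le]
  rintro _ ⟨i, j, hij, a, ha, b, hb, rfl⟩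
  exact h i j hij a ha b hb

variable [GradedAlgebra 𝒜]

theorem smul_mem_barGrade {n i j : ℕ} {a : A} (ha : a ∈ 𝒜 i) {x : barTerm k A n}
    (hx : x ∈ barGrade 𝒜 n j) : a • x ∈ barGrade 𝒜 n (i + j) := by
  cases n with
  | zero => exact SetLike.mul_mem_graded (A := 𝒜) ha hx
  | succ n =>
    suffices h : barGrade 𝒜 (n + 1) j ≤ (barGrade 𝒜 (n + 1) (i + j)).comap (barSMul a (n + 1)) from
      h hx
    refine barGrade_succ_le 𝒜 ?_
    rintro i' j' rfl b hb c hc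
    change a • b • barCons n c ∈ barGrade 𝒜 (n + 1) (i + (i' + j'))
    rw [smul_smul, ← add_assoc]
    exact smul_barCons_mem_barGrade 𝒜 (SetLike.mul_mem_graded ha hb) hc

theorem barCons_mem_barGrade {n j : ℕ} {b : barTerm k A n} (hb : b ∈ barGrade 𝒜 n j) :
    barCons n b ∈ barGrade 𝒜 (n + 1) j := by
  have h := smul_barCons_mem_barGrade 𝒜 (SetLike.one_mem_graded 𝒜) hb
  rwa [one_smul, zero_add] at h

theorem barD_mem_barGrade [IsConnectedGraded 𝒜] {n m : ℕ} {x : barTerm k A (n + 1)}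
    (hx : x ∈ barGrade 𝒜 (n + 1) m) : barD (augmentation 𝒜) n x ∈ barGrade 𝒜 n m := by
  suffices h : barGrade 𝒜 (n + 1) m ≤ (barGrade 𝒜 n m).comap (barD (augmentation 𝒜) n) from h hx
  clear hx x
  induction n generalizing m with
  | zero =>
    refine barGrade_succ_le 𝒜 ?_
    rintro i j rfl a ha b hb
    rw [Submodule.mem_comap, barD_zero_smul_barCons]
    refine sub_mem (smul_mem_barGrade 𝒜 ha hb) ?_
    by_cases hj : j = 0
    · subst hj
      refine smul_mem_barGrade 𝒜 ha (Submodule.smul_mem _ _ ?_)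
      exact SetLike.one_mem_graded 𝒜
    · rw [augmentation_of_mem 𝒜 hj (show barVal k A b ∈ 𝒜 j from hb), zero_smul, smul_zero]
      exact zero_mem _
  | succ n ih =>
    refine barGrade_succ_le 𝒜 ?_
    rintro i j rfl a ha b hb
    rw [Submodule.mem_comap, barD_succ_smul_barCons]
    exact sub_mem (smul_mem_barGrade 𝒜 ha hb) (smul_barCons_mem_barGrade 𝒜 ha (ih hb))

theorem koszulGen_le_barGrade (ε : A →ₐ[k] k) (n : ℕ) : koszulGen 𝒜 ε n ≤ barGrade 𝒜 n n := by
  induction n with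
  | zero =>
    rw [koszulGen, Submodule.span_singleton_le_iff_mem]
    exact SetLike.one_mem_graded 𝒜
  | succ n ih =>
    intro x hx
    obtain ⟨y, hy, -, rfl⟩ := (mem_koszulGen_succ 𝒜 ε).1 hx
    refine barCons_mem_barGrade 𝒜 ?_
    have h : degOneMul 𝒜 n (koszulGen 𝒜 ε n) ≤ barGrade 𝒜 n (n + 1) :=
      Submodule.map₂_le.2 fun v hv g hg => by
        rw [add_comm]
        exact smul_mem_barGrade 𝒜 hv (ih hg)
    exact h hy

theorem iSup_barGrade (n : ℕ) : ⨆ m, barGrade 𝒜 n m = ⊤ := by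
  induction n with
  | zero => exact (DirectSum.Decomposition.isInternal 𝒜).submodule_iSup_eq_top
  | succ n ih =>
    rw [eq_top_iff]
    rintro x -
    induction x using bar_induction with
    | h0 => exact zero_mem _
    | hadd x y hx hy => exact add_mem hx hy
    | hsmul a b =>
      have hb : b ∈ ⨆ m, barGrade 𝒜 n m := by rw [ih]; exact Submodule.mem_top
      induction a using DirectSum.Decomposition.inductionOn 𝒜 with
      | zero => rw [zero_smul]; exact zero_mem _
      | add a a' h h' => rw [add_smul]; exact add_mem h h'
      | @homogeneous i a =>
        induction hb using Submodule.iSup_induction' with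
        | mem m b hb => exact Submodule.mem_iSup_of_mem _ (smul_barCons_mem_barGrade 𝒜 a.2 hb)
        | zero => rw [map_zero, smul_zero]; exact zero_mem _
        | add b b' _ _ h h' => rw [map_add, smul_add]; exact add_mem h h'

/-- The map `f ⊗ g` on `B_{n + 1} = A ⊗ B_n`. -/
def barMap (n : ℕ) (f : A →ₗ[k] A) (g : barTerm k A n →ₗ[k] barTerm k A n) :
    barTerm k A (n + 1) →ₗ[k] barTerm k A (n + 1) :=
  TensorProduct.map f g

theorem barMap_smul_barCons (n : ℕ) (f : A →ₗ[k] A) (g : barTerm k A n →ₗ[k] barTerm k A n)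
    (a : A) (b : barTerm k A n) : barMap n f g (a • barCons n b) = f a • barCons n (g b) := by
  rw [smul_barCons, smul_barCons]
  rfl

/-- The projection of `B_n` onto its component of degree `m`. -/
def barProj : (n : ℕ) → ℕ → barTerm k A n →ₗ[k] barTerm k A n
  | 0, m => (GradedAlgebra.proj 𝒜 m : A →ₗ[k] A)
  | n + 1, m => ∑ p ∈ Finset.HasAntidiagonal.antidiagonal m,
      barMap n (GradedAlgebra.proj 𝒜 p.1) (barProj n p.2)

theorem barProj_smul_barCons (n m : ℕ) (a : A) (b : barTerm k A n) :
    barProj 𝒜 (n + 1) m (a • barCons n b) = ∑ p ∈ Finset.HasAntidiagonal.antidiagonal m,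
      GradedAlgebra.proj 𝒜 p.1 a • barCons n (barProj 𝒜 n p.2 b) := by
  rw [barProj, LinearMap.sum_apply]
  simp only [barMap_smul_barCons]

theorem barProj_of_mem {n i : ℕ} (m : ℕ) {x : barTerm k A n} (hx : x ∈ barGrade 𝒜 n i) :
    barProj 𝒜 n m x = if i = m then x else 0 := by
  induction n generalizing i m with
  | zero =>
    split_ifs with h
    · subst h
      exact DirectSum.decompose_of_mem_same 𝒜 hx
    · exact DirectSum.decompose_of_mem_ne 𝒜 hx h
  | succ n ih =>
    suffices h : barGrade 𝒜 (n + 1) i ≤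
        LinearMap.eqLocus (barProj 𝒜 (n + 1) m) (if i = m then LinearMap.id else 0) by
      have h' := h hx
      rw [LinearMap.mem_eqLocus] at h'
      rw [h']
      split_ifs <;> rfl
    refine barGrade_succ_le 𝒜 ?_
    rintro i j rfl a ha b hb
    rw [LinearMap.mem_eqLocus, barProj_smul_barCons]
    have hterm (p : ℕ × ℕ) : GradedAlgebra.proj 𝒜 p.1 a • barCons n (barProj 𝒜 n p.2 b) =
        if p = (i, j) then a • barCons n b else 0 := by
      rw [ih p.2 hb, GradedAlgebra.proj_apply]
      by_cases h1 : i = p.1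
      · rw [h1, DirectSum.decompose_of_mem_same 𝒜 (h1 ▸ ha)]
        by_cases h2 : j = p.2
        · rw [if_pos h2, if_pos (by rw [h2])]
        · rw [if_neg h2, if_neg (fun h => h2 (by rw [h])), map_zero, smul_zero]
      · rw [DirectSum.decompose_of_mem_ne 𝒜 ha h1, zero_smul, if_neg fun h => h1 (by rw [h])]
    rw [Finset.sum_congr rfl fun p _ => hterm p, Finset.sum_ite_eq']
    simp only [Finset.HasAntidiagonal.mem_antidiagonal]
    split_ifs <;> rfl

theorem isInternal_barGrade (n : ℕ) : DirectSum.IsInternal (barGrade 𝒜 n) := by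
  refine DirectSum.isInternal_submodule_of_iSupIndep_of_iSup_eq_top ?_ (iSup_barGrade 𝒜 n)
  intro i
  rw [Submodule.disjoint_def]
  intro x hx hx'
  have h0 : ⨆ j, ⨆ (_ : j ≠ i), barGrade 𝒜 n j ≤ LinearMap.ker (barProj 𝒜 n i) :=
    iSup₂_le fun j hj y hy => by
      rw [LinearMap.mem_ker, barProj_of_mem 𝒜 i hy, if_neg hj]
  have h1 := LinearMap.mem_ker.1 (h0 hx')
  rwa [barProj_of_mem 𝒜 i hx, if_pos rfl] at h1

/-- The projection of `A` onto its component of degree `j`, for an integer `j`. -/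
def intProj (j : ℤ) : A →ₗ[k] A := if 0 ≤ j then GradedAlgebra.proj 𝒜 j.toNat else 0

theorem intProj_mem (j : ℤ) (a : A) : intProj 𝒜 j a ∈ intGrade 𝒜 j := by
  unfold intProj intGrade
  split_ifs
  · exact (DirectSum.decompose 𝒜 a _).2
  · exact zero_mem _

theorem intProj_of_mem {j : ℤ} {a : A} (ha : a ∈ intGrade 𝒜 j) : intProj 𝒜 j a = a := by
  unfold intGrade at ha
  unfold intProj
  split_ifs at ha ⊢
  · exact DirectSum.decompose_of_mem_same 𝒜 ha
  · exact ((Submodule.mem_bot k).1 ha).symm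

theorem intProj_mul {i : ℕ} {a : A} (ha : a ∈ 𝒜 i) (j : ℤ) (b : A) :
    intProj 𝒜 (i + j) (a * b) = a * intProj 𝒜 j b := by
  unfold intProj
  by_cases hj : 0 ≤ j
  · rw [if_pos hj, if_pos (by omega), GradedAlgebra.proj_apply, GradedAlgebra.proj_apply,
      DirectSum.coe_decompose_mul_of_left_mem_of_le 𝒜 ha (by omega)]
    rw [show (↑i + j).toNat - i = j.toNat by omega]
  · rw [if_neg hj]
    split_ifs with h
    · rw [GradedAlgebra.proj_apply, DirectSum.coe_decompose_mul_of_left_mem_of_not_le 𝒜 ha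
        (by omega), LinearMap.zero_apply, mul_zero]
    · simp

/-- The homogeneous component of degree `j` of an `A`-linear map `B_n → A`. -/
theorem exists_barCochain_component {n : ℕ} (F : barTerm k A n →ₗ[A] A) (j : ℤ) :
    ∃ F' ∈ barCochain 𝒜 n j, ∀ m, ∀ x ∈ barGrade 𝒜 n m, F' x = intProj 𝒜 (j + m) (F x) := by
  let E := LinearEquiv.ofBijective (DirectSum.coeLinearMap (barGrade 𝒜 n)) (isInternal_barGrade 𝒜 n)
  let F' : barTerm k A n →ₗ[k] A := DirectSum.toModule k ℕ A (fun m =>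
    intProj 𝒜 (j + m) ∘ₗ F.restrictScalars k ∘ₗ (barGrade 𝒜 n m).subtype) ∘ₗ E.symm.toLinearMap
  have hF' (m) (x) (hx : x ∈ barGrade 𝒜 n m) : F' x = intProj 𝒜 (j + m) (F x) := by
    have h : E.symm x = DirectSum.lof k ℕ (fun m => barGrade 𝒜 n m) m ⟨x, hx⟩ := by
      rw [E.symm_apply_eq]
      exact (DirectSum.coeLinearMap_lof (barGrade 𝒜 n) m ⟨x, hx⟩).symm
    change DirectSum.toModule k ℕ A _ (E.symm x) = _
    rw [h, DirectSum.toModule_lof]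
    rfl
  refine ⟨F', ⟨fun a x => ?_, fun m x hx => ?_⟩, hF'⟩
  · rw [← bar_smul_def]
    have hx : x ∈ ⨆ m, barGrade 𝒜 n m := by rw [iSup_barGrade]; exact Submodule.mem_top
    induction a using DirectSum.Decomposition.inductionOn 𝒜 with
    | zero => rw [zero_smul, map_zero, zero_mul]
    | add a a' h h' => rw [add_smul, map_add, h, h', add_mul]
    | @homogeneous i a =>
      induction hx using Submodule.iSup_induction' with
      | mem m x hx =>
        rw [hF' _ _ hx, hF' _ _ (smul_mem_barGrade 𝒜 a.2 hx), map_smul, smul_eq_mul,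
          ← intProj_mul 𝒜 a.2]
        congr 2
        push_cast
        ring
      | zero => rw [smul_zero, map_zero, mul_zero]
      | add x y _ _ hx hy => rw [smul_add, map_add, hx, hy, map_add, mul_add]
  · rw [hF' m x hx]
    exact intProj_mem 𝒜 _ _

/-- If the Koszul complex is exact and stops at `A ⊗ G_n`, then every functional on `G_n` is the
reduction of a homogeneous cocycle of degree `-n`. -/
theorem exists_barCocycle_extending [IsConnectedGraded 𝒜]
    (hex : ∀ n t, koszulMap 𝒜 (augmentation 𝒜) n t ∈ barCycles (augmentation 𝒜) n →
      ∃ t', barDiff (augmentation 𝒜) n (koszulMap 𝒜 (augmentation 𝒜) (n + 1) t') =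
        koszulMap 𝒜 (augmentation 𝒜) n t) {n : ℕ}
    (hn : ∀ t, koszulMap 𝒜 (augmentation 𝒜) n t ∈ barCycles (augmentation 𝒜) n → t = 0)
    (φ : Module.Dual k (koszulGen 𝒜 (augmentation 𝒜) n)) :
    ∃ F ∈ barCocycle 𝒜 (augmentation 𝒜) n (-n), ∀ g : koszulGen 𝒜 (augmentation 𝒜) n,
      augmentation 𝒜 (F g) = φ g := by
  obtain ⟨F, hF, hφ⟩ := exists_cocycle_extending hex hn φ
  obtain ⟨F', hF', h⟩ := exists_barCochain_component 𝒜 F (-n)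
  refine ⟨F', ⟨hF', ?_⟩, fun g => ?_⟩
  · change F' ∘ₗ barD (augmentation 𝒜) n = 0
    ext x
    have hx : x ∈ ⨆ m, barGrade 𝒜 (n + 1) m := by rw [iSup_barGrade]; exact Submodule.mem_top
    induction hx using Submodule.iSup_induction' with
    | mem m x hx =>
      rw [LinearMap.comp_apply, h m _ (barD_mem_barGrade 𝒜 hx), ← barDiff_apply, hF, map_zero,
        LinearMap.zero_apply]
    | zero => simp
    | add x y _ _ hx hy => rw [map_add, hx, hy, map_add]
  · rw [h n g (koszulGen_le_barGrade 𝒜 _ n g.2), hφ, intProj_of_mem, AlgHom.commutes]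
    · rfl
    · rw [neg_add_cancel]
      change _ ∈ 𝒜 0
      rw [IsConnectedGraded.zero_eq (𝒜 := 𝒜)]
      exact ⟨_, rfl⟩

end BarGrading

/-! ### The top degree of the Koszul complex -/

section TopDegree

variable {k : Type u} [Field k] {R : Type v} [Ring R] [Algebra k R]
  (𝒜 : ℕ → Submodule k R) [GradedAlgebra 𝒜] [IsConnectedGraded 𝒜]

theorem koszulGen_zero_ne_bot : koszulGen 𝒜 (augmentation 𝒜) 0 ≠ ⊥ := by
  have : Nontrivial R := IsConnectedGraded.nontrivial (𝒜 := 𝒜)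
  rw [koszulGen, Ne, Submodule.span_singleton_eq_bot]
  exact one_ne_zero (α := R)

/-- Coboundaries of the bar resolution take values in `R₊` on the generators of the Koszul
complex. -/
theorem augmentation_barCoboundary {n : ℕ} {j : ℤ} {F : barTerm k R n →ₗ[k] R}
    (hF : F ∈ barCoboundary 𝒜 (augmentation 𝒜) n j) {g : barTerm k R n}
    (hg : g ∈ koszulGen 𝒜 (augmentation 𝒜) n) : augmentation 𝒜 (F g) = 0 := by
  cases n with
  | zero =>
    rw [(Submodule.mem_bot k).1 hF]
    simp
  | succ n =>
    obtain ⟨C, hC, rfl⟩ := hF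
    have hV := (barDiff_mem_of_mem_koszulGen 𝒜 (augmentation 𝒜) hg).1
    have hle : degOneMul 𝒜 n (koszulGen 𝒜 (augmentation 𝒜) n) ≤
        LinearMap.ker ((augmentation 𝒜).toLinearMap ∘ₗ C) :=
      Submodule.map₂_le.2 fun v hv x _ => by
        rw [LinearMap.mem_ker, LinearMap.comp_apply]
        refine (congrArg (augmentation 𝒜) (hC.1 v x)).trans ?_
        rw [map_mul, augmentation_of_mem 𝒜 one_ne_zero hv, zero_mul]
    exact hle hV

/-- The properties of the degree `d` in which the Koszul complex of an AS-regular algebra ends: it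
is the injective dimension, `G_d` is a line, and the class of a cocycle on `B_d` is determined by
its reduction `ε ∘ F` on `G_d`, which vanishes for all degrees except `-d`. -/
structure IsKoszulTop (d : ℕ) : Prop where
  selfInjectiveDimension_eq : selfInjectiveDimension R = d
  exists_generator : ∃ γ ≠ 0, koszulGen 𝒜 (augmentation 𝒜) d = Submodule.span k {γ}
  exists_cocycle : ∃ F ∈ barCocycle 𝒜 (augmentation 𝒜) d (-d),
    ∃ g ∈ koszulGen 𝒜 (augmentation 𝒜) d, augmentation 𝒜 (F g) ≠ 0
  mem_barCoboundary : ∀ F ∈ barCocycle 𝒜 (augmentation 𝒜) d (-d),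
    (∀ g ∈ koszulGen 𝒜 (augmentation 𝒜) d, augmentation 𝒜 (F g) = 0) →
      F ∈ barCoboundary 𝒜 (augmentation 𝒜) d (-d)
  mem_barCoboundary_of_ne : ∀ j : ℤ, j ≠ -d → ∀ F ∈ barCocycle 𝒜 (augmentation 𝒜) d j,
    F ∈ barCoboundary 𝒜 (augmentation 𝒜) d j

/-- The last nonzero term of the Koszul complex sits in the degree `p` of its length. Functionals on
`G_p` extend to cocycles, so `Ext^p(k, R)` is nonzero, and by the Gorenstein condition `p` is the
injective dimension, hence the global dimension. -/
theorem exists_isKoszulTop_degree (L : LinearResolution 𝒜) {n : ℕ} {l : ℤ}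
    (hG : IsASGorenstein 𝒜 n l) {d : ℕ} (hd : globalDimension R = d) [IsNoetherianRing R] :
    n = d ∧ l = d ∧ koszulGen 𝒜 (augmentation 𝒜) d ≠ ⊥ ∧
      ∀ t, koszulMap 𝒜 (augmentation 𝒜) d t ∈ barCycles (augmentation 𝒜) d → t = 0 := by
  classical
  have hvanish : ∃ p, koszulGen 𝒜 (augmentation 𝒜) (p + 1) = ⊥ := by
    refine ⟨d, (Submodule.eq_bot_iff _).2 fun x hx => ?_⟩
    obtain ⟨y, hy, hy', rfl⟩ := (mem_koszulGen_succ 𝒜 _).1 hx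
    obtain ⟨t, rfl, -⟩ := exists_koszulMap_eq 𝒜 _ hy
    rw [L.koszulMap_eq_zero_of_globalDimension_le hd.le t hy', map_zero, map_zero]
  have hp1 := Nat.find_spec hvanish
  have hp2 : koszulGen 𝒜 (augmentation 𝒜) (Nat.find hvanish) ≠ ⊥ := by
    rcases h : Nat.find hvanish with _ | q
    · exact koszulGen_zero_ne_bot 𝒜
    · exact Nat.find_min hvanish (m := q) (by omega)
  have hpd : Nat.find hvanish ≤ d := by
    refine Nat.find_min' hvanish ((Submodule.eq_bot_iff _).2 fun x hx => ?_)
    obtain ⟨y, hy, hy', rfl⟩ := (mem_koszulGen_succ 𝒜 _).1 hx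
    obtain ⟨t, rfl, -⟩ := exists_koszulMap_eq 𝒜 _ hy
    rw [L.koszulMap_eq_zero_of_globalDimension_le hd.le t hy', map_zero, map_zero]
  generalize Nat.find hvanish = p at hp1 hp2 hpd
  have hvan : ∀ t, koszulMap 𝒜 (augmentation 𝒜) p t ∈ barCycles (augmentation 𝒜) p → t = 0 := by
    intro t ht
    obtain ⟨t', ht'⟩ := L.koszul_exact p t ht
    have hsub : Subsingleton (koszulGen 𝒜 (augmentation 𝒜) (p + 1)) := by
      rw [hp1]; infer_instance
    have : t' = 0 := Subsingleton.elim _ _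
    rw [this, map_zero, map_zero] at ht'
    exact koszulMap_injective 𝒜 _ p (ht'.symm.trans (map_zero _).symm)
  have hpn : p = n ∧ (-p : ℤ) = -l := by
    obtain ⟨g, hg, hg0⟩ := Submodule.exists_mem_ne_zero_of_ne_bot hp2
    obtain ⟨φ, hφ⟩ : ∃ φ : Module.Dual k (koszulGen 𝒜 (augmentation 𝒜) p), φ ⟨g, hg⟩ ≠ 0 := by
      by_contra! h
      exact hg0 (congrArg Subtype.val ((Module.forall_dual_apply_eq_zero_iff k _).1 h))
    obtain ⟨F, hF, hFφ⟩ := exists_barCocycle_extending 𝒜 L.koszul_exact hvan φ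
    by_contra hne
    have hr := hG.ext_left p (-p)
    rw [if_neg hne, rank_zero_iff] at hr
    have hmem : (barCoboundary 𝒜 (augmentation 𝒜) p (-p)).mkQ F ∈
        gradedExt 𝒜 (augmentation 𝒜) p (-p) := Submodule.mem_map_of_mem hF
    have h0 := congrArg Subtype.val (hr.elim ⟨_, hmem⟩ 0)
    have hFc : F ∈ barCoboundary 𝒜 (augmentation 𝒜) p (-p) :=
      (Submodule.Quotient.mk_eq_zero _).1 h0
    refine hφ ?_
    rw [← hFφ]
    exact augmentation_barCoboundary 𝒜 hFc hg
  have hdn : d ≤ n := by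
    have h := globalDimension_le_of_selfInjectiveDimension hG.injDim_left hd.le
    rw [hd] at h
    exact_mod_cast h
  have hpd' : p = d := by omega
  subst hpd'
  exact ⟨hpn.1.symm, by omega, hp2, hvan⟩

/-- All functionals on `G_d` are reductions of cocycles of degree `-d`, and by the Gorenstein
condition these are multiples of one of them up to coboundaries; hence `G_d` is a line. -/
theorem isKoszulTop (L : LinearResolution 𝒜) {n : ℕ} {l : ℤ}
    (hG : IsASGorenstein 𝒜 n l) {d : ℕ} (hd : globalDimension R = d) [IsNoetherianRing R] :
    IsKoszulTop 𝒜 d := by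
  obtain ⟨rfl, rfl, hne, hvan⟩ := exists_isKoszulTop_degree 𝒜 L hG hd
  have hsurj := exists_barCocycle_extending 𝒜 L.koszul_exact hvan
  obtain ⟨γ, hγ, hγ0⟩ := Submodule.exists_mem_ne_zero_of_ne_bot hne
  obtain ⟨φ, hφ⟩ : ∃ φ : Module.Dual k (koszulGen 𝒜 (augmentation 𝒜) n), φ ⟨γ, hγ⟩ ≠ 0 := by
    by_contra! h
    exact hγ0 (congrArg Subtype.val ((Module.forall_dual_apply_eq_zero_iff k _).1 h))
  obtain ⟨F₀, hF₀, hF₀φ⟩ := hsurj φ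
  have hF₀cob : F₀ ∉ barCoboundary 𝒜 (augmentation 𝒜) n (-n) := fun h => hφ (by
    rw [← hF₀φ]
    exact augmentation_barCoboundary 𝒜 h hγ)
  -- `Ext^n` is one-dimensional, spanned by the class of `F₀`
  have hone : ∀ F ∈ barCocycle 𝒜 (augmentation 𝒜) n (-n),
      ∃ c : k, F - c • F₀ ∈ barCoboundary 𝒜 (augmentation 𝒜) n (-n) := by
    intro F hF
    have hr := hG.ext_left n (-n)
    rw [if_pos ⟨rfl, rfl⟩] at hr
    have hr' := Module.finrank_eq_of_rank_eq (n := 1) (by rw [hr, Nat.cast_one])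
    let e (C) (hC : C ∈ barCocycle 𝒜 (augmentation 𝒜) n (-n)) :
        gradedExt 𝒜 (augmentation 𝒜) n (-n) :=
      ⟨(barCoboundary 𝒜 (augmentation 𝒜) n (-n)).mkQ C, Submodule.mem_map_of_mem hC⟩
    have he0 : e F₀ hF₀ ≠ 0 := fun h =>
      hF₀cob ((Submodule.Quotient.mk_eq_zero _).1 (congrArg Subtype.val h))
    obtain ⟨c, hc⟩ := exists_smul_eq_of_finrank_eq_one hr' he0 (e F hF)
    refine ⟨c, (Submodule.Quotient.mk_eq_zero _).1 ?_⟩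
    have := congrArg Subtype.val hc
    rw [Submodule.Quotient.mk_sub, sub_eq_zero]
    exact this.symm
  have hone' : ∀ F ∈ barCocycle 𝒜 (augmentation 𝒜) n (-n), ∃ c : k,
      F - c • F₀ ∈ barCoboundary 𝒜 (augmentation 𝒜) n (-n) ∧
      ∀ g : koszulGen 𝒜 (augmentation 𝒜) n, augmentation 𝒜 (F g) = c * φ g := by
    intro F hF
    obtain ⟨c, hc⟩ := hone F hF
    refine ⟨c, hc, fun g => ?_⟩
    have h := augmentation_barCoboundary 𝒜 hc g.2
    rw [LinearMap.sub_apply, LinearMap.smul_apply, map_sub, map_smul, hF₀φ, sub_eq_zero] at h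
    exact h
  refine ⟨hG.injDim_left, ⟨γ, hγ0, le_antisymm (fun g hg => ?_) ?_⟩, ⟨F₀, hF₀, γ, hγ, ?_⟩,
    fun F hF hF0 => ?_, fun j hj F hF => ?_⟩
  · have h : (⟨g, hg⟩ : koszulGen 𝒜 (augmentation 𝒜) n) - (φ ⟨g, hg⟩ / φ ⟨γ, hγ⟩) • ⟨γ, hγ⟩ = 0 := by
      rw [← Module.forall_dual_apply_eq_zero_iff k]
      intro ψ
      obtain ⟨F, hF, hFψ⟩ := hsurj ψ
      obtain ⟨c, -, hc⟩ := hone' F hF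
      have hψ : ∀ x, ψ x = c * φ x := fun x => by rw [← hFψ, hc]
      rw [hψ, map_sub, map_smul, smul_eq_mul, div_mul_cancel₀ _ hφ, sub_self, mul_zero]
    have h' := congrArg Subtype.val h
    exact Submodule.mem_span_singleton.2 ⟨_, (sub_eq_zero.1 h').symm⟩
  · rwa [Submodule.span_singleton_le_iff_mem]
  · rw [← Subtype.coe_mk γ hγ, hF₀φ]
    exact hφ
  · obtain ⟨c, hc, hc'⟩ := hone' F hF
    have h := hc' ⟨γ, hγ⟩
    rw [hF0 _ hγ] at h
    obtain rfl : c = 0 := (mul_eq_zero.1 h.symm).resolve_right hφ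
    simpa using hc
  · have hr := hG.ext_left n j
    rw [if_neg (fun h => hj h.2), rank_zero_iff] at hr
    exact (Submodule.Quotient.mk_eq_zero _).1
      (congrArg Subtype.val (hr.elim ⟨_, Submodule.mem_map_of_mem hF⟩ 0))

end TopDegree

/-! ### The quadratic dual and the Koszul complex -/

section Contraction

variable {k : Type u} [Field k] {R : Type v} [Ring R] [Algebra k R]
  (𝒜 : ℕ → Submodule k R) (ε : R →ₐ[k] k)

/-- The Koszul differential on generators, `G_{n + 1} → R ⊗ G_n`; it takes values in
`V ⊗ G_n`. -/
def koszulDiff (n : ℕ) : koszulGen 𝒜 ε (n + 1) →ₗ[k] R ⊗[k] koszulGen 𝒜 ε n :=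
  (exists_koszulDiff 𝒜 ε n).choose

theorem koszulMap_koszulDiff (n : ℕ) (x : koszulGen 𝒜 ε (n + 1)) :
    koszulMap 𝒜 ε n (koszulDiff 𝒜 ε n x) = barDiff ε n x :=
  ((exists_koszulDiff 𝒜 ε n).choose_spec x).1

theorem koszulDiff_mem_range (n : ℕ) (x : koszulGen 𝒜 ε (n + 1)) : koszulDiff 𝒜 ε n x ∈
    LinearMap.range (LinearMap.rTensor (koszulGen 𝒜 ε n) (𝒜 1).subtype) :=
  ((exists_koszulDiff 𝒜 ε n).choose_spec x).2

theorem koszulDiff_injective (n : ℕ) : Function.Injective (koszulDiff 𝒜 ε n) := by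
  intro x y h
  ext
  rw [← (barDiff_mem_of_mem_koszulGen 𝒜 ε x.2).2, ← (barDiff_mem_of_mem_koszulGen 𝒜 ε y.2).2,
    ← koszulMap_koszulDiff, ← koszulMap_koszulDiff, h]

theorem koszulMap_freeLift_koszulDiff (n : ℕ) (t : R ⊗[k] koszulGen 𝒜 ε (n + 1)) :
    koszulMap 𝒜 ε n (freeLift (A := R) (koszulDiff 𝒜 ε n) t) =
      barDiff ε n (koszulMap 𝒜 ε (n + 1) t) := by
  induction t with
  | zero => simp
  | add x y hx hy => simp only [map_add, hx, hy]
  | tmul a x => rw [freeLift_tmul, map_smul, koszulMap_koszulDiff, koszulMap_tmul, map_smul]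

theorem freeLift_koszulDiff_koszulDiff (n : ℕ) (x : koszulGen 𝒜 ε (n + 2)) :
    freeLift (A := R) (koszulDiff 𝒜 ε n) (koszulDiff 𝒜 ε (n + 1) x) = 0 := by
  apply koszulMap_injective 𝒜 ε n
  rw [koszulMap_freeLift_koszulDiff, koszulMap_koszulDiff, map_zero]
  exact barDiff_mem_barCycles ε (n + 1) x

theorem map_subtype_mem_degOneMul (n : ℕ) (s : 𝒜 1 ⊗[k] koszulGen 𝒜 ε n) :
    koszulMap 𝒜 ε n (LinearMap.rTensor _ (𝒜 1).subtype s) ∈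
      degOneMul 𝒜 n (koszulGen 𝒜 ε n) := by
  induction s with
  | zero => simp
  | add x y hx hy => rw [map_add, map_add]; exact add_mem hx hy
  | tmul a g => exact Submodule.apply_mem_map₂ _ a.2 g.2

/-- An element of `V ⊗ G_n` that is a cycle is the differential of an element of `G_{n + 1}`. -/
theorem exists_koszulDiff_eq {n : ℕ} {s : 𝒜 1 ⊗[k] koszulGen 𝒜 ε n}
    (hs : koszulMap 𝒜 ε n (LinearMap.rTensor _ (𝒜 1).subtype s) ∈ barCycles ε n) :
    ∃ x, koszulDiff 𝒜 ε n x = LinearMap.rTensor _ (𝒜 1).subtype s := by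
  have hx := (mem_koszulGen_succ 𝒜 ε).2 ⟨_, map_subtype_mem_degOneMul 𝒜 ε n s, hs, rfl⟩
  refine ⟨⟨_, hx⟩, koszulMap_injective 𝒜 ε n ?_⟩
  rw [koszulMap_koszulDiff]
  exact barDiff_barCons ε hs

variable {𝒜} in
theorem coe_eq_sum_coord {ι : Type*} [Fintype ι] {n : ℕ} (b : Module.Basis ι k (𝒜 n))
    (v : 𝒜 n) : (v : R) = ∑ i, b.coord i v • (b i : R) := by
  have h := congrArg (𝒜 n).subtype (b.sum_repr v)
  rw [map_sum] at h
  exact h.symm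

variable {𝒜} in
theorem exists_eq_sum_mul_ι {ι : Type*} [Fintype ι] (b : Module.Basis ι k (𝒜 1)) {n : ℕ}
    {y : QuadraticDual 𝒜} (hy : y ∈ quadraticDualComponent 𝒜 (n + 1)) :
    ∃ z : ι → QuadraticDual 𝒜, (∀ i, z i ∈ quadraticDualComponent 𝒜 n) ∧
      y = ∑ i, z i * quadraticDualι 𝒜 (b.coord i) := by
  rw [quadraticDualComponent, pow_succ] at hy
  induction hy using Submodule.mul_induction_on' with
  | mem_mul_mem x hx z hz =>
    obtain ⟨f, rfl⟩ := hz
    refine ⟨fun i => f (b i) • x, fun i => Submodule.smul_mem _ _ hx, ?_⟩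
    have hf : f = ∑ i, f (b i) • b.coord i := (b.sum_dual_apply_smul_coord f).symm
    conv_lhs => rw [hf]
    simp only [map_sum, map_smul, Finset.mul_sum, mul_smul_comm, smul_mul_assoc]
  | add x _ y _ hx hy =>
    obtain ⟨z, hz, rfl⟩ := hx
    obtain ⟨z', hz', rfl⟩ := hy
    exact ⟨z + z', fun i => add_mem (hz i) (hz' i), by
      simp only [Pi.add_apply, add_mul, Finset.sum_add_distrib]⟩

theorem mkAlgHom_tensorSquare_tmul (f g : Module.Dual k (𝒜 1)) :
    RingQuot.mkAlgHom k (quadraticDualRel 𝒜) (tensorSquare (k := k) _ (f ⊗ₜ g)) =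
      quadraticDualι 𝒜 f * quadraticDualι 𝒜 g := by
  simp [tensorSquare, quadraticDualι]

variable [GradedAlgebra 𝒜]

/-- The projection of `R` onto its degree one part `V`. -/
def degOnePart : R →ₗ[k] 𝒜 1 :=
  (GradedAlgebra.proj 𝒜 1).codRestrict (𝒜 1) fun a => (DirectSum.decompose 𝒜 a 1).2

theorem degOnePart_coe (v : 𝒜 1) : degOnePart 𝒜 (v : R) = v :=
  Subtype.ext (DirectSum.decompose_of_mem_same 𝒜 v.2)

/-- The contraction of the first letter of an element of `R ⊗ W` with `f ∈ V*`. -/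
def contractFirst (W : Type*) [AddCommGroup W] [Module k W] :
    Module.Dual k (𝒜 1) →ₗ[k] R ⊗[k] W →ₗ[k] W :=
  LinearMap.llcomp k _ _ _ (TensorProduct.lid k W).toLinearMap ∘ₗ LinearMap.rTensorHom W ∘ₗ
    LinearMap.lcomp k k (degOnePart 𝒜)

variable {𝒜} in
theorem contractFirst_tmul {W : Type*} [AddCommGroup W] [Module k W] (f : Module.Dual k (𝒜 1))
    (a : R) (w : W) : contractFirst 𝒜 W f (a ⊗ₜ w) = f (degOnePart 𝒜 a) • w := rfl

/-- The contraction `G_{n + 1} → G_n` of the first letter with `f ∈ V*`. -/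
def koszulContract (n : ℕ) :
    Module.Dual k (𝒜 1) →ₗ[k] koszulGen 𝒜 ε (n + 1) →ₗ[k] koszulGen 𝒜 ε n :=
  (LinearMap.lcomp k _ (koszulDiff 𝒜 ε n)) ∘ₗ contractFirst 𝒜 (koszulGen 𝒜 ε n)

theorem koszulContract_apply (n : ℕ) (f : Module.Dual k (𝒜 1)) (x : koszulGen 𝒜 ε (n + 1)) :
    koszulContract 𝒜 ε n f x = contractFirst 𝒜 _ f (koszulDiff 𝒜 ε n x) := rfl

theorem koszulDiff_eq_sum {ι : Type*} [Fintype ι] (b : Module.Basis ι k (𝒜 1)) (n : ℕ)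
    (x : koszulGen 𝒜 ε (n + 1)) :
    koszulDiff 𝒜 ε n x = ∑ i, (b i : R) ⊗ₜ[k] koszulContract 𝒜 ε n (b.coord i) x := by
  simp only [koszulContract_apply]
  obtain ⟨s, hs⟩ := koszulDiff_mem_range 𝒜 ε n x
  rw [← hs]
  clear hs
  induction s with
  | zero => simp
  | add x y hx hy =>
    simp only [map_add, TensorProduct.tmul_add, Finset.sum_add_distrib]
    rw [← hx, ← hy]
  | tmul v g =>
    simp only [LinearMap.rTensor_tmul, contractFirst_tmul, Submodule.subtype_apply, degOnePart_coe,
      ← TensorProduct.smul_tmul]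
    rw [← TensorProduct.sum_tmul, ← coe_eq_sum_coord]

theorem finite_koszulGen [FiniteDimensional k (𝒜 1)] (n : ℕ) :
    FiniteDimensional k (koszulGen 𝒜 ε n) := by
  induction n with
  | zero => rw [koszulGen]; infer_instance
  | succ n ih =>
    refine FiniteDimensional.of_injective (V₂ := 𝒜 1 ⊗[k] koszulGen 𝒜 ε n)
      (LinearMap.rTensor _ (degOnePart 𝒜) ∘ₗ koszulDiff 𝒜 ε n) fun x y hxy => ?_
    have hinv (t) (ht : t ∈ LinearMap.range (LinearMap.rTensor (koszulGen 𝒜 ε n)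
        (𝒜 1).subtype)) : LinearMap.rTensor _ (𝒜 1).subtype
          (LinearMap.rTensor _ (degOnePart 𝒜) t) = t := by
      obtain ⟨s, rfl⟩ := ht
      induction s with
      | zero => simp
      | add x y hx hy => simp only [map_add, hx, hy]
      | tmul v g => simp [degOnePart_coe]
    refine koszulDiff_injective 𝒜 ε n ?_
    rw [← hinv _ (koszulDiff_mem_range 𝒜 ε n x), ← hinv _ (koszulDiff_mem_range 𝒜 ε n y)]
    exact congrArg _ hxy

/-- For `ψ ∈ G_n^*`, the contraction `G_{n + 2} → V ⊗ V` of all letters but the first two. -/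
def koszulFirstTwo (n : ℕ) (ψ : Module.Dual k (koszulGen 𝒜 ε n)) :
    koszulGen 𝒜 ε (n + 2) →ₗ[k] 𝒜 1 ⊗[k] 𝒜 1 :=
  TensorProduct.map (degOnePart 𝒜) ((TensorProduct.rid k (𝒜 1)).toLinearMap ∘ₗ
    TensorProduct.map (degOnePart 𝒜) ψ ∘ₗ koszulDiff 𝒜 ε n) ∘ₗ koszulDiff 𝒜 ε (n + 1)

/-- The first two letters of an element of `G_{n + 2}` form a quadratic relation. -/
theorem koszulFirstTwo_mem (n : ℕ) (ψ : Module.Dual k (koszulGen 𝒜 ε n))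
    (x : koszulGen 𝒜 ε (n + 2)) : koszulFirstTwo 𝒜 ε n ψ x ∈ quadraticRelations 𝒜 := by
  have h1 (y : koszulGen 𝒜 ε (n + 1)) :
      (((TensorProduct.rid k (𝒜 1)).toLinearMap (TensorProduct.map (degOnePart 𝒜) ψ
        (koszulDiff 𝒜 ε n y)) : 𝒜 1) : R) =
      TensorProduct.rid k R (LinearMap.lTensor R ψ (koszulDiff 𝒜 ε n y)) := by
    obtain ⟨s, hs⟩ := koszulDiff_mem_range 𝒜 ε n y
    rw [← hs]
    clear hs
    induction s with
    | zero => simp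
    | add x y hx hy => simp only [map_add, Submodule.coe_add, hx, hy]
    | tmul v g => simp [degOnePart_coe]
  have h2 (t : R ⊗[k] koszulGen 𝒜 ε (n + 1))
      (ht : t ∈ LinearMap.range (LinearMap.rTensor (koszulGen 𝒜 ε (n + 1)) (𝒜 1).subtype)) :
      LinearMap.mul' k R (TensorProduct.map (𝒜 1).subtype (𝒜 1).subtype
        (TensorProduct.map (degOnePart 𝒜) ((TensorProduct.rid k (𝒜 1)).toLinearMap ∘ₗ
          TensorProduct.map (degOnePart 𝒜) ψ ∘ₗ koszulDiff 𝒜 ε n) t)) =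
      TensorProduct.rid k R (LinearMap.lTensor R ψ
        (freeLift (A := R) (koszulDiff 𝒜 ε n) t)) := by
    obtain ⟨s, rfl⟩ := ht
    have hsmul (a : R) (t : R ⊗[k] koszulGen 𝒜 ε n) :
        TensorProduct.rid k R (LinearMap.lTensor R ψ (a • t)) =
          a * TensorProduct.rid k R (LinearMap.lTensor R ψ t) := by
      induction t with
      | zero => simp
      | add x y hx hy => simp only [map_add, smul_add, hx, hy, mul_add]
      | tmul b g => simp [TensorProduct.smul_tmul']
    induction s with
    | zero => simp
    | add x y hx hy => simp only [map_add, hx, hy]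
    | tmul v y =>
      rw [LinearMap.rTensor_tmul, freeLift_tmul, hsmul, ← h1]
      simp [degOnePart_coe]
  change LinearMap.mul' k R (TensorProduct.map (𝒜 1).subtype (𝒜 1).subtype _) = 0
  exact (h2 _ (koszulDiff_mem_range 𝒜 ε (n + 1) x)).trans (by
    rw [freeLift_koszulDiff_koszulDiff, map_zero, map_zero])

theorem reversePairing_koszulFirstTwo (n : ℕ) (ψ : Module.Dual k (koszulGen 𝒜 ε n))
    (f g : Module.Dual k (𝒜 1)) (x : koszulGen 𝒜 ε (n + 2)) :
    reversePairing (𝒜 1) (f ⊗ₜ g) (koszulFirstTwo 𝒜 ε n ψ x) =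
      ψ (koszulContract 𝒜 ε n f (koszulContract 𝒜 ε (n + 1) g x)) := by
  rw [koszulContract_apply 𝒜 ε (n + 1), koszulFirstTwo, LinearMap.comp_apply]
  induction koszulDiff 𝒜 ε (n + 1) x with
  | zero => simp
  | add x y hx hy => simp only [map_add, hx, hy]
  | tmul a y =>
    rw [contractFirst_tmul, map_smul, map_smul, smul_eq_mul, koszulContract_apply]
    have h : f (((TensorProduct.rid k (𝒜 1)).toLinearMap (TensorProduct.map (degOnePart 𝒜) ψ
        (koszulDiff 𝒜 ε n y)))) = ψ (contractFirst 𝒜 _ f (koszulDiff 𝒜 ε n y)) := by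
      induction koszulDiff 𝒜 ε n y with
      | zero => simp
      | add x y hx hy => simp only [map_add, hx, hy]
      | tmul b z => simp [contractFirst_tmul, mul_comm]
    rw [← h]
    rfl

/-- The action of `f ∈ V*` on `∏ G_n` by contraction of the first letter. -/
def koszulContractAll : Module.Dual k (𝒜 1) →ₗ[k] Module.End k ((n : ℕ) → koszulGen 𝒜 ε n) where
  toFun f := LinearMap.pi fun n => koszulContract 𝒜 ε n f ∘ₗ LinearMap.proj (n + 1)
  map_add' f g := by ext; simp
  map_smul' c f := by ext; simp

theorem koszulContractAll_apply (f : Module.Dual k (𝒜 1)) (x : (n : ℕ) → koszulGen 𝒜 ε n)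
    (n : ℕ) : koszulContractAll 𝒜 ε f x n = koszulContract 𝒜 ε n f (x (n + 1)) := rfl

theorem koszulContractAll_single [∀ n, DecidableEq (koszulGen 𝒜 ε n)] (f : Module.Dual k (𝒜 1))
    (n : ℕ) (x : koszulGen 𝒜 ε (n + 1)) :
    koszulContractAll 𝒜 ε f (Pi.single (n + 1) x) = Pi.single n (koszulContract 𝒜 ε n f x) := by
  funext m
  rw [koszulContractAll_apply]
  by_cases h : m = n
  · subst h
    rw [Pi.single_eq_same, Pi.single_eq_same]
  · rw [Pi.single_eq_of_ne h, Pi.single_eq_of_ne (by omega), map_zero]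

theorem lift_koszulContractAll_eq_zero (t : Module.Dual k (𝒜 1) ⊗[k] Module.Dual k (𝒜 1))
    (ht : t ∈ orthogonalRelations 𝒜) :
    TensorAlgebra.lift k (koszulContractAll 𝒜 ε) (tensorSquare (k := k) _ t) = 0 := by
  ext x n : 2
  rw [LinearMap.zero_apply, Pi.zero_apply, ← Module.forall_dual_apply_eq_zero_iff k]
  intro ψ
  have key : ψ (TensorAlgebra.lift k (koszulContractAll 𝒜 ε) (tensorSquare (k := k) _ t) x n) =
      reversePairing (𝒜 1) t (koszulFirstTwo 𝒜 ε n ψ (x (n + 2))) := by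
    clear ht
    induction t with
    | zero => simp
    | add s t hs ht => simp only [map_add, LinearMap.add_apply, Pi.add_apply, hs, ht]
    | tmul f g =>
      rw [reversePairing_koszulFirstTwo]
      simp [tensorSquare, koszulContractAll_apply]
  rw [key]
  exact ht _ (koszulFirstTwo_mem 𝒜 ε n ψ _)

/-- The action of the quadratic dual on `∏ G_n` extending the contraction of the first letter. -/
def quadraticDualContract : QuadraticDual 𝒜 →ₐ[k] Module.End k ((n : ℕ) → koszulGen 𝒜 ε n) :=
  RingQuot.liftAlgHom k ⟨TensorAlgebra.lift k (koszulContractAll 𝒜 ε), by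
    rintro _ _ ⟨t, ht, rfl, rfl⟩
    rw [map_zero, lift_koszulContractAll_eq_zero 𝒜 ε t ht]⟩

theorem quadraticDualContract_ι (f : Module.Dual k (𝒜 1)) :
    quadraticDualContract 𝒜 ε (quadraticDualι 𝒜 f) = koszulContractAll 𝒜 ε f := by
  simp [quadraticDualContract, quadraticDualι]

/-- The pairing of the quadratic dual with `G_n`: contract all letters, from the first to the
last. -/
def koszulPairing (n : ℕ) : QuadraticDual 𝒜 →ₗ[k] Module.Dual k (koszulGen 𝒜 ε n) :=
  (LinearMap.llcomp k _ _ _ (ε.toLinearMap ∘ₗ barVal k R ∘ₗ (koszulGen 𝒜 ε 0).subtype ∘ₗ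
    LinearMap.proj 0)) ∘ₗ LinearMap.lcomp k _
      (LinearMap.single k (fun n => koszulGen 𝒜 ε n) n) ∘ₗ
    (quadraticDualContract 𝒜 ε).toLinearMap

theorem koszulPairing_one (x : koszulGen 𝒜 ε 0) : koszulPairing 𝒜 ε 0 1 x = ε (barVal k R x) := by
  change ε (barVal k R (quadraticDualContract 𝒜 ε 1 (Pi.single 0 x) 0)) = _
  rw [map_one, Module.End.one_apply, Pi.single_eq_same]

theorem koszulPairing_mul_ι (n : ℕ) (y : QuadraticDual 𝒜) (f : Module.Dual k (𝒜 1))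
    (x : koszulGen 𝒜 ε (n + 1)) : koszulPairing 𝒜 ε (n + 1) (y * quadraticDualι 𝒜 f) x =
      koszulPairing 𝒜 ε n y (koszulContract 𝒜 ε n f x) := by
  classical
  change ε (barVal k R (quadraticDualContract 𝒜 ε _ (Pi.single (n + 1) x) 0)) =
    ε (barVal k R (quadraticDualContract 𝒜 ε y (Pi.single n (koszulContract 𝒜 ε n f x)) 0))
  rw [map_mul, Module.End.mul_apply, quadraticDualContract_ι, koszulContractAll_single]

variable [FiniteDimensional k (𝒜 1)]

/-- The pairing of `R^!_n` with `G_n` is nondegenerate on the side of `G_n`. -/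
theorem exists_koszulPairing_ne_zero (n : ℕ) (x : koszulGen 𝒜 ε n) (hx : x ≠ 0) :
    ∃ y ∈ quadraticDualComponent 𝒜 n, koszulPairing 𝒜 ε n y x ≠ 0 := by
  induction n with
  | zero =>
    refine ⟨1, by rw [quadraticDualComponent, pow_zero]; exact Submodule.one_le.1 le_rfl, ?_⟩
    rw [koszulPairing_one]
    obtain ⟨x, hx'⟩ := x
    obtain ⟨c, rfl⟩ := Submodule.mem_span_singleton.1 hx'
    rw [map_smul, barVal_barOne, map_smul, map_one, smul_eq_mul, mul_one]
    rintro rfl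
    exact hx (Subtype.ext (zero_smul k _))
  | succ n ih =>
    obtain ⟨i, hi⟩ : ∃ i, koszulContract 𝒜 ε n ((Module.finBasis k (𝒜 1)).coord i) x ≠ 0 := by
      by_contra! h
      refine hx (koszulDiff_injective 𝒜 ε n ?_)
      rw [koszulDiff_eq_sum 𝒜 ε (Module.finBasis k (𝒜 1)), map_zero]
      exact Finset.sum_eq_zero fun i _ => by rw [h i, TensorProduct.tmul_zero]
    obtain ⟨y, hy, hyx⟩ := ih _ hi
    refine ⟨_, ?_, (koszulPairing_mul_ι 𝒜 ε n y _ x).trans_ne hyx⟩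
    rw [quadraticDualComponent, pow_succ]
    exact Submodule.mul_mem_mul hy ⟨_, rfl⟩

theorem exists_koszulPairing_eq (n : ℕ) (ψ : Module.Dual k (koszulGen 𝒜 ε n)) :
    ∃ y ∈ quadraticDualComponent 𝒜 n, koszulPairing 𝒜 ε n y = ψ := by
  have := finite_koszulGen 𝒜 ε n
  have h : (quadraticDualComponent 𝒜 n).map (koszulPairing 𝒜 ε n) = ⊤ := by
    rw [← Subspace.dualCoannihilator_dualAnnihilator_eq
      (W := (quadraticDualComponent 𝒜 n).map (koszulPairing 𝒜 ε n)),
      ← Submodule.dualAnnihilator_bot]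
    congr 1
    rw [Submodule.eq_bot_iff]
    intro x hx
    by_contra hx0
    obtain ⟨y, hy, hyx⟩ := exists_koszulPairing_ne_zero 𝒜 ε n x hx0
    exact hyx ((Submodule.mem_dualCoannihilator _).1 hx _ (Submodule.mem_map_of_mem hy))
  have hψ : ψ ∈ (quadraticDualComponent 𝒜 n).map (koszulPairing 𝒜 ε n) := by
    rw [h]; exact Submodule.mem_top
  exact hψ

/-- The pairing of `R^!_n` with `G_n` is nondegenerate on the side of `R^!_n`. In the inductive
step, a functional on `V ⊗ G_{n + 1}` vanishing on `G_{n + 2}` factors through the differential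
`V ⊗ G_{n + 1} → R_2 ⊗ G_n`, so it is given by elements of `I^⊥`. -/
theorem eq_zero_of_koszulPairing (hε : ∀ v ∈ 𝒜 1, ε v = 0) (n : ℕ) (y : QuadraticDual 𝒜)
    (hy : y ∈ quadraticDualComponent 𝒜 n) (h : ∀ x, koszulPairing 𝒜 ε n y x = 0) : y = 0 := by
  have h1mem : barOne k R ∈ koszulGen 𝒜 ε 0 := Submodule.subset_span rfl
  have hzero : ∀ y ∈ quadraticDualComponent 𝒜 0, ∃ c : k, y = algebraMap k _ c ∧
      ∀ x, koszulPairing 𝒜 ε 0 y x = c * ε (barVal k R x) := by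
    intro y hy
    rw [quadraticDualComponent, pow_zero] at hy
    obtain ⟨c, rfl⟩ := Submodule.mem_one.1 hy
    refine ⟨c, rfl, fun x => ?_⟩
    rw [Algebra.algebraMap_eq_smul_one, map_smul, LinearMap.smul_apply, koszulPairing_one,
      smul_eq_mul]
  let b := Module.finBasis k (𝒜 1)
  induction n generalizing y with
  | zero =>
    obtain ⟨c, rfl, hc⟩ := hzero y hy
    have h1 := h ⟨_, h1mem⟩
    rw [hc, barVal_barOne, map_one, mul_one] at h1
    rw [h1, map_zero]
  | succ n ih =>
    obtain ⟨z, hz, rfl⟩ := exists_eq_sum_mul_ι b hy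
    have h' (x) : ∑ i, koszulPairing 𝒜 ε n (z i) (koszulContract 𝒜 ε n (b.coord i) x) = 0 := by
      rw [← h x, map_sum, LinearMap.sum_apply]
      simp only [koszulPairing_mul_ι]
    -- the functional on `V ⊗ G_n` defined by the representation of the element
    let Y : 𝒜 1 ⊗[k] koszulGen 𝒜 ε n →ₗ[k] k :=
      ∑ i, (TensorProduct.lid k k).toLinearMap ∘ₗ
        TensorProduct.map (b.coord i) (koszulPairing 𝒜 ε n (z i))
    have hYtmul (v g) : Y (v ⊗ₜ g) = ∑ i, b.coord i v * koszulPairing 𝒜 ε n (z i) g := by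
      simp only [Y, LinearMap.sum_apply, LinearMap.comp_apply, TensorProduct.map_tmul]
      rfl
    have hYb (i g) : Y (b i ⊗ₜ g) = koszulPairing 𝒜 ε n (z i) g := by
      rw [hYtmul, Finset.sum_eq_single i]
      · simp
      · intro j _ hji
        simp [Ne.symm hji]
      · simp
    have hY (s) (x) (hx : koszulDiff 𝒜 ε n x = LinearMap.rTensor _ (𝒜 1).subtype s) : Y s = 0 := by
      rw [← h' x]
      simp only [koszulContract_apply, hx]
      clear hx
      induction s with
      | zero => simp
      | add s t hs ht => simp only [map_add, hs, ht, Finset.sum_add_distrib]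
      | tmul v g =>
        rw [hYtmul]
        simp only [LinearMap.rTensor_tmul, contractFirst_tmul, Submodule.subtype_apply,
          degOnePart_coe, map_smul, smul_eq_mul]
    cases n with
    | zero =>
      refine Finset.sum_eq_zero fun i _ => ?_
      obtain ⟨c, hc, hc'⟩ := hzero _ (hz i)
      have hcyc : koszulMap 𝒜 ε 0 (LinearMap.rTensor _ (𝒜 1).subtype (b i ⊗ₜ ⟨_, h1mem⟩)) ∈
          barCycles ε 0 := by
        rw [LinearMap.rTensor_tmul, koszulMap_tmul, mem_barCycles_zero]
        exact (congrArg ε (barVal_smul_barOne (k := k) (A := R) (b i : R))).trans (hε _ (b i).2)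
      obtain ⟨x, hx⟩ := exists_koszulDiff_eq 𝒜 ε hcyc
      have h0 := hY _ x hx
      rw [hYb, hc', barVal_barOne, map_one, mul_one] at h0
      rw [hc, h0, map_zero, zero_mul]
    | succ m =>
      have := finite_koszulGen 𝒜 ε m
      let D : 𝒜 1 ⊗[k] koszulGen 𝒜 ε (m + 1) →ₗ[k] R ⊗[k] koszulGen 𝒜 ε m :=
        (freeLift (A := R) (koszulDiff 𝒜 ε m)).restrictScalars k ∘ₗ
          LinearMap.rTensor _ (𝒜 1).subtype
      have hYD : Y ∈ (LinearMap.ker D).dualAnnihilator := by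
        rw [Submodule.mem_dualAnnihilator]
        intro s hs
        have hcyc : koszulMap 𝒜 ε (m + 1) (LinearMap.rTensor _ (𝒜 1).subtype s) ∈
            barCycles ε (m + 1) := by
          rw [mem_barCycles_succ, ← koszulMap_freeLift_koszulDiff,
            (LinearMap.mem_ker.1 hs : freeLift (A := R) (koszulDiff 𝒜 ε m) _ = 0), map_zero]
        obtain ⟨x, hx⟩ := exists_koszulDiff_eq 𝒜 ε hcyc
        exact hY s x hx
      -- so the functional factors through `D`, by `ω`
      obtain ⟨ω, hω⟩ : Y ∈ LinearMap.range D.dualMap :=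
        (LinearMap.range_dualMap_eq_dualAnnihilator_ker (V₁ := 𝒜 1 ⊗[k] koszulGen 𝒜 ε (m + 1))
          (V₂ := R ⊗[k] koszulGen 𝒜 ε m) D).symm ▸ hYD
      let e := Module.finBasis k (koszulGen 𝒜 ε m)
      choose u hu hue using fun c => exists_koszulPairing_eq 𝒜 ε m (e.coord c)
      have hω' (a : R) (g : koszulGen 𝒜 ε m) :
          ω (a ⊗ₜ g) = ∑ c, ω (a ⊗ₜ e c) * koszulPairing 𝒜 ε m (u c) g := by
        conv_lhs => rw [← e.sum_repr g]
        simp only [TensorProduct.tmul_sum, TensorProduct.tmul_smul, map_sum, map_smul, hue,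
          Module.Basis.coord_apply, smul_eq_mul]
        exact Finset.sum_congr rfl fun c _ => mul_comm _ _
      -- by induction, the coefficients `z i` are determined by their pairings, which `ω` computes
      have hzi (i) : z i = ∑ j, ∑ c, ω (((b i : R) * b j) ⊗ₜ e c) •
          (u c * quadraticDualι 𝒜 (b.coord j)) := by
        rw [← sub_eq_zero]
        refine ih _ (sub_mem (hz i) (Submodule.sum_mem _ fun j _ => Submodule.sum_mem _ fun c _ =>
          Submodule.smul_mem _ _ ?_)) fun x => ?_
        · rw [quadraticDualComponent, pow_succ]
          exact Submodule.mul_mem_mul (hu c) ⟨_, rfl⟩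
        · rw [map_sub, LinearMap.sub_apply, ← hYb, ← hω, sub_eq_zero]
          change ω ((b i : R) • koszulDiff 𝒜 ε m x) = _
          rw [koszulDiff_eq_sum 𝒜 ε b, Finset.smul_sum, map_sum, map_sum, LinearMap.sum_apply]
          refine Finset.sum_congr rfl fun j _ => ?_
          rw [TensorProduct.smul_tmul', smul_eq_mul, hω', map_sum, LinearMap.sum_apply]
          refine Finset.sum_congr rfl fun c _ => ?_
          rw [map_smul, LinearMap.smul_apply, koszulPairing_mul_ι, smul_eq_mul]
      -- the relations of the quadratic dual that appear
      let t (c) : Module.Dual k (𝒜 1) ⊗[k] Module.Dual k (𝒜 1) :=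
        ∑ i, ∑ j, ω (((b i : R) * b j) ⊗ₜ e c) • (b.coord j ⊗ₜ b.coord i)
      have ht (c) (x) : reversePairing (𝒜 1) (t c) x =
          ω (LinearMap.mul' k R (TensorProduct.map (𝒜 1).subtype (𝒜 1).subtype x) ⊗ₜ e c) := by
        induction x with
        | zero => simp
        | add x y hx hy => simp only [map_add, hx, hy, TensorProduct.add_tmul]
        | tmul v w =>
          simp only [t, map_sum, map_smul, LinearMap.sum_apply, LinearMap.smul_apply]
          simp only [TensorProduct.map_tmul, LinearMap.mul'_apply, Submodule.subtype_apply]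
          rw [coe_eq_sum_coord b v, coe_eq_sum_coord b w]
          simp only [Finset.sum_mul, Finset.mul_sum, smul_mul_assoc, mul_smul_comm,
            TensorProduct.sum_tmul, map_sum, ← TensorProduct.smul_tmul', map_smul, smul_eq_mul]
          rw [Finset.sum_comm]
          refine Finset.sum_congr rfl fun j _ => Finset.sum_congr rfl fun i _ => ?_
          change _ * (b.coord i v * b.coord j w) = _
          ring
      have ht0 (c) : RingQuot.mkAlgHom k (quadraticDualRel 𝒜) (tensorSquare (k := k) _ (t c)) =
          0 := by
        have hmem : t c ∈ orthogonalRelations 𝒜 := fun x hx => by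
          have hx' : LinearMap.mul' k R
            (TensorProduct.map (𝒜 1).subtype (𝒜 1).subtype x) = 0 := hx
          rw [ht, hx', TensorProduct.zero_tmul, map_zero]
        rw [RingQuot.mkAlgHom_rel k (⟨_, hmem, rfl, rfl⟩ : quadraticDualRel 𝒜 _ 0), map_zero]
      calc ∑ i, z i * quadraticDualι 𝒜 (b.coord i)
          = ∑ c, u c * RingQuot.mkAlgHom k (quadraticDualRel 𝒜)
              (tensorSquare (k := k) _ (t c)) := by
            simp only [t, map_sum, map_smul, mkAlgHom_tensorSquare_tmul, Finset.mul_sum,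
              mul_smul_comm, ← mul_assoc]
            simp only [hzi, Finset.sum_mul, smul_mul_assoc]
            rw [Finset.sum_comm_cycle]
        _ = 0 := Finset.sum_eq_zero fun c _ => by rw [ht0, mul_zero]

end Contraction

/-! ### Sums over the comultiplication -/

section Sweedler

open Coalgebra HopfAlgebra

variable {k : Type u} [Field k] {H : Type w} [Ring H] [HopfAlgebra k H]

/-- Coassociativity: `∑ T(h₁₁, h₁₂, h₂) = ∑ T(h₁, h₂₁, h₂₂)` for a trilinear map `T`. -/
theorem sum_sum_left_eq_sum_sum_right {M : Type*} [AddCommGroup M] [Module k M] (T : H → H → H → M)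
    (h₁ : ∀ b c, IsLinearMap k fun a => T a b c) (h₂ : ∀ a c, IsLinearMap k fun b => T a b c)
    (h₃ : ∀ a b, IsLinearMap k fun c => T a b c) {h : H} {ι κ μ : Type*} (s : Repr k h ι)
    (s₁ : (i : ι) → Repr k (s.left i) κ) (s₂ : (i : ι) → Repr k (s.right i) μ) :
    ∑ i ∈ s.index, ∑ j ∈ (s₁ i).index, T ((s₁ i).left j) ((s₁ i).right j) (s.right i) =
      ∑ i ∈ s.index, ∑ j ∈ (s₂ i).index, T (s.left i) ((s₂ i).left j) ((s₂ i).right j) := by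
  let T₂ (a : H) : H →ₗ[k] H →ₗ[k] M :=
    LinearMap.mk₂ k (T a) (fun b b' c => (h₂ a c).map_add b b') (fun r b c => (h₂ a c).map_smul r b)
      (fun b c c' => (h₃ a b).map_add c c') (fun r b c => (h₃ a b).map_smul r c)
  let T₁ : H →ₗ[k] H ⊗[k] H →ₗ[k] M :=
    { toFun := fun a => TensorProduct.lift (T₂ a)
      map_add' := fun a a' => TensorProduct.ext' fun b c => (h₁ b c).map_add a a'
      map_smul' := fun r a => TensorProduct.ext' fun b c => (h₁ b c).map_smul r a }
  have h := congrArg (TensorProduct.lift T₁) (sum_tmul_tmul_eq s s₁ s₂)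
  simp only [map_sum, TensorProduct.lift.tmul] at h
  exact h

theorem sum_counit_right_smul {h : H} {ι : Type*} (s : Repr k h ι) :
    ∑ i ∈ s.index, counit (R := k) (s.right i) • s.left i = h := by
  have := congrArg (TensorProduct.rid k H) (sum_tmul_counit_eq s)
  simpa only [map_sum, TensorProduct.rid_tmul, one_smul] using this

theorem map_antipode_comm_comul {h : H} {ι : Type*} (s : Repr k h ι) :
    TensorProduct.map (antipode k) (antipode k) (TensorProduct.comm k H H (comul h)) =
      ∑ i ∈ s.index, antipode k (s.right i) ⊗ₜ[k] antipode k (s.left i) := by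
  rw [← s.eq, map_sum, map_sum]
  rfl

/-- The antipode reverses the comultiplication. -/
theorem comul_antipode {h : H} {ι : Type*} (s : Repr k h ι) :
    ∑ i ∈ s.index, antipode k (s.right i) ⊗ₜ[k] antipode k (s.left i) =
      comul (R := k) (antipode k h) := by
  let G : H →ₗ[k] H ⊗[k] H := TensorProduct.map (antipode k) (antipode k) ∘ₗ
    (TensorProduct.comm k H H).toLinearMap ∘ₗ comul
  have hG (h : H) : G h = ∑ i ∈ (ℛ k h).index,
      antipode k ((ℛ k h).right i) ⊗ₜ[k] antipode k ((ℛ k h).left i) :=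
    map_antipode_comm_comul (ℛ k h)
  have hleft : WithConv.toConv G * WithConv.toConv (comul (R := k) (A := H)) = 1 := by
    ext h
    rw [(ℛ k h).convMul_apply]
    -- `∑ S(h₂) h₃ ⊗ S(h₁) h₄ = ∑ 1 ⊗ S(h₁) h₂`
    have hin (a b : H) : ∑ j ∈ (ℛ k b).index,
        (antipode k ((ℛ k b).left j) ⊗ₜ[k] a) * comul (R := k) ((ℛ k b).right j) =
          1 ⊗ₜ[k] (a * b) := by
      have h1 := sum_sum_left_eq_sum_sum_right (k := k)
        (fun p q r : H => (antipode k p * q) ⊗ₜ[k] (a * r))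
        (fun _ _ => ⟨fun _ _ => by simp [add_mul, TensorProduct.add_tmul],
          fun _ _ => by simp [TensorProduct.smul_tmul']⟩)
        (fun _ _ => ⟨fun _ _ => by simp [mul_add, TensorProduct.add_tmul],
          fun _ _ => by simp [TensorProduct.smul_tmul']⟩)
        (fun _ _ => ⟨fun _ _ => by simp [mul_add, TensorProduct.tmul_add],
          fun _ _ => by simp⟩) (ℛ k b) (fun i => ℛ k _) (fun i => ℛ k _)
      have h2 (x : H) := sum_antipode_mul_eq_smul (ℛ k x)
      simp only [← TensorProduct.sum_tmul, h2, ← TensorProduct.smul_tmul', ← TensorProduct.tmul_smul,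
        ← mul_smul_comm, ← TensorProduct.tmul_sum, ← Finset.mul_sum, sum_counit_smul] at h1
      rw [h1]
      refine Finset.sum_congr rfl fun j _ => ?_
      conv_lhs => rw [← (ℛ k ((ℛ k b).right j)).eq, Finset.mul_sum]
      simp only [Algebra.TensorProduct.tmul_mul_tmul]
    have h1 := sum_sum_left_eq_sum_sum_right (k := k)
      (fun p q r : H => (antipode k q ⊗ₜ[k] antipode k p) * comul (R := k) r)
      (fun _ _ => ⟨fun _ _ => by simp [add_mul, TensorProduct.tmul_add],
        fun _ _ => by simp⟩)
      (fun _ _ => ⟨fun _ _ => by simp [add_mul, TensorProduct.add_tmul],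
        fun _ _ => by simp [← TensorProduct.smul_tmul']⟩)
      (fun _ _ => ⟨fun _ _ => by simp [mul_add], fun _ _ => by simp⟩)
      (ℛ k h) (fun i => ℛ k _) (fun i => ℛ k _)
    simp only [hin, ← TensorProduct.tmul_sum, sum_antipode_mul_eq_smul, ← Finset.sum_mul] at h1
    simp only [hG]
    rw [h1]
    simp [Algebra.algebraMap_eq_smul_one, Algebra.TensorProduct.one_def]
  have h := left_inv_eq_right_inv hleft LinearMap.comul_right_inv
  rw [← map_antipode_comm_comul s]
  exact LinearMap.congr_fun (WithConv.toConv_injective h) _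

/-- The representation of `Δ(S(h))` obtained from one of `Δ(h)`. -/
def antipodeRepr {h : H} {ι : Type*} (s : Repr k h ι) : Repr k (antipode k h) ι where
  index := s.index
  left i := antipode k (s.right i)
  right i := antipode k (s.left i)
  eq := comul_antipode s

end Sweedler

/-! ### The Hopf action on the bar resolution -/

section BarAction

open Coalgebra HopfAlgebra

variable {k : Type u} [Field k] {H : Type w} [Ring H] [HopfAlgebra k H]
  {R : Type v} [Ring R] [Algebra k R] [Module H R] [IsScalarTower k H R]

theorem smul_mul_repr (𝒜 : ℕ → Submodule k R) [IsGradedModuleAlgebra k H 𝒜] {h : H} {ι : Type*}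
    (s : Repr k h ι) (a b : R) :
    h • (a * b) = ∑ i ∈ s.index, (s.left i • a) * (s.right i • b) := by
  rw [IsGradedModuleAlgebra.smul_mul (k := k) (𝒜 := 𝒜), ← s.eq, map_sum, map_sum]
  rfl

theorem smul_comm_scalar (h : H) (c : k) (a : R) : h • (c • a) = c • (h • a) :=
  map_smul (hopfAct (k := k) h) c a

theorem barVal_barAct (h : H) (x : barTerm k R 0) :
    barVal k R (barAct 0 h x) = h • barVal k R x := rfl

theorem barAct_smul_barCons (n : ℕ) {h : H} {ι : Type*} (s : Repr k h ι) (a : R)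
    (x : barTerm k R n) : barAct (n + 1) h (a • barCons n x) =
      ∑ i ∈ s.index, (s.left i • a) • barCons n (barAct n (s.right i) x) := by
  simp only [smul_barCons]
  have h1 : barAct (n + 1) h (barMk n a x) = TensorProduct.lift
      ((TensorProduct.mapBilinear (RingHom.id k) R (barTerm k R n) R (barTerm k R n)).compl₁₂
        hopfAct (barAct n)) (comul h) (a ⊗ₜ[k] x) := rfl
  rw [h1, ← s.eq, map_sum, LinearMap.sum_apply]
  rfl

variable (𝒜 : ℕ → Submodule k R) [IsGradedModuleAlgebra k H 𝒜]

include 𝒜 in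
theorem barAct_smul (n : ℕ) {h : H} {ι : Type*} (s : Repr k h ι) (a : R) (x : barTerm k R n) :
    barAct n h (a • x) = ∑ i ∈ s.index, (s.left i • a) • barAct n (s.right i) x := by
  cases n with
  | zero => exact smul_mul_repr 𝒜 s a (barVal k R x)
  | succ n =>
    induction x using bar_induction with
    | h0 => simp
    | hadd x y hx hy => simp only [smul_add, map_add, hx, hy, Finset.sum_add_distrib]
    | hsmul b y =>
      rw [smul_smul, barAct_smul_barCons n s]
      simp only [barAct_smul_barCons n (ℛ k (s.right _)), smul_mul_repr 𝒜 (ℛ k (s.left _)),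
        Finset.sum_smul, Finset.smul_sum, smul_smul]
      exact sum_sum_left_eq_sum_sum_right
        (fun p q r : H => ((p • a) * (q • b)) • barCons n (barAct n r y))
        (fun _ _ => ⟨fun _ _ => by simp [add_smul, add_mul], fun _ _ => by simp⟩)
        (fun _ _ => ⟨fun _ _ => by simp [add_smul, mul_add], fun _ _ => by simp⟩)
        (fun _ _ => ⟨fun _ _ => by simp, fun c r => by
          simp only [map_smul, LinearMap.smul_apply]; rw [smul_comm]⟩)
        s (fun i => ℛ k (s.left i)) (fun i => ℛ k (s.right i))

include 𝒜 in
theorem barAct_barCons (n : ℕ) (h : H) (x : barTerm k R n) :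
    barAct (n + 1) h (barCons n x) = barCons n (barAct n h x) := by
  rw [← one_smul R (barCons n x), barAct_smul_barCons n (ℛ k h)]
  conv_rhs => rw [← sum_counit_smul (ℛ k h)]
  simp only [IsGradedModuleAlgebra.smul_one (k := k) (𝒜 := 𝒜), map_sum, LinearMap.sum_apply,
    map_smul, LinearMap.smul_apply, algebraMap_smul]

include 𝒜 in
theorem barAct_zero_barOne (h : H) : barAct 0 h (barOne k R) = counit (R := k) h • barOne k R := by
  apply barVal_injective
  rw [barVal_barAct, barVal_barOne, IsGradedModuleAlgebra.smul_one (k := k) (𝒜 := 𝒜), map_smul,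
    barVal_barOne, Algebra.algebraMap_eq_smul_one]

variable {ε : R →ₐ[k] k} (hε : ∀ (h : H) (a : R), ε (h • a) = counit (R := k) h * ε a)

include 𝒜 hε in
theorem barD_barAct (n : ℕ) (h : H) (x : barTerm k R (n + 1)) :
    barD ε n (barAct (n + 1) h x) = barAct n h (barD ε n x) := by
  induction n generalizing h with
  | zero =>
    induction x using bar_induction with
    | h0 => simp
    | hadd x y hx hy => simp only [map_add, hx, hy]
    | hsmul a y =>
      rw [barAct_smul_barCons 0 (ℛ k h), barD_zero_smul_barCons, map_sub, map_sum,
        barAct_smul 𝒜 0 (ℛ k h), barAct_smul 𝒜 0 (ℛ k h), ← Finset.sum_sub_distrib]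
      refine Finset.sum_congr rfl fun i _ => ?_
      rw [barD_zero_smul_barCons, map_smul, barAct_zero_barOne 𝒜, barVal_barAct, hε, smul_smul,
        mul_comm]
  | succ n ih =>
    induction x using bar_induction with
    | h0 => simp
    | hadd x y hx hy => simp only [map_add, hx, hy]
    | hsmul a y =>
      rw [barAct_smul_barCons _ (ℛ k h), barD_succ_smul_barCons, map_sub, map_sum,
        barAct_smul 𝒜 _ (ℛ k h), barAct_smul 𝒜 _ (ℛ k h), ← Finset.sum_sub_distrib]
      refine Finset.sum_congr rfl fun i _ => ?_
      rw [barD_succ_smul_barCons, ih, barAct_barCons 𝒜]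

include 𝒜 hε in
theorem barAct_mem_barCycles {n : ℕ} (h : H) {x : barTerm k R n} (hx : x ∈ barCycles ε n) :
    barAct n h x ∈ barCycles ε n := by
  cases n with
  | zero =>
    rw [mem_barCycles_zero] at hx ⊢
    rw [barVal_barAct, hε, hx, mul_zero]
  | succ n =>
    rw [mem_barCycles_succ, barDiff_apply] at hx ⊢
    rw [barD_barAct 𝒜 hε, hx, map_zero]

theorem barAct_mem_degOneMul {n : ℕ} {G : Submodule k (barTerm k R n)}
    (hG : ∀ h : H, ∀ x ∈ G, barAct n h x ∈ G) (h : H) {x : barTerm k R n}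
    (hx : x ∈ degOneMul 𝒜 n G) : barAct n h x ∈ degOneMul 𝒜 n G := by
  suffices hle : degOneMul 𝒜 n G ≤ (degOneMul 𝒜 n G).comap (barAct n h) from hle hx
  refine Submodule.map₂_le.2 fun v hv g hg => ?_
  change barAct n h (v • g) ∈ degOneMul 𝒜 n G
  rw [barAct_smul 𝒜 n (ℛ k h)]
  exact Submodule.sum_mem _ fun i _ => Submodule.apply_mem_map₂ _
    (IsGradedModuleAlgebra.smul_mem (k := k) 1 _ v hv) (hG _ g hg)

include hε in
theorem barAct_mem_koszulGen (n : ℕ) (h : H) (x : barTerm k R n) (hx : x ∈ koszulGen 𝒜 ε n) :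
    barAct n h x ∈ koszulGen 𝒜 ε n := by
  induction n generalizing h with
  | zero =>
    obtain ⟨c, rfl⟩ := Submodule.mem_span_singleton.1 hx
    rw [map_smul, barAct_zero_barOne 𝒜]
    exact Submodule.smul_mem _ _ (Submodule.smul_mem _ _ (Submodule.mem_span_singleton_self _))
  | succ n ih =>
    obtain ⟨y, hy, hy', rfl⟩ := (mem_koszulGen_succ 𝒜 ε).1 hx
    exact (mem_koszulGen_succ 𝒜 ε).2 ⟨_, barAct_mem_degOneMul 𝒜 ih h hy,
      barAct_mem_barCycles 𝒜 hε h hy', (barAct_barCons 𝒜 n h y).symm⟩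

theorem barAct_mem_barGrade [GradedAlgebra 𝒜] {n m : ℕ} (h : H) {x : barTerm k R n}
    (hx : x ∈ barGrade 𝒜 n m) : barAct n h x ∈ barGrade 𝒜 n m := by
  induction n generalizing m h with
  | zero => exact IsGradedModuleAlgebra.smul_mem (k := k) (𝒜 := 𝒜) m h x hx
  | succ n ih =>
    suffices hle : barGrade 𝒜 (n + 1) m ≤ (barGrade 𝒜 (n + 1) m).comap (barAct (n + 1) h) from
      hle hx
    refine barGrade_succ_le 𝒜 ?_
    rintro i j rfl a ha b hb
    rw [Submodule.mem_comap, barAct_smul_barCons n (ℛ k h)]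
    exact Submodule.sum_mem _ fun _ _ => smul_barCons_mem_barGrade 𝒜
      (IsGradedModuleAlgebra.smul_mem (k := k) i _ a ha) (ih _ hb)

theorem barAct_one (n : ℕ) (x : barTerm k R n) : barAct n (1 : H) x = x := by
  induction n with
  | zero => exact one_smul H (barVal k R x)
  | succ n ih =>
    let s : Repr k (1 : H) Unit := ⟨{()}, fun _ => 1, fun _ => 1, by
      rw [Finset.sum_singleton]; exact (Bialgebra.comul_one).symm⟩
    induction x using bar_induction with
    | h0 => simp
    | hadd x y hx hy => simp only [map_add, hx, hy]
    | hsmul a y =>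
      rw [barAct_smul_barCons n s]
      simp only [s, Finset.sum_singleton, one_smul, ih]

theorem barAct_mul (n : ℕ) (g h : H) (x : barTerm k R n) :
    barAct n (g * h) x = barAct n g (barAct n h x) := by
  induction n generalizing g h with
  | zero => exact mul_smul g h (barVal k R x)
  | succ n ih =>
    induction x using bar_induction with
    | h0 => simp
    | hadd x y hx hy => simp only [map_add, hx, hy]
    | hsmul a y =>
      rw [barAct_smul_barCons n ((ℛ k g).mul (ℛ k h)), barAct_smul_barCons n (ℛ k h), map_sum]
      simp only [barAct_smul_barCons n (ℛ k g), Repr.mul_index, Repr.mul_left, Repr.mul_right,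
        Finset.sum_product_right, mul_smul, ih]

theorem augmentation_smul [GradedAlgebra 𝒜] [IsConnectedGraded 𝒜] (h : H) (a : R) :
    augmentation 𝒜 (h • a) = counit (R := k) h * augmentation 𝒜 a := by
  induction a using DirectSum.Decomposition.inductionOn 𝒜 with
  | zero => simp
  | add x y hx hy => rw [smul_add, map_add, map_add, hx, hy, mul_add]
  | @homogeneous i a =>
    obtain ⟨a, ha⟩ := a
    change augmentation 𝒜 (h • a) = counit (R := k) h * augmentation 𝒜 a
    rcases eq_or_ne i 0 with rfl | hi
    · have ha' := ha
      rw [IsConnectedGraded.zero_eq (𝒜 := 𝒜)] at ha'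
      obtain ⟨c, rfl⟩ := ha'
      rw [Algebra.linearMap_apply, Algebra.algebraMap_eq_smul_one, smul_comm_scalar,
        IsGradedModuleAlgebra.smul_one (k := k) (𝒜 := 𝒜)]
      simp [mul_comm]
    · rw [augmentation_of_mem 𝒜 hi ha,
        augmentation_of_mem 𝒜 hi (IsGradedModuleAlgebra.smul_mem (k := k) i h a ha), mul_zero]

end BarAction

/-! ### Equivariance of the pairing -/

section Equivariance

open Coalgebra HopfAlgebra

variable {k : Type u} [Field k] {H : Type w} [Ring H] [HopfAlgebra k H]
  {R : Type v} [Ring R] [Algebra k R] [Module H R] [IsScalarTower k H R]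
  (𝒜 : ℕ → Submodule k R) [IsGradedModuleAlgebra k H 𝒜]
  {ε : R →ₐ[k] k} (hε : ∀ (h : H) (a : R), ε (h • a) = counit (R := k) h * ε a)

/-- The action of `H` on the generators of the Koszul complex. -/
def koszulAct (n : ℕ) (h : H) : koszulGen 𝒜 ε n →ₗ[k] koszulGen 𝒜 ε n :=
  (barAct n h).restrict (barAct_mem_koszulGen 𝒜 hε n h)

theorem coe_koszulAct (n : ℕ) (h : H) (x : koszulGen 𝒜 ε n) :
    (koszulAct 𝒜 hε n h x : barTerm k R n) = barAct n h x := rfl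

theorem koszulMap_map_koszulAct (n : ℕ) {h : H} {ι : Type*} (s : Repr k h ι)
    (t : R ⊗[k] koszulGen 𝒜 ε n) :
    koszulMap 𝒜 ε n (∑ i ∈ s.index,
      TensorProduct.map (hopfAct (s.left i)) (koszulAct 𝒜 hε n (s.right i)) t) =
    barAct n h (koszulMap 𝒜 ε n t) := by
  rw [map_sum]
  induction t with
  | zero => simp
  | add x y hx hy => simp only [map_add, Finset.sum_add_distrib, hx, hy]
  | tmul a x =>
    rw [koszulMap_tmul, barAct_smul 𝒜 n s]
    rfl

/-- The Koszul differential is `H`-equivariant. -/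
theorem koszulDiff_koszulAct (n : ℕ) {h : H} {ι : Type*} (s : Repr k h ι)
    (x : koszulGen 𝒜 ε (n + 1)) :
    koszulDiff 𝒜 ε n (koszulAct 𝒜 hε (n + 1) h x) = ∑ i ∈ s.index,
      TensorProduct.map (hopfAct (s.left i)) (koszulAct 𝒜 hε n (s.right i))
        (koszulDiff 𝒜 ε n x) := by
  apply koszulMap_injective 𝒜 ε n
  rw [koszulMap_map_koszulAct, koszulMap_koszulDiff, koszulMap_koszulDiff, barDiff_apply,
    barDiff_apply, coe_koszulAct, barD_barAct 𝒜 hε]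

variable [GradedAlgebra 𝒜]

theorem koszulContract_koszulAct (n : ℕ) (f : Module.Dual k (𝒜 1)) {h : H} {ι : Type*}
    (s : Repr k h ι) (x : koszulGen 𝒜 ε (n + 1)) :
    koszulContract 𝒜 ε n f (koszulAct 𝒜 hε (n + 1) h x) = ∑ i ∈ s.index,
      koszulAct 𝒜 hε n (s.right i) (koszulContract 𝒜 ε n (dualAct 𝒜 f (s.left i)) x) := by
  simp only [koszulContract_apply]
  rw [koszulDiff_koszulAct 𝒜 hε n s, map_sum]
  refine Finset.sum_congr rfl fun i _ => ?_
  obtain ⟨t, ht⟩ := koszulDiff_mem_range 𝒜 ε n x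
  rw [← ht]
  clear ht
  induction t with
  | zero => simp
  | add x y hx hy => simp only [map_add, hx, hy]
  | tmul v g =>
    rw [LinearMap.rTensor_tmul, TensorProduct.map_tmul, contractFirst_tmul, contractFirst_tmul,
      map_smul, Submodule.subtype_apply, degOnePart_coe, dualAct_apply]
    congr 2
    exact degOnePart_coe 𝒜 (degOneAct 𝒜 (s.left i) v)

omit [GradedAlgebra 𝒜] in
theorem quadraticDualAct_mul_repr (x y : QuadraticDual 𝒜) {h : H} {ι : Type*} (s : Repr k h ι) :
    quadraticDualAct 𝒜 (x * y) h = ∑ i ∈ s.index,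
      quadraticDualAct 𝒜 x (s.right i) * quadraticDualAct 𝒜 y (s.left i) := by
  rw [quadraticDualAct_mul, ← s.eq, map_sum, map_sum, map_sum]
  rfl

omit [GradedAlgebra 𝒜] in
theorem quadraticDualAct_add (x y : QuadraticDual 𝒜) (h : H) :
    quadraticDualAct 𝒜 (x + y) h = quadraticDualAct 𝒜 x h + quadraticDualAct 𝒜 y h := by
  simp [quadraticDualAct]

omit [GradedAlgebra 𝒜] in
theorem quadraticDualAct_smul (c : k) (x : QuadraticDual 𝒜) (h : H) :
    quadraticDualAct 𝒜 (c • x) h = c • quadraticDualAct 𝒜 x h := by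
  simp [quadraticDualAct]

omit [GradedAlgebra 𝒜] in
theorem quadraticDualAct_mem {n : ℕ} {y : QuadraticDual 𝒜} (hy : y ∈ quadraticDualComponent 𝒜 n)
    (h : H) : quadraticDualAct 𝒜 y h ∈ quadraticDualComponent 𝒜 n := by
  induction n generalizing y h with
  | zero =>
    rw [quadraticDualComponent, pow_zero] at hy ⊢
    obtain ⟨c, rfl⟩ := Submodule.mem_one.1 hy
    rw [Algebra.algebraMap_eq_smul_one, quadraticDualAct_smul, quadraticDualAct_one]
    exact Submodule.smul_mem _ _ (Submodule.algebraMap_mem _)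
  | succ n ih =>
    rw [quadraticDualComponent, pow_succ] at hy
    induction hy using Submodule.mul_induction_on' with
    | mem_mul_mem x hx z hz =>
      obtain ⟨f, rfl⟩ := hz
      rw [quadraticDualAct_mul_repr 𝒜 _ _ (ℛ k h), quadraticDualComponent, pow_succ]
      exact Submodule.sum_mem _ fun i _ => Submodule.mul_mem_mul (ih hx _)
        ⟨_, (quadraticDualAct_ι 𝒜 f _).symm⟩
    | add x _ y _ hx hy =>
      rw [quadraticDualAct_add]
      exact add_mem hx hy

/-- The action of `H` on `R^!_n` is transposed to the action on the generators `G_n` of the Koszul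
complex. -/
theorem koszulPairing_quadraticDualAct {n : ℕ} {y : QuadraticDual 𝒜}
    (hy : y ∈ quadraticDualComponent 𝒜 n) (h : H) (x : koszulGen 𝒜 ε n) :
    koszulPairing 𝒜 ε n (quadraticDualAct 𝒜 y h) x =
      koszulPairing 𝒜 ε n y (koszulAct 𝒜 hε n h x) := by
  induction n generalizing y h with
  | zero =>
    rw [quadraticDualComponent, pow_zero] at hy
    obtain ⟨c, rfl⟩ := Submodule.mem_one.1 hy
    rw [Algebra.algebraMap_eq_smul_one, quadraticDualAct_smul, quadraticDualAct_one,
      Algebra.algebraMap_eq_smul_one, map_smul, map_smul, map_smul]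
    simp only [LinearMap.smul_apply, koszulPairing_one, coe_koszulAct, barVal_barAct, hε,
      smul_eq_mul]
  | succ n ih =>
    rw [quadraticDualComponent, pow_succ] at hy
    induction hy using Submodule.mul_induction_on' with
    | mem_mul_mem y hy z hz =>
      obtain ⟨f, rfl⟩ := hz
      rw [quadraticDualAct_mul_repr 𝒜 _ _ (ℛ k h), koszulPairing_mul_ι,
        koszulContract_koszulAct 𝒜 hε n f (ℛ k h), map_sum, map_sum, LinearMap.sum_apply]
      refine Finset.sum_congr rfl fun i _ => ?_
      rw [quadraticDualAct_ι, koszulPairing_mul_ι, ih hy]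
    | add y _ z _ hy hz =>
      rw [quadraticDualAct_add, map_add, map_add, LinearMap.add_apply, LinearMap.add_apply, hy, hz]

end Equivariance

/-! ### The Hopf action on cochains -/

section CochainAction

open Coalgebra HopfAlgebra

variable {k : Type u} [Field k] {H : Type w} [Ring H] [HopfAlgebra k H]
  {R : Type v} [Ring R] [Algebra k R] [Module H R] [IsScalarTower k H R]
  (hS : Function.Bijective (antipode k (A := H)))

/-- In terms of `g = S⁻¹(h)`, the action of `h` on cochains is
`(h · F)(x) = ∑ S(g₁) F(g₂ x)`. -/
theorem cochainAct_antipode (n : ℕ) {g : H} {ι : Type*} (s : Repr k g ι)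
    (F : barTerm k R n →ₗ[k] R) (x : barTerm k R n) :
    cochainAct hS n (antipode k g) F x =
      ∑ i ∈ s.index, antipode k (s.left i) • F (barAct n (s.right i) x) := by
  rw [cochainAct, ← (antipodeRepr s).eq, map_sum, LinearMap.sum_apply]
  refine Finset.sum_congr rfl fun i _ => ?_
  have h : (LinearEquiv.ofBijective (antipode k (A := H)) hS).symm (antipode k (s.right i)) =
      s.right i := (LinearEquiv.ofBijective (antipode k (A := H)) hS).symm_apply_apply _
  change antipode k (s.left i) • F (barAct n ((LinearEquiv.ofBijective (antipode k (A := H))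
    hS).symm (antipode k (s.right i))) x) = _
  rw [h]

variable (𝒜 : ℕ → Submodule k R) [IsGradedModuleAlgebra k H 𝒜]

include 𝒜 in
/-- `∑ S(g₁) ((g₂ a) b) = a (S(g) b)`. -/
theorem sum_antipode_smul_smul_mul {g : H} (a b : R) :
    ∑ i ∈ (ℛ k g).index, antipode k ((ℛ k g).left i) • (((ℛ k g).right i • a) * b) =
      a * (antipode k g • b) := by
  have h1 := sum_sum_left_eq_sum_sum_right (k := k)
    (fun p q r : H => (antipode k q • r • a) * (antipode k p • b))
    (fun _ _ => ⟨fun _ _ => by simp [add_smul, mul_add], fun _ _ => by simp⟩)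
    (fun _ _ => ⟨fun _ _ => by simp [add_smul, add_mul], fun _ _ => by simp⟩)
    (fun _ _ => ⟨fun _ _ => by simp [add_smul, add_mul], fun _ _ => by
      simp [smul_comm_scalar]⟩)
    (ℛ k g) (fun i => ℛ k _) (fun i => ℛ k _)
  calc _ = ∑ i ∈ (ℛ k g).index, ∑ j ∈ (ℛ k ((ℛ k g).left i)).index,
        (antipode k ((ℛ k ((ℛ k g).left i)).right j) • (ℛ k g).right i • a) *
          (antipode k ((ℛ k ((ℛ k g).left i)).left j) • b) :=
        Finset.sum_congr rfl fun i _ => smul_mul_repr 𝒜 (antipodeRepr (ℛ k ((ℛ k g).left i))) _ _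
    _ = _ := h1
    _ = a * (antipode k (∑ i ∈ (ℛ k g).index,
          counit (R := k) ((ℛ k g).right i) • (ℛ k g).left i) • b) := by
        rw [map_sum, Finset.sum_smul, Finset.mul_sum]
        refine Finset.sum_congr rfl fun i _ => ?_
        simp only [smul_smul, ← Finset.sum_mul, ← Finset.sum_smul, sum_antipode_mul_eq_smul]
        simp
    _ = _ := by rw [sum_counit_right_smul]

include 𝒜 in
/-- The action of `H` on cochains preserves `R`-linearity. -/
theorem cochainAct_smul {n : ℕ} (h : H) {F : barTerm k R n →ₗ[k] R}
    (hF : ∀ (a : R) x, F (a • x) = a * F x) (a : R) (x : barTerm k R n) :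
    cochainAct hS n h F (a • x) = a * cochainAct hS n h F x := by
  obtain ⟨g, rfl⟩ := hS.2 h
  rw [cochainAct_antipode hS n (ℛ k g), cochainAct_antipode hS n (ℛ k g)]
  simp only [barAct_smul 𝒜 n (ℛ k _), map_sum, hF, Finset.smul_sum]
  rw [← sum_sum_left_eq_sum_sum_right (k := k)
    (fun p q r : H => antipode k p • ((q • a) * F (barAct n r x)))
    (fun _ _ => ⟨fun _ _ => by simp [add_smul], fun _ _ => by simp⟩)
    (fun _ _ => ⟨fun _ _ => by simp [add_smul, add_mul], fun _ _ => by simp [smul_comm_scalar]⟩)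
    (fun _ _ => ⟨fun _ _ => by simp [mul_add], fun _ _ => by simp [smul_comm_scalar]⟩)
    (ℛ k g) (fun i => ℛ k _) (fun i => ℛ k _), Finset.mul_sum]
  exact Finset.sum_congr rfl fun i _ => sum_antipode_smul_smul_mul 𝒜 _ _

theorem smul_mem_intGrade {j : ℤ} (h : H) {a : R} (ha : a ∈ intGrade 𝒜 j) :
    h • a ∈ intGrade 𝒜 j := by
  unfold intGrade at ha ⊢
  split_ifs at ha ⊢
  · exact IsGradedModuleAlgebra.smul_mem (k := k) _ h a ha
  · rw [(Submodule.mem_bot k).1 ha, smul_zero]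
    exact Submodule.zero_mem _

variable [GradedAlgebra 𝒜] [IsConnectedGraded 𝒜]

theorem cochainAct_mem_barCocycle {n : ℕ} {j : ℤ} (h : H) {F : barTerm k R n →ₗ[k] R}
    (hF : F ∈ barCocycle 𝒜 (augmentation 𝒜) n j) :
    cochainAct hS n h F ∈ barCocycle 𝒜 (augmentation 𝒜) n j := by
  obtain ⟨⟨hF1, hF2⟩, hF3⟩ := hF
  refine ⟨⟨fun a x => cochainAct_smul hS 𝒜 h hF1 a x, fun m x hx => ?_⟩, ?_⟩
  · obtain ⟨g, rfl⟩ := hS.2 h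
    rw [cochainAct_antipode hS n (ℛ k g)]
    exact Submodule.sum_mem _ fun i _ =>
      smul_mem_intGrade 𝒜 _ (hF2 m _ (barAct_mem_barGrade 𝒜 _ hx))
  · obtain ⟨g, rfl⟩ := hS.2 h
    refine LinearMap.ext fun x => ?_
    change cochainAct hS n _ F (barD (augmentation 𝒜) n x) = 0
    rw [cochainAct_antipode hS n (ℛ k g)]
    refine Finset.sum_eq_zero fun i _ => ?_
    rw [← barD_barAct 𝒜 (augmentation_smul 𝒜)]
    have h0 : F (barD (augmentation 𝒜) n (barAct (n + 1) ((ℛ k g).right i) x)) = 0 :=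
      LinearMap.congr_fun hF3 _
    rw [h0, smul_zero]

/-- The reduction of `S(g) · F` is the reduction of `F` composed with the action of `g`: the factor
`S(g₁)` acts on `k` by the counit. -/
theorem augmentation_cochainAct (n : ℕ) (g : H) (F : barTerm k R n →ₗ[k] R) (x : barTerm k R n) :
    augmentation 𝒜 (cochainAct hS n (antipode k g) F x) = augmentation 𝒜 (F (barAct n g x)) := by
  rw [cochainAct_antipode hS n (ℛ k g), map_sum]
  conv_rhs => rw [← sum_counit_smul (ℛ k g)]
  simp only [augmentation_smul, counit_antipode, map_sum, map_smul, LinearMap.sum_apply,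
    LinearMap.smul_apply, smul_eq_mul]

end CochainAction

/-! ### The homological determinant -/

section

variable {k : Type u} [Field k] {R : Type v} [Ring R] [Algebra k R]
  (𝒜 : ℕ → Submodule k R) [GradedAlgebra 𝒜] [IsConnectedGraded 𝒜]

theorem augmentation_iSup_barCoboundary {n : ℕ} {F : barTerm k R n →ₗ[k] R}
    (hF : F ∈ ⨆ j, barCoboundary 𝒜 (augmentation 𝒜) n j) {g : barTerm k R n}
    (hg : g ∈ koszulGen 𝒜 (augmentation 𝒜) n) : augmentation 𝒜 (F g) = 0 := by
  induction hF using Submodule.iSup_induction' with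
  | mem j F hF => exact augmentation_barCoboundary 𝒜 hF hg
  | zero => simp
  | add F G _ _ hF hG => rw [LinearMap.add_apply, map_add, hF, hG, add_zero]

variable {𝒜}

/-- A cocycle whose reduction on `G_d` vanishes is a coboundary. -/
theorem IsKoszulTop.mem_iSup_barCoboundary {d : ℕ} (hT : IsKoszulTop 𝒜 d)
    {F : barTerm k R d →ₗ[k] R} (hF : F ∈ ⨆ j, barCocycle 𝒜 (augmentation 𝒜) d j)
    (h : ∀ g ∈ koszulGen 𝒜 (augmentation 𝒜) d, augmentation 𝒜 (F g) = 0) :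
    F ∈ ⨆ j, barCoboundary 𝒜 (augmentation 𝒜) d j := by
  -- up to coboundaries, `F` is homogeneous of degree `-d`
  obtain ⟨F₀, hF₀, hFF₀⟩ : ∃ F₀ ∈ barCocycle 𝒜 (augmentation 𝒜) d (-d),
      F - F₀ ∈ ⨆ j, barCoboundary 𝒜 (augmentation 𝒜) d j := by
    clear h
    induction hF using Submodule.iSup_induction' with
    | mem j F hF =>
      rcases eq_or_ne j (-d) with rfl | hj
      · exact ⟨F, hF, by rw [sub_self]; exact zero_mem _⟩
      · refine ⟨0, zero_mem _, ?_⟩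
        rw [sub_zero]
        exact Submodule.mem_iSup_of_mem j (hT.mem_barCoboundary_of_ne j hj F hF)
    | zero => exact ⟨0, zero_mem _, by rw [sub_self]; exact zero_mem _⟩
    | add F G _ _ hF hG =>
      obtain ⟨F₀, hF₀, hF⟩ := hF
      obtain ⟨G₀, hG₀, hG⟩ := hG
      exact ⟨F₀ + G₀, add_mem hF₀ hG₀, by rw [add_sub_add_comm]; exact add_mem hF hG⟩
  rw [← sub_add_cancel F F₀]
  refine add_mem hFF₀ (Submodule.mem_iSup_of_mem (-d : ℤ) (hT.mem_barCoboundary F₀ hF₀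
    fun g hg => ?_))
  have h' := augmentation_iSup_barCoboundary 𝒜 hFF₀ hg
  rwa [LinearMap.sub_apply, map_sub, h g hg, zero_sub, neg_eq_zero] at h'

/-- If the generators of degree `d` of the Koszul complex form a line, then so does the component
of degree `d` of the quadratic dual. -/
theorem exists_quadraticDual_generator [FiniteDimensional k (𝒜 1)] {d : ℕ} {γ : barTerm k R d}
    (hγ0 : γ ≠ 0) (hγ : koszulGen 𝒜 (augmentation 𝒜) d = Submodule.span k {γ}) :
    ∃ lam : QuadraticDual 𝒜, lam ≠ 0 ∧ quadraticDualComponent 𝒜 d = Submodule.span k {lam} := by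
  have hγmem : γ ∈ koszulGen 𝒜 (augmentation 𝒜) d := hγ ▸ Submodule.mem_span_singleton_self γ
  obtain ⟨lam, hlam, hne⟩ := exists_koszulPairing_ne_zero 𝒜 (augmentation 𝒜) d ⟨γ, hγmem⟩
    fun h => hγ0 (congrArg Subtype.val h)
  refine ⟨lam, fun h => hne (by rw [h, map_zero, LinearMap.zero_apply]),
    le_antisymm (fun y hy => ?_) ((Submodule.span_singleton_le_iff_mem _ _).2 hlam)⟩
  refine Submodule.mem_span_singleton.2 ⟨koszulPairing 𝒜 (augmentation 𝒜) d y ⟨γ, hγmem⟩ /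
    koszulPairing 𝒜 (augmentation 𝒜) d lam ⟨γ, hγmem⟩, ?_⟩
  refine (sub_eq_zero.1 (eq_zero_of_koszulPairing 𝒜 (augmentation 𝒜)
    (fun v hv => augmentation_of_mem 𝒜 one_ne_zero hv) d _
    (sub_mem hy (Submodule.smul_mem _ _ hlam)) fun x => ?_)).symm
  obtain ⟨x, hx⟩ := x
  have hx' := hx
  rw [hγ] at hx'
  obtain ⟨c, rfl⟩ := Submodule.mem_span_singleton.1 hx'
  have hcx : (⟨c • γ, hx⟩ : koszulGen 𝒜 (augmentation 𝒜) d) = c • ⟨γ, hγmem⟩ := rfl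
  rw [hcx, map_smul, map_sub, map_smul, LinearMap.sub_apply, LinearMap.smul_apply, smul_eq_mul,
    smul_eq_mul, div_mul_cancel₀ _ hne, sub_self, mul_zero]

end

section HomologicalDeterminant

open Coalgebra HopfAlgebra

variable {k : Type u} [Field k] {H : Type w} [Ring H] [HopfAlgebra k H]
  {R : Type v} [Ring R] [Algebra k R] [Module H R] [IsScalarTower k H R]
  (𝒜 : ℕ → Submodule k R) [GradedAlgebra 𝒜] [IsConnectedGraded 𝒜] [IsGradedModuleAlgebra k H 𝒜]
  (hS : Function.Bijective (antipode k (A := H)))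

/-- If the generators of degree `d` of the Koszul complex form a line, then `H` acts on this line by
a character. -/
theorem exists_koszul_character {d : ℕ} {γ : barTerm k R d} (hγ0 : γ ≠ 0)
    (hγ : koszulGen 𝒜 (augmentation 𝒜) d = Submodule.span k {γ}) :
    ∃ χ : H →ₐ[k] k, ∀ h, barAct d h γ = χ h • γ := by
  have hmem (h : H) : ∃ c : k, c • γ = barAct d h γ := by
    rw [← Submodule.mem_span_singleton, ← hγ]
    exact barAct_mem_koszulGen 𝒜 (augmentation_smul 𝒜) d h γ
      (hγ ▸ Submodule.mem_span_singleton_self γ)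
  choose c hc using hmem
  have hinj {a b : k} (h : a • γ = b • γ) : a = b := smul_left_injective k hγ0 h
  refine ⟨AlgHom.ofLinearMap ⟨⟨c, fun g h => hinj ?_⟩, fun r h => hinj ?_⟩ (hinj ?_)
    fun g h => hinj ?_, fun h => (hc h).symm⟩
  · rw [hc, add_smul, hc, hc, map_add, LinearMap.add_apply]
  · rw [hc, RingHom.id_apply, smul_eq_mul, mul_smul, hc, map_smul, LinearMap.smul_apply]
  · exact (hc 1).trans ((barAct_one d γ).trans (one_smul k γ).symm)
  · change c (g * h) • γ = (c g * c h) • γ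
    rw [hc, barAct_mul, ← hc h, map_smul, ← hc g, smul_smul, mul_comm]

/-- The composite of a character with the inverse of the antipode. -/
theorem exists_character_antipode (χ : H →ₐ[k] k) (hS : Function.Bijective (antipode k (A := H))) :
    ∃ η : H →ₐ[k] k, ∀ h, η (antipode k h) = χ h := by
  let e := LinearEquiv.ofBijective (antipode k (A := H)) hS
  have he (h : H) : e.symm (antipode k h) = h := e.symm_apply_apply h
  refine ⟨AlgHom.ofLinearMap (χ.toLinearMap ∘ₗ e.symm.toLinearMap) ?_ fun a b => ?_, fun h => ?_⟩
  · change χ (e.symm 1) = 1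
    rw [← antipode_one (R := k), he, map_one]
  · obtain ⟨a, rfl⟩ := hS.2 a
    obtain ⟨b, rfl⟩ := hS.2 b
    change χ (e.symm _) = χ (e.symm _) * χ (e.symm _)
    rw [← antipode_mul_antidistrib, he, he, he, map_mul, mul_comm]
  · exact congrArg χ (he h)

variable {𝒜} {d : ℕ} (hT : IsKoszulTop 𝒜 d) {γ : barTerm k R d}
  (hγ : koszulGen 𝒜 (augmentation 𝒜) d = Submodule.span k {γ})
  {χ : H →ₐ[k] k} (hχ : ∀ h, barAct d h γ = χ h • γ)

include hT hγ hχ in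
/-- The character by which `H` acts on the top generator of the Koszul complex is a homological
determinant. -/
theorem isHomologicalDeterminant_character : IsHomologicalDeterminant 𝒜 hS χ.toLinearMap := by
  obtain ⟨η, hη⟩ := exists_character_antipode χ hS
  obtain ⟨F, hF, g, hg, hFg⟩ := hT.exists_cocycle
  refine ⟨d, hT.selfInjectiveDimension_eq, F, Submodule.mem_iSup_of_mem _ hF, fun hcob => hFg ?_, η,
    fun h => Submodule.mem_iSup_of_mem (-d : ℤ) (hT.mem_barCoboundary _ (sub_mem
      (cochainAct_mem_barCocycle hS 𝒜 h hF) (Submodule.smul_mem _ _ hF)) fun g hg => ?_),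
    LinearMap.ext fun h => (hη h).symm⟩
  · exact augmentation_iSup_barCoboundary 𝒜 hcob hg
  · obtain ⟨h, rfl⟩ := hS.2 h
    rw [hγ] at hg
    obtain ⟨c, rfl⟩ := Submodule.mem_span_singleton.1 hg
    rw [LinearMap.sub_apply, map_sub, augmentation_cochainAct hS 𝒜, LinearMap.smul_apply, hη,
      map_smul (barAct d h), hχ]
    simp only [map_smul, smul_eq_mul]
    ring

include hT hγ hχ in
/-- A homological determinant is the character by which `H` acts on the top generator of the Koszul
complex. -/
theorem IsHomologicalDeterminant.eq_character {hdet : H →ₗ[k] k}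
    (h : IsHomologicalDeterminant 𝒜 hS hdet) : hdet = χ.toLinearMap := by
  obtain ⟨n, hn, F, hF, hF0, η, hη, rfl⟩ := h
  obtain rfl : n = d := by
    rw [hT.selfInjectiveDimension_eq] at hn
    exact_mod_cast hn.symm
  have hγmem : γ ∈ koszulGen 𝒜 (augmentation 𝒜) n := hγ ▸ Submodule.mem_span_singleton_self γ
  have hFγ : augmentation 𝒜 (F γ) ≠ 0 := fun h0 => hF0 (hT.mem_iSup_barCoboundary hF fun g hg => by
    rw [hγ] at hg
    obtain ⟨c, rfl⟩ := Submodule.mem_span_singleton.1 hg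
    rw [map_smul, map_smul, h0, smul_zero])
  ext h
  have h1 := augmentation_iSup_barCoboundary 𝒜 (hη (antipode k h)) hγmem
  rw [LinearMap.sub_apply, map_sub, augmentation_cochainAct hS 𝒜, LinearMap.smul_apply, hχ,
    map_smul F, map_smul, map_smul, ← sub_smul, smul_eq_mul] at h1
  have h2 := (mul_eq_zero.1 h1).resolve_right hFγ
  exact (sub_eq_zero.1 h2).symm

include hγ hχ in
/-- `H` acts on the component of degree `d` of the quadratic dual by the same character as on the
top generator of the Koszul complex. -/
theorem quadraticDualAct_eq_character_smul [FiniteDimensional k (𝒜 1)] {y : QuadraticDual 𝒜}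
    (hy : y ∈ quadraticDualComponent 𝒜 d) (h : H) : quadraticDualAct 𝒜 y h = χ h • y := by
  refine sub_eq_zero.1 (eq_zero_of_koszulPairing 𝒜 (augmentation 𝒜)
    (fun v hv => augmentation_of_mem 𝒜 one_ne_zero hv) d _
    (sub_mem (quadraticDualAct_mem 𝒜 hy h) (Submodule.smul_mem _ _ hy)) fun x => ?_)
  have hx : koszulAct 𝒜 (augmentation_smul 𝒜) d h x = χ h • x := by
    obtain ⟨x, hx⟩ := x
    have hx' := hx
    rw [hγ] at hx'
    obtain ⟨c, rfl⟩ := Submodule.mem_span_singleton.1 hx'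
    ext
    rw [coe_koszulAct, Submodule.coe_smul, map_smul, hχ, smul_comm]
  rw [map_sub, LinearMap.sub_apply, koszulPairing_quadraticDualAct 𝒜 (augmentation_smul 𝒜) hy, hx,
    map_smul, map_smul, LinearMap.smul_apply, sub_self]

end HomologicalDeterminant
end

theorem mainTheorem4 {k : Type u} [Field k] [IsAlgClosed k] [CharZero k]
    {H : Type w} [Ring H] [HopfAlgebra k H]
    (hS : Function.Bijective (HopfAlgebra.antipode k (A := H)))
    {R : Type v} [Ring R] [Algebra k R] [Module H R] [IsScalarTower k H R]
    (𝒜 : ℕ → Submodule k R) [GradedAlgebra 𝒜] [IsConnectedGraded 𝒜]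
    [IsGradedModuleAlgebra k H 𝒜]
    (hNoeth : IsNoetherianRing R) (hNoethOp : IsNoetherianRing Rᵐᵒᵖ)
    (hKoszul : IsKoszul 𝒜) (hReg : IsASRegular 𝒜)
    (d : ℕ) (hd : globalDimension R = d) :
    ∃ lam : QuadraticDual 𝒜, lam ≠ 0 ∧ quadraticDualComponent 𝒜 d = Submodule.span k {lam} ∧
      (∃ hdet : H →ₗ[k] k, IsHomologicalDeterminant 𝒜 hS hdet) ∧
      ∀ hdet : H →ₗ[k] k, IsHomologicalDeterminant 𝒜 hS hdet →
        ∀ h : H, hdet h • lam = quadraticDualAct 𝒜 lam h := by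
  obtain ⟨hQ, ⟨L⟩⟩ := hKoszul
  obtain ⟨⟨n, l, hG⟩, -⟩ := hReg
  have := hQ.finite
  have hT := isKoszulTop 𝒜 L hG hd
  obtain ⟨γ, hγ0, hγ⟩ := hT.exists_generator
  obtain ⟨χ, hχ⟩ := exists_koszul_character (H := H) 𝒜 hγ0 hγ
  obtain ⟨lam, hlam0, hlam⟩ := exists_quadraticDual_generator hγ0 hγ
  refine ⟨lam, hlam0, hlam, ⟨_, isHomologicalDeterminant_character hS hT hγ hχ⟩,
    fun hdet hhdet h => ?_⟩
  rw [hhdet.eq_character hS hT hγ hχ, quadraticDualAct_eq_character_smul hγ hχ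
    (hlam ▸ Submodule.mem_span_singleton_self lam)]
  rfl
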